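/- Let $\mathbb K$ be a field of characteristic zero. A bi-directed graph is a finite directed multigraph (loops and multiple edges allowed) on vertices $1,\dots,N$, $N\ge 1$, whose edges carry, besides their own (black) arrow, a red arrow that is parallel or opposite to the black one. Let $\mathsf{Gra}^{2}_3(N)$ be the $\mathbb K$-span of such graphs with unlabelled, commuting edges, with partial compositions $\circ_i$ given by inserting a graph into the vertex $i$ and summing over all reattachments of the half-edges at $i$. Let $\mathsf{fcGC}_3^{2}$ be the span, inside $\bigoplus_{N\ge1}\big(\mathsf{Gra}^2_3(N)\otimes\mathrm{sgn}_N\big)^{\mathbb S_N}$, of the combinations of connected graphs, with graded Lie bracket $[f,g]=f\circ g-(-1)^{(M-1)(N-1)}g\circ f$, $\;f\circ g=\sum_{\sigma}\mathrm{sgn}(\sigma)\,\sigma\cdot(f\circ_1 g)$ (sum over the $(N,M-1)$-shuffles, for $f$ of arity $M$ and $g$ of arity $N$), and differential $\delta=[\Upsilon_{\mathsf S},\cdot]$, where $\Upsilon_{\mathsf S}$ is the black arrow $1\to2$ minus the black arrow $2\to1$, summed over the two directions of the red arrow. Let $\mathsf{fcGC}^{2|\rm black}_3$ (resp. $\mathsf{fcGC}^{2|2}_3$)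 be the subcomplex spanned by graphs without black cycles (resp. with neither black nor red cycles). A graph is of shape $A$, $B$, $C$ if the underlying undirected graph consists of two vertices joined by three internally disjoint paths of lengths $(1,2,3)$, $(2,2,2)$, $(1,3,3)$ respectively. Consider the pairs $(\Theta,\vartheta)$ with $\Theta\in\mathsf{fcGC}^{2|2}_3$ and $\vartheta\in\mathsf{fcGC}^{2|\rm black}_3$ such that (i) $\Theta=-\delta\vartheta$; (ii) $\Theta$ contains only graphs of shape $C$; (iii) each graph of $\vartheta$ contains at least one red cycle. Then there is such a pair $(\Theta_3,\vartheta_3)$ in which all graphs of $\vartheta_3$ are of shape $A$ or $B$ and $\Theta_3$ is not exact in $\mathsf{fcGC}_3^{2|2}$ (so $\Theta_3$ represents a non-trivial class of $\mathsf{fcGC}^{2|2}_3$ which becomes exact in $\mathsf{fcGC}^{2|\rm black}_3$; in particular $\Theta_3\ne0$ and $\vartheta_3\neq 0$), and it is unique up to a scalar: for every pair $(\Theta',\vartheta')$ satisfying (i)-(iii) there is $c\in\mathbb K$ with $\Theta'=c\,\Theta_3$, and if moreover all graphs of $\vartheta'$ are of shape $A$ or $B$, then $c$ can be chosen so that also $\vartheta'=c\,\vartheta_3$.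 -/

import Mathlib

noncomputable section

namespace BiGC

/-! ### Bi-directed graphs -/

/-- A bi-directed edge between vertices in `V`: `(s, t, r)` carries a black arrow from `s` to `t`,
and a red arrow from `s` to `t` if `r = true`, from `t` to `s` if `r = false`. -/
abbrev BiEdge (V : Type) : Type := V × V × Bool

/-- Renaming the end points of an edge. -/
def BiEdge.map {V W : Type} (f : V → W) (e : BiEdge V) : BiEdge W := (f e.1, f e.2.1, e.2.2)

/-- Bi-directed multigraphs on the vertex set `V` (loops and multiple edges are allowed), with
unlabelled edges: a finite multiset of bi-directed edges, given by its multiplicities. -/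
abbrev BiGraph (V : Type) : Type := BiEdge V →₀ ℕ

namespace BiGraph

variable {V : Type}

/-- There is a black arrow from `u` to `v`. -/
def Black (G : BiGraph V) (u v : V) : Prop :=
  ∃ e ∈ G.support, e.1 = u ∧ e.2.1 = v

/-- There is a red arrow from `u` to `v`. -/
def Red (G : BiGraph V) (u v : V) : Prop :=
  ∃ e ∈ G.support, (e.2.2 = true ∧ e.1 = u ∧ e.2.1 = v) ∨ (e.2.2 = false ∧ e.1 = v ∧ e.2.1 = u)

/-- There is a cycle (non-trivial directed path from a vertex to itself) of black arrows. -/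
def HasBlackCycle (G : BiGraph V) : Prop := ∃ v, Relation.TransGen G.Black v v

/-- There is a cycle (non-trivial directed path from a vertex to itself) of red arrows. -/
def HasRedCycle (G : BiGraph V) : Prop := ∃ v, Relation.TransGen G.Red v v

/-- The graph is connected (directions being forgotten). -/
def Connected (G : BiGraph V) : Prop := (SimpleGraph.fromRel G.Black).Connected

/-- The undirected multigraph underlying `G`, as the multiset of its edges. -/
def shape (G : BiGraph V) : Multiset (Sym2 V) :=
  (Finsupp.toMultiset G).map fun e => s(e.1, e.2.1)

/-- The undirected multigraph underlying `G` is isomorphic to the one on `Fin n` with edges `S`. -/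
def HasShape {n : ℕ} (G : BiGraph V) (S : Multiset (Sym2 (Fin n))) : Prop :=
  ∃ φ : Fin n ≃ V, S.map (Sym2.map φ) = G.shape

end BiGraph

/-- The theta graph with five vertices and arms of lengths 1, 2, 3. -/
def shapeA : Multiset (Sym2 (Fin 5)) :=
  {s(2, 4), s(3, 1), s(3, 4), s(3, 0), s(1, 0), s(2, 1)}

/-- The theta graph with five vertices and arms of lengths 2, 2, 2. -/
def shapeB : Multiset (Sym2 (Fin 5)) :=
  {s(2, 4), s(3, 1), s(3, 4), s(3, 0), s(2, 0), s(2, 1)}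

/-- The theta graph with six vertices and arms of lengths 1, 3, 3. -/
def shapeC : Multiset (Sym2 (Fin 6)) :=
  {s(3, 0), s(3, 1), s(2, 3), s(2, 5), s(5, 0), s(4, 1), s(2, 4)}

/-! ### The operad of bi-directed graphs in dimension 3 -/

variable (K : Type*) [Field K]

/-- The arity `p + 1` part of the operad of bi-directed graphs in dimension 3: the linear
combinations of bi-directed multigraphs on the vertices `0, …, p`.  For `d = 3` edges have the even
degree `-2`, so that they are unlabelled and commute; the space is thus the polynomial algebra on
the possible edges, each monomial being a multigraph. -/
abbrev Gra (p : ℕ) : Type _ := MvPolynomial (BiEdge (Fin (p + 1))) K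

variable {K}

/-- The action of permutations of the vertices. -/
def Gra.perm {p : ℕ} (σ : Equiv.Perm (Fin (p + 1))) (a : Gra K p) : Gra K p :=
  MvPolynomial.rename (BiEdge.map σ) a

/-- When the vertex `0` of a graph on `0, …, p` is replaced by a graph on `q + 1` vertices, a half
edge at vertex `0` can be attached to any of `0, …, q`, and a half edge at the vertex `i > 0` is
now at `i + q`. -/
def attach (p q : ℕ) (i : Fin (p + 1)) : Finset (Fin (p + q + 1)) :=
  Finset.univ.filter fun v => if i.val = 0 then v.val ≤ q else v.val = i.val + q

/-- The sum of all the ways of reattaching an edge. -/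
def reattach (p q : ℕ) (e : BiEdge (Fin (p + 1))) : Gra K (p + q) :=
  ∑ u ∈ attach p q e.1, ∑ w ∈ attach p q e.2.1, MvPolynomial.X (u, w, e.2.2)

/-- The partial composition of `a` and `b` at the first vertex of `a`: this vertex is replaced by
`b`, with the sum over all the ways of reattaching the half edges that were incident to it. -/
def Gra.comp {p q : ℕ} (a : Gra K p) (b : Gra K q) : Gra K (p + q) :=
  MvPolynomial.aeval (reattach p q) a *
    MvPolynomial.rename (BiEdge.map (Fin.castLE (by omega : q + 1 ≤ p + q + 1))) b

/-- The shuffles: permutations of `0, …, p + q` that are increasing on `0, …, q` and on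
`q + 1, …, p + q`. -/
def shuffles (p q : ℕ) : Finset (Equiv.Perm (Fin (p + q + 1))) :=
  Finset.univ.filter fun σ =>
    ∀ i j : Fin (p + q + 1), i < j → (j.val ≤ q ∨ q < i.val) → σ i < σ j

/-- The pre-Lie type product: signed sum of the partial composition over all shuffles. -/
def Gra.circ {p q : ℕ} (a : Gra K p) (b : Gra K q) : Gra K (p + q) :=
  ∑ σ ∈ shuffles p q, ((Equiv.Perm.sign σ : ℤˣ) : ℤ) • Gra.perm σ (Gra.comp a b)

/-! ### The graph complexes -/

variable (K)

/-- Finite families of combinations of graphs with `p + 1` vertices, `p = 0, 1, 2, …`. -/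
abbrev Cochain : Type _ := Π₀ p : ℕ, Gra K p

/-- The sign-twisted invariants: `fGC` for two directions and `d = 3` (vertices are odd). -/
def fGC : Submodule K (Cochain K) where
  carrier := {γ | ∀ (p : ℕ) (σ : Equiv.Perm (Fin (p + 1))),
    Gra.perm σ (γ p) = ((Equiv.Perm.sign σ : ℤˣ) : ℤ) • γ p}
  add_mem' := by
    intro a b ha hb p σ
    have h1 := ha p σ
    have h2 := hb p σ
    simp only [Gra.perm] at h1 h2 ⊢
    rw [DFinsupp.add_apply, map_add, h1, h2, smul_add]
  zero_mem' := by
    intro p σ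
    simp [Gra.perm]
  smul_mem' := by
    intro c a ha p σ
    have h1 := ha p σ
    simp only [Gra.perm] at h1 ⊢
    rw [DFinsupp.smul_apply, map_smul, h1, smul_comm]

variable {K}

/-- Every graph that appears in `γ` (with a non-zero coefficient) satisfies `P`. -/
def EachGraph (P : ∀ p : ℕ, BiGraph (Fin (p + 1)) → Prop) (γ : Cochain K) : Prop :=
  ∀ p : ℕ, ∀ G ∈ (γ p).support, P p G

variable (K)

/-- The combinations all of whose graphs satisfy `P`. -/
def spanned (P : ∀ p : ℕ, BiGraph (Fin (p + 1)) → Prop) : Submodule K (Cochain K) where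
  carrier := {γ | EachGraph P γ}
  add_mem' := by
    classical
    intro a b ha hb p G hG
    rw [DFinsupp.add_apply] at hG
    rcases Finset.mem_union.1 (MvPolynomial.support_add hG) with h | h
    · exact ha p G h
    · exact hb p G h
  zero_mem' := by
    intro p G hG
    simp at hG
  smul_mem' := by
    intro c a ha p G hG
    rw [DFinsupp.smul_apply] at hG
    exact ha p G (MvPolynomial.support_smul hG)

/-- `fcGC^{2|0}` for `d = 3`: connected bi-directed graphs. -/
def fcGC : Submodule K (Cochain K) := fGC K ⊓ spanned K fun _ G => G.Connected

/-- `fcGC^{2|black}` for `d = 3`: connected graphs without black cycles. -/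
def fcGCBlack : Submodule K (Cochain K) := fcGC K ⊓ spanned K fun _ G => ¬ G.HasBlackCycle

/-- `fcGC^{2|2}` for `d = 3`: connected graphs without black cycles and without red cycles. -/
def fcGCBi : Submodule K (Cochain K) := fcGCBlack K ⊓ spanned K fun _ G => ¬ G.HasRedCycle

variable {K}

open Classical in
/-- The graded Lie bracket; a graph with `p + 1` vertices has the parity of `p`. -/
def bracket (f g : Cochain K) : Cochain K :=
  f.sum fun p a => g.sum fun q b =>
    DFinsupp.single (p + q) (Gra.circ a b)
      - (-1 : K) ^ (p * q) • DFinsupp.single (q + p) (Gra.circ b a)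

variable (K)

/-- The Maurer-Cartan element: the black arrow from the first to the second vertex minus the black
arrow from the second to the first, summed over the directions of the red arrow. -/
def upsilon : Cochain K :=
  DFinsupp.single 1
    (∑ r : Bool, (MvPolynomial.X (0, 1, r) - MvPolynomial.X (1, 0, r) : Gra K 1))

variable {K}

/-- The differential: the bracket with the Maurer-Cartan element. -/
def delta (γ : Cochain K) : Cochain K := bracket (upsilon K) γ

/-- The three conditions on the pair: `Θ = - δ ϑ`, all the graphs of `Θ` are of shape `C`, and each
graph of `ϑ` has a red cycle. -/
structure IsPair (Θ ϑ : Cochain K) : Prop where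
  eq_neg_delta : Θ = -delta ϑ
  shape_C : EachGraph (fun _ G => G.HasShape shapeC) Θ
  red_cycle : EachGraph (fun _ G => G.HasRedCycle) ϑ

/-- All the graphs of `ϑ` are of shape `A` or `B`. -/
def OfShapeAB (ϑ : Cochain K) : Prop :=
  EachGraph (fun _ G => G.HasShape shapeA ∨ G.HasShape shapeB) ϑ

end BiGC

end

/-! Vertices are odd and edges even. In a theta graph or a figure eight, each arm or loop is a word
in four letters pp, pm, mp, mm, which record the directions of the black and of the red arrow along
it. The differential inserts the combination pp + pm - mp - mm with alternating signs at all places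
of a word. Dually, for the pairing that makes monomials orthogonal, the coefficient of `Gra.circ g
(mc K)` at a graph is the signed sum of the coefficients of `g` at the contractions of its edges
(`pair_prodE_circ_mc`). The other half of the bracket only creates univalent vertices and is not
seen by graphs all of whose valences are at least two (`pair_mc_circ`).

Uniqueness. A graph of shape C has six vertices, so only the five-vertex part of ϑ contributes to Θ.
The coefficients of δϑ vanish at all six-vertex thetas and figure eights that are not of shape C,
and at graphs of shape C with a red cycle. In each of these linear equations the contractions
without red cycle drop out, and a suitable choice of letters leaves only one or two terms. The
equations force the coefficients of ϑ to vanish at figure eights and at thetas with arms 1, 1, 4,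
and they reduce those at shapes A and B to a single number `RedCocycle.scalar`
(`RedCocycle.theta123`, `RedCocycle.theta222`). If that number is zero, then so is Θ
(`RedCocycle.theta133`); applied to the difference of one pair and a multiple of another, this gives
uniqueness (`IsPair.unique`).

Non-exactness. A fixed combination of nine coefficients vanishes on the differential of every
combination of graphs without black and red cycles (`Acyclic.relation`), but on Θ it equals twice
the scalar (`Acyclic.scalar_eq_zero`).

Existence. Let d be signed insertion into words, so that d² = 0, and put α = pm - mm, β = pp·mp -
mp·pp, γ = pm·mm - mm·pm. Writing (u|v|w) for the antisymmetrized theta with these arms, -δ maps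
(α|β|dγ) to (dα|β|dγ) + (α|dβ|dγ). It maps (dα|β|γ) to 2(dα|β|dγ), because turning the theta around
fixes dα, exchanges β and γ, and so makes the terms from dβ and dγ equal. Hence ϑ = 2(α|β|dγ) -
(dα|β|γ) has -δϑ = 2(α|dβ|dγ), of shape C (`differential_alt_seed`). The backward letter of α or
word of γ closes a red cycle with the forward word of β. No word of dβ or dγ is constant in either
colour, and a cycle in a theta graph needs two constant arms; so Θ has no cycles. Finally ϑ ≠ 0 by a
finite evaluation (`alt_seed_ne_zero`), and then its scalar is non-zero by the uniqueness analysis.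
-/

noncomputable section

namespace BiGC

/-! ### The apolar pairing of polynomials -/

section Pairing

open MvPolynomial

variable {K : Type*} [Field K] {I J : Type*}

/-- The apolar pairing of polynomials: distinct monomials are orthogonal, and the square of a
monomial is the product of the factorials of its exponents. -/
def pair : MvPolynomial I K →ₗ[K] MvPolynomial I K →ₗ[K] K :=
  (basisMonomials I K).constr K fun m =>
    ((m.prod fun _ n => n.factorial : ℕ) : K) • MvPolynomial.lcoeff K m

theorem pair_monomial (m : I →₀ ℕ) (c : K) (f : MvPolynomial I K) :
    pair (monomial m c) f = c * (((m.prod fun _ n => n.factorial : ℕ) : K) * coeff m f) := by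
  have h : monomial m c = c • basisMonomials I K m := by
    simp [coe_basisMonomials, smul_monomial]
  rw [h, map_smul, pair, Module.Basis.constr_basis]
  simp

theorem pair_C (c : K) (f : MvPolynomial I K) : pair (C c) f = c * constantCoeff f := by
  rw [C_apply, pair_monomial]
  simp [constantCoeff_eq]

theorem pair_comm (f g : MvPolynomial I K) : pair f g = pair g f := by
  classical
  induction f using MvPolynomial.induction_on' with
  | add p q hp hq => simp [hp, hq]
  | monomial m c =>
    induction g using MvPolynomial.induction_on' with
    | add p q hp hq => simp [hp, hq]
    | monomial n d =>
      rw [pair_monomial, pair_monomial, coeff_monomial, coeff_monomial]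
      by_cases h : n = m
      · subst h; simp; ring
      · simp [h, Ne.symm h]

/-- The factorials in the pairing are there for this adjunction between multiplication by a variable
and the derivative; the factor `m i + 1` appears on both sides. -/
theorem pair_X_mul (i : I) (f g : MvPolynomial I K) :
    pair (X i * f) g = pair f (pderiv i g) := by
  classical
  induction f using MvPolynomial.induction_on' with
  | add p q hp hq => simp [mul_add, hp, hq]
  | monomial m c =>
    rw [X, monomial_mul, pair_monomial, pair_monomial, coeff_pderiv, one_mul, add_comm _ m]
    have h : ((m + Finsupp.single i 1).prod fun _ n => n.factorial)
        = (m i + 1) * m.prod fun _ n => n.factorial := by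
      have h1 := Finsupp.mul_prod_erase' (m + Finsupp.single i 1) i
        (fun _ n => n.factorial) (fun _ => rfl)
      have h2 := Finsupp.mul_prod_erase' m i (fun _ n => n.factorial) (fun _ => rfl)
      rw [← h1, ← h2, Finsupp.erase_add, Finsupp.erase_single]
      simp [Nat.factorial_succ, mul_assoc]
    rw [h]
    push_cast
    ring

theorem pair_mul_X (i : I) (f g : MvPolynomial I K) :
    pair f (X i * g) = pair (pderiv i f) g := by
  rw [pair_comm, pair_X_mul, pair_comm]

theorem pair_rename_rename (e : I ≃ J) (f g : MvPolynomial I K) :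
    pair (rename e f) (rename e g) = pair f g := by
  induction f using MvPolynomial.induction_on generalizing g with
  | C c => simp [pair_C, constantCoeff_rename]
  | add p q hp hq => simp [hp, hq]
  | mul_X p i hp =>
    rw [map_mul, rename_X, mul_comm, mul_comm p, pair_X_mul, pair_X_mul,
      pderiv_rename e.injective, hp]

/-- Substituting for each variable the sum of the variables in its fibre under `π` is adjoint to
renaming along `π`. The hypotheses record the fibre sum only through its constant term and
derivatives, which is all that the chain rule `hd` needs to move the variables of `f` across one by
one. -/
theorem pair_aeval [DecidableEq I] (φ : I → MvPolynomial J K) (π : J → I)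
    (hφ : ∀ i, constantCoeff (φ i) = 0)
    (hπ : ∀ j i, pderiv j (φ i) = if π j = i then 1 else 0) (f : MvPolynomial J K)
    (g : MvPolynomial I K) : pair f (aeval φ g) = pair (rename π f) g := by
  have hd : ∀ (j : J) (g : MvPolynomial I K),
      pderiv j (aeval φ g) = aeval φ (pderiv (π j) g) := by
    intro j g
    induction g using MvPolynomial.induction_on with
    | C c => simp [algebraMap_eq]
    | add p q hp hq => simp only [map_add, hp, hq]
    | mul_X p i hp =>
      rw [map_mul, pderiv_mul, hp, pderiv_mul, map_add, map_mul, map_mul, aeval_X, hπ, pderiv_X,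
        Pi.single_apply]
      simp only [eq_comm (a := i)]
      split_ifs <;> simp
  induction f using MvPolynomial.induction_on generalizing g with
  | C c =>
    rw [rename_C, pair_C, pair_C]
    congr 1
    induction g using MvPolynomial.induction_on with
    | C c => simp [algebraMap_eq]
    | add p q hp hq => simp only [map_add, hp, hq]
    | mul_X p i hp => simp [hφ]
  | add p q hp hq => simp only [map_add, LinearMap.add_apply, hp, hq]
  | mul_X p j hp =>
    rw [map_mul (rename π), rename_X, mul_comm p, mul_comm _ (X (π j)), pair_X_mul, pair_X_mul,
        hd, hp]

theorem pair_monomial_ne_zero [CharZero K] {m : I →₀ ℕ} {f : MvPolynomial I K}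
    (h : m ∈ f.support) : pair (monomial m 1) f ≠ 0 := by
  rw [pair_monomial, one_mul]
  refine mul_ne_zero ?_ (mem_support_iff.1 h)
  rw [Nat.cast_ne_zero]
  exact Finset.prod_ne_zero_iff.2 fun i _ => Nat.factorial_ne_zero _

theorem mem_support_of_pair_ne_zero {m : I →₀ ℕ} {f : MvPolynomial I K}
    (h : pair (monomial m 1) f ≠ 0) : m ∈ f.support := by
  rw [mem_support_iff]
  intro h0
  simp [pair_monomial, h0] at h

end Pairing

end BiGC

end

/-! ### Composition with the Maurer-Cartan element as the adjoint of edge contraction -/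

noncomputable section

namespace BiGC

open MvPolynomial

/-! ### Letters and edges -/

/-- The type of a bi-directed edge on an oriented arm: whether its black, and its red arrow points
forward. -/
abbrev Letter : Type := Bool × Bool

/-- The same edge on the arm with the opposite orientation. -/
def Letter.rev (l : Letter) : Letter := (!l.1, !l.2)

/-- The sign of the direction of the black arrow. -/
def Letter.sgn (K : Type*) [Field K] (l : Letter) : K := if l.1 then 1 else -1

/-- The edge of type `l` on an arm from `s` to `t`. -/
def edge {V : Type} (s t : V) (l : Letter) : BiEdge V := if l.1 then (s, t, l.2) else (t, s, !l.2)

theorem edge_rev {V : Type} (s t : V) (l : Letter) : edge s t l.rev = edge t s l := by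
  rcases l with ⟨_ | _, _ | _⟩ <;> rfl

theorem map_edge {V W : Type} (f : V → W) (s t : V) (l : Letter) :
    (edge s t l).map f = edge (f s) (f t) l := by
  rcases l with ⟨_ | _, _ | _⟩ <;> rfl

variable {K : Type*} [Field K]

/-- The variable of the polynomial algebra that belongs to an edge. -/
def E (K : Type*) [Field K] {V : Type} (s t : V) (l : Letter) : MvPolynomial (BiEdge V) K :=
  X (edge s t l)

theorem E_rev {V : Type} (s t : V) (l : Letter) : E K s t l.rev = E K t s l := by
  rw [E, E, edge_rev]

theorem rename_E {V W : Type} (f : V → W) (s t : V) (l : Letter) :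
    rename (BiEdge.map f) (E K s t l) = E K (f s) (f t) l := by
  rw [E, rename_X, map_edge, E]

theorem BiEdge.map_id {V : Type} : BiEdge.map (id : V → V) = id := rfl

theorem BiEdge.map_comp {U V W : Type} (g : V → W) (f : U → V) :
    BiEdge.map g ∘ BiEdge.map f = BiEdge.map (g ∘ f) := rfl

/-- Renaming the vertices of edges by an equivalence. -/
def BiEdge.mapEquiv {V W : Type} (e : V ≃ W) : BiEdge V ≃ BiEdge W where
  toFun := BiEdge.map e
  invFun := BiEdge.map e.symm
  left_inv x := by simp [BiEdge.map]
  right_inv x := by simp [BiEdge.map]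

theorem Gra.perm_mul {p : ℕ} (σ τ : Equiv.Perm (Fin (p + 1))) (f : Gra K p) :
    Gra.perm (σ * τ) f = Gra.perm σ (Gra.perm τ f) := by
  simp only [Gra.perm, rename_rename, BiEdge.map_comp]
  rfl

theorem Gra.perm_one {p : ℕ} (f : Gra K p) : Gra.perm 1 f = f := by
  simp only [Gra.perm, Equiv.Perm.coe_one, BiEdge.map_id, rename_id, AlgHom.id_apply]

theorem pair_perm {p : ℕ} (σ : Equiv.Perm (Fin (p + 1))) (f g : Gra K p) :
    pair f (Gra.perm σ g) = pair (Gra.perm σ⁻¹ f) g := by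
  have h := pair_rename_rename (BiEdge.mapEquiv σ) (Gra.perm σ⁻¹ f) g
  rw [← h]
  congr 1
  change pair f = pair (Gra.perm σ (Gra.perm σ⁻¹ f))
  rw [← Gra.perm_mul, mul_inv_cancel, Gra.perm_one]

/-- Sign-twisted invariance under the permutations of the vertices. -/
def Alternating {p : ℕ} (f : Gra K p) : Prop :=
  ∀ σ : Equiv.Perm (Fin (p + 1)), Gra.perm σ f = ((Equiv.Perm.sign σ : ℤˣ) : ℤ) • f

theorem Alternating.pair_perm {p : ℕ} {f : Gra K p} (hf : Alternating f)
    (σ : Equiv.Perm (Fin (p + 1))) (M : Gra K p) :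
    pair (Gra.perm σ M) f = ((Equiv.Perm.sign σ : ℤˣ) : ℤ) * pair M f := by
  have h := BiGC.pair_perm σ⁻¹ M f
  rw [hf σ⁻¹, inv_inv] at h
  rw [← h, Equiv.Perm.sign_inv, map_zsmul, zsmul_eq_mul]

/-! ### The derivation that removes an edge -/

/-- The signed sum of the derivations that remove an edge between `s` and `t`. -/
def removeEdge {V : Type} (s t : V) :
    Derivation K (MvPolynomial (BiEdge V) K) (MvPolynomial (BiEdge V) K) :=
  ∑ r : Bool, (pderiv (s, t, r) - pderiv (t, s, r))

theorem removeEdge_apply {V : Type} (s t : V) (f : MvPolynomial (BiEdge V) K) :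
    removeEdge s t f = ∑ r : Bool, (pderiv (s, t, r) f - pderiv (t, s, r) f) := by
  simp [removeEdge]

theorem removeEdge_E {V : Type} [DecidableEq V] {s t a b : V} (hst : s ≠ t) (l : Letter) :
    removeEdge s t (E K a b l) =
      if a = s ∧ b = t then C (l.sgn K) else if a = t ∧ b = s then -C (l.sgn K) else 0 := by
  classical
  rcases l with ⟨_ | _, _ | _⟩ <;>
  simp only [removeEdge_apply, E, edge, pderiv_X, Pi.single_apply, Fintype.sum_bool,
    Letter.sgn, Bool.not_true, Bool.not_false] <;>
  by_cases h1 : a = s ∧ b = t <;> by_cases h2 : a = t ∧ b = s <;>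
  simp_all <;> aesop

theorem perm_removeEdge {p : ℕ} (σ : Equiv.Perm (Fin (p + 1))) (s t : Fin (p + 1)) (f : Gra K p) :
    removeEdge s t (Gra.perm σ⁻¹ f) = Gra.perm σ⁻¹ (removeEdge (σ s) (σ t) f) := by
  have h : ∀ e, pderiv e (Gra.perm σ⁻¹ f) = Gra.perm σ⁻¹ (pderiv (BiEdge.map σ e) f) := by
    intro e
    have h1 := pderiv_rename (R := K) (BiEdge.mapEquiv σ⁻¹).injective (BiEdge.map σ e) f
    have h2 : BiEdge.mapEquiv σ⁻¹ (BiEdge.map σ e) = e := by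
      simp [BiEdge.mapEquiv, BiEdge.map]
    rw [h2] at h1
    exact h1
  simp only [removeEdge_apply, h]
  simp only [Gra.perm, map_sum, map_sub, BiEdge.map]

/-! ### The Maurer-Cartan element -/

/-- The Maurer-Cartan element as a combination of graphs with two vertices. -/
def mc (K : Type*) [Field K] : Gra K 1 := ∑ r : Bool, (X (0, 1, r) - X (1, 0, r))

theorem pair_mul_mc (M g : Gra K 5) :
    pair M (g * rename (BiEdge.map (Fin.castLE (by omega : 1 + 1 ≤ 4 + 1 + 1))) (mc K)) =
      pair (removeEdge 0 1 M) g := by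
  have h0 : (Fin.castLE (by omega : 1 + 1 ≤ 4 + 1 + 1)) 0 = 0 := rfl
  have h1 : (Fin.castLE (by omega : 1 + 1 ≤ 4 + 1 + 1)) 1 = 1 := rfl
  rw [mul_comm g]
  simp only [mc, map_sub, rename_X, BiEdge.map, h0, h1, Fintype.sum_bool, add_mul, sub_mul,
    map_add, removeEdge_apply, LinearMap.add_apply, LinearMap.sub_apply, pair_mul_X]

/-- The map that collapses the vertices `0` and `1`. -/
def collapse (v : Fin 6) : Fin 5 := if h : v = 0 then 0 else v.pred h

theorem mem_attach (v : Fin 6) (i : Fin 5) : v ∈ attach 4 1 i ↔ collapse v = i := by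
  revert v i; decide

/-- The fibres of `collapse` are the sets `attach 4 1 i`, so reattaching half edges is adjoint to
merging the two inserted vertices. -/
theorem pair_reattach (M : Gra K 5) (g : Gra K 4) :
    pair M (aeval (reattach 4 1) g) = pair (rename (BiEdge.map collapse) M) g := by
  refine pair_aeval _ _ ?_ ?_ _ _
  · intro e
    simp [reattach]
  · rintro ⟨u, w, r⟩ ⟨i, j, r'⟩
    classical
    simp only [reattach, map_sum, pderiv_X, Pi.single_apply, BiEdge.map, Prod.mk.injEq]
    by_cases h : collapse u = i ∧ collapse w = j ∧ r = r'
    · obtain ⟨h1, h2, rfl⟩ := h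
      rw [if_pos ⟨h1, h2, rfl⟩, Finset.sum_eq_single u, Finset.sum_eq_single w]
      · simp
      · intro b _ hb; simp [hb]
      · intro hw; exact absurd ((mem_attach _ _).2 h2) hw
      · intro b _ hb; simp [hb]
      · intro hw; exact absurd ((mem_attach _ _).2 h1) hw
    · rw [if_neg h]
      refine Finset.sum_eq_zero fun x hx => Finset.sum_eq_zero fun y hy => ?_
      rw [mem_attach] at hx hy
      rw [if_neg]
      rintro ⟨rfl, rfl, rfl⟩
      exact h ⟨hx, hy, rfl⟩

/-- The number of the vertex `v` after the contraction of an edge between `s` and `t`. -/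
def contractVertex (s t v : Fin 6) : Fin 5 :=
  if v = s ∨ v = t then 0
  else Fin.ofNat 5 (1 + v.val - (if s < v then 1 else 0) - (if t < v then 1 else 0))

/-- A shuffle in `shuffles 4 1` is determined by the places `σ 0 < σ 1` of the two inserted
vertices, since the remaining ones follow in order; its sign counts the vertices they jump over. -/
theorem shuffles_spec : ∀ σ ∈ shuffles 4 1, σ 0 < σ 1 ∧
    ((Equiv.Perm.sign σ : ℤˣ) : ℤ) = (-1) ^ ((σ 0).val + (σ 1).val + 1) ∧
    ∀ v, collapse (σ.symm v) = contractVertex (σ 0) (σ 1) v := by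
  decide +kernel

theorem shuffles_image : (shuffles 4 1).image (fun σ => (σ 0, σ 1)) =
    Finset.univ.filter fun x : Fin 6 × Fin 6 => x.1 < x.2 := by
  decide +kernel

theorem shuffles_injOn : Set.InjOn (fun σ : Equiv.Perm (Fin 6) => (σ 0, σ 1)) (shuffles 4 1) := by
  rw [← Finset.card_image_iff, shuffles_image]
  decide +kernel

/-- The product of `γ` with the Maurer-Cartan element, paired with `M`: edges of `M` are
contracted. -/
theorem pair_circ_mc (M : Gra K 5) (g : Gra K 4) :
    pair M (Gra.circ g (mc K)) = ∑ x : Fin 6 × Fin 6 with x.1 < x.2,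
      (-1) ^ (x.1.val + x.2.val + 1) *
      pair (rename (BiEdge.map (contractVertex x.1 x.2)) (removeEdge x.1 x.2 M)) g := by
  -- The shuffles are reindexed by the ends of the edge to be contracted.
  rw [← shuffles_image, Finset.sum_image shuffles_injOn, Gra.circ, map_sum]
  refine Finset.sum_congr rfl fun σ hσ => ?_
  obtain ⟨-, h1, h2⟩ := shuffles_spec σ hσ
  rw [map_zsmul, pair_perm, Gra.comp, pair_mul_mc, perm_removeEdge, pair_reattach, Gra.perm,
    rename_rename, BiEdge.map_comp, h1, zsmul_eq_mul]
  have h3 : collapse ∘ ⇑(σ⁻¹) = contractVertex (σ 0) (σ 1) := funext h2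
  rw [h3]
  push_cast
  rfl

end BiGC

end

/-! ### Invisibility of univalent vertices, and the six-vertex part of the differential -/

noncomputable section

namespace BiGC

open MvPolynomial

variable {K : Type*} [Field K]

/-- Every vertex has valence at least two. -/
def NoUnivalent (M : Gra K 5) : Prop :=
  ∀ v : Fin 6, ∃ (s t : Fin 6) (l l' : Letter) (N : Gra K 5), M = E K v s l * (E K v t l' * N)

theorem pderiv_reattach {p q : ℕ} (e : BiEdge (Fin (p + q + 1))) (e' : BiEdge (Fin (p + 1))) :
    ∃ c : K, pderiv e (reattach p q e' : Gra K (p + q)) = C c := by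
  classical
  refine ⟨∑ u ∈ attach p q e'.1, ∑ w ∈ attach p q e'.2.1, if (u, w, e'.2.2) = e then 1 else 0, ?_⟩
  simp only [reattach, map_sum, pderiv_X, Pi.single_apply]
  refine Finset.sum_congr rfl fun u _ => Finset.sum_congr rfl fun w _ => ?_
  split_ifs <;> simp

theorem pderiv_rename_of_notMem {I J : Type*} (f : I → J) (j : J) (h : j ∉ Set.range f)
    (g : MvPolynomial I K) : pderiv j (rename f g) = 0 := by
  induction g using MvPolynomial.induction_on with
  | C c => simp
  | add p q hp hq => rw [map_add, map_add, hp, hq, add_zero]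
  | mul_X p i hp =>
    rw [map_mul, pderiv_mul, hp, rename_X, pderiv_X_of_ne, zero_mul, mul_zero, add_zero]
    rintro rfl
    exact h ⟨i, rfl⟩

theorem castLE_ne_five :
    ∀ y : Fin 5, Fin.castLE (by omega : 4 + 1 ≤ 1 + 4 + 1) y ≠ (5 : Fin 6) := by
  decide

/-- The vertex 5 is the second vertex of the Maurer-Cartan element: no edge of `g` meets it, and the
factor that does is linear in the edges. -/
theorem pderiv_comp_mc (e : BiEdge (Fin 6)) (he : e.1 = 5 ∨ e.2.1 = 5) :
    ∃ c : K, ∀ g : Gra K 4, pderiv e (Gra.comp (mc K) g) =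
      C c * rename (BiEdge.map (Fin.castLE (by omega : 4 + 1 ≤ 1 + 4 + 1))) g := by
  have h : ∃ c : K, pderiv e (aeval (reattach 1 4) (mc K) : Gra K (1 + 4)) = C c := by
    obtain ⟨c1, h1⟩ := pderiv_reattach (K := K) (p := 1) (q := 4) e (0, 1, true)
    obtain ⟨c2, h2⟩ := pderiv_reattach (K := K) (p := 1) (q := 4) e (1, 0, true)
    obtain ⟨c3, h3⟩ := pderiv_reattach (K := K) (p := 1) (q := 4) e (0, 1, false)
    obtain ⟨c4, h4⟩ := pderiv_reattach (K := K) (p := 1) (q := 4) e (1, 0, false)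
    refine ⟨c1 - c2 + (c3 - c4), ?_⟩
    rw [mc, Fintype.sum_bool]
    simp only [map_add, map_sub, aeval_X, h1, h2, h3, h4]
  obtain ⟨c, hc⟩ := h
  refine ⟨c, fun g => ?_⟩
  rw [Gra.comp, pderiv_mul, hc, pderiv_rename_of_notMem, mul_zero, add_zero]
  rintro ⟨x, rfl⟩
  rcases he with he | he
  · exact castLE_ne_five _ he
  · exact castLE_ne_five _ he

theorem edge_incident {V : Type} (s t : V) (l : Letter) : (edge s t l).1 = s ∨
    (edge s t l).2.1 = s := by
  rcases l with ⟨_ | _, _ | _⟩ <;> simp [edge]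

/-- In the term belonging to `σ` the vertex `σ 5` carries only the edge of the Maurer-Cartan
element. `M` has two half edges there, so its two derivatives annihilate the term. -/
theorem pair_mc_circ (M : Gra K 5) (hM : NoUnivalent M) (g : Gra K 4) :
    pair M (Gra.circ (mc K) g) = 0 := by
  rw [Gra.circ, map_sum]
  refine Finset.sum_eq_zero fun σ _ => ?_
  obtain ⟨s, t, l, l', N, rfl⟩ := hM (σ 5)
  rw [map_zsmul]
  have h5 : σ⁻¹ (σ 5) = 5 := by simp
  have key : pair (E K (σ 5) s l * (E K (σ 5) t l' * N)) (Gra.perm σ (Gra.comp (mc K) g)) = 0 := by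
    rw [pair_perm, Gra.perm, map_mul (rename _), map_mul (rename _), rename_E, rename_E, h5, E, E,
      pair_X_mul, pair_X_mul]
    obtain ⟨c, hc⟩ := pderiv_comp_mc (K := K) (edge 5 (σ⁻¹ s) l) (edge_incident _ _ _)
    rw [hc, pderiv_C_mul, pderiv_rename_of_notMem, mul_zero, map_zero]
    rintro ⟨x, hx⟩
    rcases edge_incident (5 : Fin 6) (σ⁻¹ t) l' with he | he
    · rw [← hx] at he; exact castLE_ne_five _ he
    · rw [← hx] at he; exact castLE_ne_five _ he
  rw [key, smul_zero]

/-- The Maurer-Cartan element raises the index by one, so only `γ 4` contributes; the sign of the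
bracket is (-1)^(1·4) = 1. -/
theorem delta_apply_five (γ : Cochain K) :
    delta γ 5 = Gra.circ (mc K) (γ 4) - Gra.circ (γ 4) (mc K) := by
  classical
  have hu : upsilon K = DFinsupp.single 1 (mc K) := rfl
  have z1 : ∀ q (a : Gra K q), Gra.circ (0 : Gra K 1) a = 0 := by
    intro q a; simp [Gra.circ, Gra.comp, Gra.perm]
  have z2 : ∀ q (a : Gra K q), Gra.circ a (0 : Gra K 1) = 0 := by
    intro q a; simp [Gra.circ, Gra.comp, Gra.perm]
  have z3 : Gra.circ (mc K) (0 : Gra K 4) = 0 := by simp [Gra.circ, Gra.comp, Gra.perm]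
  have z4 : Gra.circ (0 : Gra K 4) (mc K) = 0 := by simp [Gra.circ, Gra.comp, Gra.perm]
  have e1 : ∀ x : Gra K (1 + 4), (DFinsupp.single (1 + 4) x : Cochain K) 5 = x :=
    fun x => DFinsupp.single_eq_same (i := 5)
  have e2 : ∀ x : Gra K (4 + 1), (DFinsupp.single (4 + 1) x : Cochain K) 5 = x :=
    fun x => DFinsupp.single_eq_same (i := 5)
  rw [delta, bracket, hu, DFinsupp.sum_single_index]
  · rw [DFinsupp.sum, DFinsupp.finsetSum_apply, Finset.sum_eq_single 4]
    · rw [DFinsupp.sub_apply, DFinsupp.smul_apply]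
      rw [e1, e2, mul_comm 1 4]
      norm_num
    · intro b _ hb
      rw [DFinsupp.sub_apply, DFinsupp.smul_apply, DFinsupp.single_eq_of_ne (by omega),
        DFinsupp.single_eq_of_ne (by omega)]
      simp
    · intro h
      rw [DFinsupp.notMem_support_iff.1 h, z3, z4, DFinsupp.sub_apply, DFinsupp.smul_apply, e1,
          smul_zero,
        sub_zero]
  · refine Finset.sum_eq_zero fun q _ => ?_
    simp [z1, z2]

end BiGC

end

/-! ### Coefficients of the differential at theta graphs and figure eights -/

noncomputable section

namespace BiGC

open MvPolynomial

variable {K : Type*} [Field K]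

/-! ### Products of edges -/

/-- The graph with the given edges, as a monomial. -/
def prodE (K : Type*) [Field K] {V : Type} (l : List (V × V × Letter)) :
    MvPolynomial (BiEdge V) K :=
  (l.map fun e => E K e.1 e.2.1 e.2.2).prod

/-- Renaming the vertices in a list of edges. -/
def mapV {V W : Type} (f : V → W) (l : List (V × V × Letter)) : List (W × W × Letter) :=
  l.map fun e => (f e.1, f e.2.1, e.2.2)

theorem rename_prodE {V W : Type} (f : V → W) (l : List (V × V × Letter)) :
    rename (BiEdge.map f) (prodE K l) = prodE K (mapV f l) := by
  rw [prodE, map_list_prod, List.map_map, prodE, mapV, List.map_map]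
  congr 1
  refine List.map_congr_left fun e _ => ?_
  exact rename_E f _ _ _

theorem removeEdge_prodE {V : Type} (s t : V) (l : List (V × V × Letter)) :
    removeEdge s t (prodE K l) = ∑ k : Fin l.length,
      removeEdge s t (E K l[k].1 l[k].2.1 l[k].2.2) * prodE K (l.eraseIdx k) := by
  induction l with
  | nil => simp [prodE]
  | cons e l ih =>
    have h : prodE K (e :: l) = E K e.1 e.2.1 e.2.2 * prodE K l := by simp [prodE]
    refine Eq.trans ?_ (Fin.sum_univ_succ (n := l.length) _).symm
    rw [h, Derivation.leibniz, ih, smul_eq_mul, smul_eq_mul, add_comm, Finset.mul_sum]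
    congr 1
    · simp [mul_comm]
    · refine Finset.sum_congr rfl fun k _ => ?_
      have h2 : prodE K ((e :: l).eraseIdx k.succ) =
          E K e.1 e.2.1 e.2.2 * prodE K (l.eraseIdx k) := by simp [prodE]
      simp only [h2]
      simp only [Fin.val_succ, Fin.getElem_fin, List.getElem_cons_succ]
      ring

/-- The sign of the contraction of an edge from `s` to `t`. -/
def contractSign (s t : Fin 6) : ℤ := (if s < t then 1 else -1) * (-1) ^ (s.val + t.val + 1)

/-- Only the increasing ordering of the pair `s`, `t` contributes. `contractSign` combines the sign
of this reordering with that of the shuffle. -/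
theorem sum_removeEdge_E (s t : Fin 6) (hst : s ≠ t) (l : Letter) (g : Gra K 4) (N : Gra K 5) :
    ∑ x : Fin 6 × Fin 6 with x.1 < x.2, (-1) ^ (x.1.val + x.2.val + 1) *
      pair (rename (BiEdge.map (contractVertex x.1 x.2)) (removeEdge x.1 x.2 (E K s t l) * N)) g =
    contractSign s t * l.sgn K * pair (rename (BiEdge.map (contractVertex s t)) N) g := by
  have hc : ∀ v, contractVertex s t v = contractVertex t s v := by
    revert s t; decide
  rcases lt_or_gt_of_ne hst with h | h
  · rw [Finset.sum_eq_single (s, t)]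
    · rw [removeEdge_E hst]
      simp [contractSign, h, ← algebraMap_eq, Algebra.algebraMap_eq_smul_one]
      ring
    · rintro ⟨a, b⟩ hab hne
      have hab' : a < b := (Finset.mem_filter.1 hab).2
      rw [removeEdge_E hab'.ne, if_neg, if_neg]
      · simp
      · rintro ⟨rfl, rfl⟩; exact lt_asymm h hab'
      · rintro ⟨rfl, rfl⟩; exact hne rfl
    · intro hn; simp [h] at hn
  · rw [Finset.sum_eq_single (t, s)]
    · rw [removeEdge_E h.ne]
      have h3 : contractVertex s t = contractVertex t s := funext hc
      simp [contractSign, h.not_gt, h.ne, h3, ← algebraMap_eq, Algebra.algebraMap_eq_smul_one]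
      ring
    · rintro ⟨a, b⟩ hab hne
      have hab' : a < b := (Finset.mem_filter.1 hab).2
      rw [removeEdge_E hab'.ne, if_neg, if_neg]
      · simp
      · rintro ⟨rfl, rfl⟩; exact hne rfl
      · rintro ⟨rfl, rfl⟩; exact lt_asymm h hab'
    · intro hn; simp [h] at hn

/-- The pre-Lie product with the Maurer-Cartan element is dual to the contraction of edges. -/
theorem pair_prodE_circ_mc (l : List (Fin 6 × Fin 6 × Letter)) (hl : ∀ e ∈ l, e.1 ≠ e.2.1)
    (g : Gra K 4) :
    pair (prodE K l : Gra K 5) (Gra.circ g (mc K)) = ∑ k : Fin l.length,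
      contractSign l[k].1 l[k].2.1 * l[k].2.2.sgn K *
        pair (prodE K (mapV (contractVertex l[k].1 l[k].2.1) (l.eraseIdx k))) g := by
  rw [pair_circ_mc]
  simp only [removeEdge_prodE, map_sum, LinearMap.sum_apply, Finset.mul_sum]
  rw [Finset.sum_comm]
  refine Finset.sum_congr rfl fun k _ => ?_
  refine (sum_removeEdge_E l[k].1 l[k].2.1 (hl _ (List.getElem_mem _)) l[k].2.2 g
    (prodE K (l.eraseIdx k))).trans ?_
  rw [rename_prodE]

theorem pair_prodE_perm {g : Gra K 4} (hg : Alternating g) (τ : Equiv.Perm (Fin 5)) (s : ℤ)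
    (hs : ((Equiv.Perm.sign τ : ℤˣ) : ℤ) = s) {l l' : List (Fin 5 × Fin 5 × Letter)}
    (h : prodE K l = prodE K (mapV τ l')) : pair (prodE K l) g = s * pair (prodE K l') g := by
  rw [h, ← rename_prodE, ← hs]
  exact hg.pair_perm τ _

end BiGC

end

noncomputable section

namespace BiGC

open MvPolynomial

variable {K : Type*} [Field K]

/-! ### Theta graphs and figure eights -/

/-- The theta graph with arms of lengths 1, 1, 4. -/
def theta114 (x y z1 z2 z3 z4 : Letter) : List (Fin 5 × Fin 5 × Letter) :=
  [(0, 1, x), (0, 1, y), (0, 2, z1), (2, 3, z2), (3, 4, z3), (4, 1, z4)]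

/-- The theta graph with arms of lengths 1, 2, 3. -/
def theta123 (x w1 w2 z1 z2 z3 : Letter) : List (Fin 5 × Fin 5 × Letter) :=
  [(0, 1, x), (0, 2, w1), (2, 1, w2), (0, 3, z1), (3, 4, z2), (4, 1, z3)]

/-- The theta graph with arms of lengths 2, 2, 2. -/
def theta222 (v1 v2 w1 w2 z1 z2 : Letter) : List (Fin 5 × Fin 5 × Letter) :=
  [(0, 2, v1), (2, 1, v2), (0, 3, w1), (3, 1, w2), (0, 4, z1), (4, 1, z2)]

/-- Two loops of lengths 2, 4 at a vertex. -/
def eight24 (w1 w2 z1 z2 z3 z4 : Letter) : List (Fin 5 × Fin 5 × Letter) :=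
  [(0, 1, w1), (1, 0, w2), (0, 2, z1), (2, 3, z2), (3, 4, z3), (4, 0, z4)]

/-- Two loops of lengths 3, 3 at a vertex. -/
def eight33 (w1 w2 w3 z1 z2 z3 : Letter) : List (Fin 5 × Fin 5 × Letter) :=
  [(0, 1, w1), (1, 2, w2), (2, 0, w3), (0, 3, z1), (3, 4, z2), (4, 0, z3)]

/-- The theta graph with arms of lengths 1, 1, 5. -/
def theta115 (x y z1 z2 z3 z4 z5 : Letter) : List (Fin 6 × Fin 6 × Letter) :=
  [(0, 1, x), (0, 1, y), (0, 2, z1), (2, 3, z2), (3, 4, z3), (4, 5, z4), (5, 1, z5)]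

/-- The theta graph with arms of lengths 1, 2, 4. -/
def theta124 (x w1 w2 z1 z2 z3 z4 : Letter) : List (Fin 6 × Fin 6 × Letter) :=
  [(0, 1, x), (0, 2, w1), (2, 1, w2), (0, 3, z1), (3, 4, z2), (4, 5, z3), (5, 1, z4)]

/-- The theta graph with arms of lengths 1, 3, 3. -/
def theta133 (x w1 w2 w3 z1 z2 z3 : Letter) : List (Fin 6 × Fin 6 × Letter) :=
  [(0, 1, x), (0, 2, w1), (2, 3, w2), (3, 1, w3), (0, 4, z1), (4, 5, z2), (5, 1, z3)]

/-- The theta graph with arms of lengths 2, 2, 3. -/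
def theta223 (v1 v2 w1 w2 z1 z2 z3 : Letter) : List (Fin 6 × Fin 6 × Letter) :=
  [(0, 2, v1), (2, 1, v2), (0, 3, w1), (3, 1, w2), (0, 4, z1), (4, 5, z2), (5, 1, z3)]

/-- Two loops of lengths 2, 5 at a vertex. -/
def eight25 (w1 w2 z1 z2 z3 z4 z5 : Letter) : List (Fin 6 × Fin 6 × Letter) :=
  [(0, 1, w1), (1, 0, w2), (0, 2, z1), (2, 3, z2), (3, 4, z3), (4, 5, z4), (5, 0, z5)]

/-- Two loops of lengths 3, 4 at a vertex. -/
def eight34 (w1 w2 w3 z1 z2 z3 z4 : Letter) : List (Fin 6 × Fin 6 × Letter) :=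
  [(0, 1, w1), (1, 2, w2), (2, 0, w3), (0, 3, z1), (3, 4, z2), (4, 5, z3), (5, 0, z4)]

/-- The coefficient of a graph, up to the multiplicities of its edges. -/
def val {p : ℕ} (g : Gra K p) (l : List (Fin (p + 1) × Fin (p + 1) × Letter)) : K :=
  pair (prodE K l) g

/-- The permutation with the given values. -/
def permOf (f g : Fin 5 → Fin 5) (h : ∀ i, g (f i) = i ∧ f (g i) = i) : Equiv.Perm (Fin 5) :=
  ⟨f, g, fun i => (h i).1, fun i => (h i).2⟩

theorem prodE_perm {V : Type} {l l' : List (V × V × Letter)} (h : l.Perm l') :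
    prodE K l = prodE K l' := (h.map _).prod_eq

/-- Brings one contraction to standard form: `f` renames the vertices of the standard graph `L'` to
those of the contracted graph, and `c` collects the sign of the contraction and that of the
renaming. -/
theorem contract_eq {g : Gra K 4} (hg : Alternating g) (s t : Fin 6) (l : Letter)
    {L : List (Fin 6 × Fin 6 × Letter)} (f f' : Fin 5 → Fin 5)
    (hf : ∀ i, f' (f i) = i ∧ f (f' i) = i) (c : ℤ) (L' : List (Fin 5 × Fin 5 × Letter))
    (hc : contractSign s t * ((Equiv.Perm.sign (permOf f f' hf) : ℤˣ) : ℤ) = c)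
    (h : (mapV (contractVertex s t) L).Perm (mapV f L')) :
    contractSign s t * l.sgn K * pair (prodE K (mapV (contractVertex s t) L)) g =
      c * (l.sgn K * val g L') := by
  rw [pair_prodE_perm hg (permOf f f' hf) _ rfl (prodE_perm h), ← hc, val]
  push_cast
  ring

/-- All graphs with loops have coefficient zero. -/
def NoLoops (g : Gra K 4) : Prop :=
  ∀ L : List (Fin 5 × Fin 5 × Letter), (∃ v l, (v, v, l) ∈ L) → val g L = 0

theorem contract_loop {g : Gra K 4} (hg : NoLoops g) (s t : Fin 6) (l : Letter)
    (L : List (Fin 6 × Fin 6 × Letter)) (h : ∃ v l, (v, v, l) ∈ mapV (contractVertex s t) L) :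
    contractSign s t * l.sgn K * pair (prodE K (mapV (contractVertex s t) L)) g =
      ((0 : ℤ) : K) := by
  have h1 := hg _ h
  rw [val] at h1
  rw [h1, mul_zero, Int.cast_zero]

theorem sum_seven {M : Type*} [AddCommMonoid M] {f : Fin 7 → M} {a0 a1 a2 a3 a4 a5 a6 : M}
    (h0 : f 0 = a0) (h1 : f 1 = a1) (h2 : f 2 = a2) (h3 : f 3 = a3) (h4 : f 4 = a4) (h5 : f 5 = a5)
    (h6 : f 6 = a6) : ∑ i, f i = a0 + a1 + a2 + a3 + a4 + a5 + a6 := by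
  rw [Fin.sum_univ_seven, h0, h1, h2, h3, h4, h5, h6]

/-- Contracting one of the parallel edges turns the other one into a loop, which explains the two
missing terms; along the long arm letters are deleted with alternating signs. The five analogues
below differ only in the shape: an arm of length one is pinched to give a figure eight, and an arm
of length two becomes a single edge. -/
theorem theta115_circ {g : Gra K 4} (hg : Alternating g) (hl : NoLoops g)
    (x y z1 z2 z3 z4 z5 : Letter) :
    val (Gra.circ g (mc K)) (theta115 x y z1 z2 z3 z4 z5) =
      0 - z1.sgn K * val g (theta114 x y z2 z3 z4 z5) + z2.sgn K * val g (theta114 x y z1 z3 z4 z5)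
        - z3.sgn K * val g (theta114 x y z1 z2 z4 z5) + z4.sgn K * val g (theta114 x y z1 z2 z3
        z5) - z5.sgn K * val g (theta114 x y z1 z2 z3 z4) := by
  refine (pair_prodE_circ_mc (theta115 x y z1 z2 z3 z4 z5) (by simp [theta115]) g).trans ?_
  refine (sum_seven
    (contract_loop hl _ _ _ _ (by exact ⟨0, _, .head _⟩))
    (contract_loop hl _ _ _ _ (by exact ⟨0, _, .head _⟩))
    (contract_eq hg 0 2 z1 ![0, 1, 2, 3, 4] ![0, 1, 2, 3, 4] (by decide) (-1)
      (theta114 x y z2 z3 z4 z5) (by decide +kernel)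
      (.refl _))
    (contract_eq hg 2 3 z2 ![1, 2, 0, 3, 4] ![2, 0, 1, 3, 4] (by decide) 1
      (theta114 x y z1 z3 z4 z5) (by decide +kernel)
      (.refl _))
    (contract_eq hg 3 4 z3 ![1, 2, 3, 0, 4] ![3, 0, 1, 2, 4] (by decide) (-1)
      (theta114 x y z1 z2 z4 z5) (by decide +kernel)
      (.refl _))
    (contract_eq hg 4 5 z4 ![1, 2, 3, 4, 0] ![4, 0, 1, 2, 3] (by decide) 1
      (theta114 x y z1 z2 z3 z5) (by decide +kernel)
      (.refl _))
    (contract_eq hg 5 1 z5 ![1, 0, 2, 3, 4] ![1, 0, 2, 3, 4] (by decide) (-1)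
      (theta114 x y z1 z2 z3 z4) (by decide +kernel)
      (.refl _))).trans ?_
  push_cast
  ring

theorem theta124_circ {g : Gra K 4} (hg : Alternating g)
    (x w1 w2 z1 z2 z3 z4 : Letter) :
    val (Gra.circ g (mc K)) (theta124 x w1 w2 z1 z2 z3 z4) =
      x.sgn K * val g (eight24 w1 w2 z1 z2 z3 z4) - w1.sgn K * val g (theta114 x w2 z1 z2 z3 z4)
        + w2.sgn K * val g (theta114 x w1 z1 z2 z3 z4) + z1.sgn K * val g (theta123 x w1 w2 z2 z3
        z4) - z2.sgn K * val g (theta123 x w1 w2 z1 z3 z4) + z3.sgn K * val g (theta123 x w1 w2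
        z1 z2 z4) - z4.sgn K * val g (theta123 x w1 w2 z1 z2 z3) := by
  refine (pair_prodE_circ_mc (theta124 x w1 w2 z1 z2 z3 z4) (by simp [theta124]) g).trans ?_
  refine (sum_seven
    (contract_eq hg 0 1 x ![0, 1, 2, 3, 4] ![0, 1, 2, 3, 4] (by decide) 1
      (eight24 w1 w2 z1 z2 z3 z4) (by decide +kernel)
      (.refl _))
    (contract_eq hg 0 2 w1 ![0, 1, 2, 3, 4] ![0, 1, 2, 3, 4] (by decide) (-1)
      (theta114 x w2 z1 z2 z3 z4) (by decide +kernel)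
      (.refl _))
    (contract_eq hg 2 1 w2 ![1, 0, 2, 3, 4] ![1, 0, 2, 3, 4] (by decide) 1
      (theta114 x w1 z1 z2 z3 z4) (by decide +kernel)
      (.refl _))
    (contract_eq hg 0 3 z1 ![0, 1, 2, 3, 4] ![0, 1, 2, 3, 4] (by decide) 1
      (theta123 x w1 w2 z2 z3 z4) (by decide +kernel)
      (.refl _))
    (contract_eq hg 3 4 z2 ![1, 2, 3, 0, 4] ![3, 0, 1, 2, 4] (by decide) (-1)
      (theta123 x w1 w2 z1 z3 z4) (by decide +kernel)
      (.refl _))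
    (contract_eq hg 4 5 z3 ![1, 2, 3, 4, 0] ![4, 0, 1, 2, 3] (by decide) 1
      (theta123 x w1 w2 z1 z2 z4) (by decide +kernel)
      (.refl _))
    (contract_eq hg 5 1 z4 ![1, 0, 2, 3, 4] ![1, 0, 2, 3, 4] (by decide) (-1)
      (theta123 x w1 w2 z1 z2 z3) (by decide +kernel)
      (.refl _))).trans ?_
  push_cast
  ring

theorem theta133_circ {g : Gra K 4} (hg : Alternating g)
    (x w1 w2 w3 z1 z2 z3 : Letter) :
    val (Gra.circ g (mc K)) (theta133 x w1 w2 w3 z1 z2 z3) =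
      x.sgn K * val g (eight33 w1 w2 w3 z1 z2 z3) - w1.sgn K * val g (theta123 x w2 w3 z1 z2 z3)
        + w2.sgn K * val g (theta123 x w1 w3 z1 z2 z3) - w3.sgn K * val g (theta123 x w1 w2 z1 z2
        z3) - z1.sgn K * val g (theta123 x z2 z3 w1 w2 w3) + z2.sgn K * val g (theta123 x z1 z3
        w1 w2 w3) - z3.sgn K * val g (theta123 x z1 z2 w1 w2 w3) := by
  refine (pair_prodE_circ_mc (theta133 x w1 w2 w3 z1 z2 z3) (by simp [theta133]) g).trans ?_
  refine (sum_seven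
    (contract_eq hg 0 1 x ![0, 1, 2, 3, 4] ![0, 1, 2, 3, 4] (by decide) 1
      (eight33 w1 w2 w3 z1 z2 z3) (by decide +kernel)
      (.refl _))
    (contract_eq hg 0 2 w1 ![0, 1, 2, 3, 4] ![0, 1, 2, 3, 4] (by decide) (-1)
      (theta123 x w2 w3 z1 z2 z3) (by decide +kernel)
      (.refl _))
    (contract_eq hg 2 3 w2 ![1, 2, 0, 3, 4] ![2, 0, 1, 3, 4] (by decide) 1
      (theta123 x w1 w3 z1 z2 z3) (by decide +kernel)
      (.refl _))
    (contract_eq hg 3 1 w3 ![1, 0, 2, 3, 4] ![1, 0, 2, 3, 4] (by decide) (-1)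
      (theta123 x w1 w2 z1 z2 z3) (by decide +kernel)
      (.refl _))
    (contract_eq hg 0 4 z1 ![0, 1, 4, 2, 3] ![0, 1, 3, 4, 2] (by decide) (-1)
      (theta123 x z2 z3 w1 w2 w3) (by decide +kernel)
      (by exact .cons _ (List.perm_append_comm (l₁ := [_, _, _]) (l₂ := [_, _]))))
    (contract_eq hg 4 5 z2 ![1, 2, 0, 3, 4] ![2, 0, 1, 3, 4] (by decide) 1
      (theta123 x z1 z3 w1 w2 w3) (by decide +kernel)
      (by exact .cons _ (List.perm_append_comm (l₁ := [_, _, _]) (l₂ := [_, _]))))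
    (contract_eq hg 5 1 z3 ![1, 0, 4, 2, 3] ![1, 0, 3, 4, 2] (by decide) (-1)
      (theta123 x z1 z2 w1 w2 w3) (by decide +kernel)
      (by exact .cons _ (List.perm_append_comm (l₁ := [_, _, _]) (l₂ := [_, _]))))).trans ?_
  push_cast
  ring

theorem theta223_circ {g : Gra K 4} (hg : Alternating g)
    (v1 v2 w1 w2 z1 z2 z3 : Letter) :
    val (Gra.circ g (mc K)) (theta223 v1 v2 w1 w2 z1 z2 z3) =
      0 - v1.sgn K * val g (theta123 v2 w1 w2 z1 z2 z3) + v2.sgn K * val g (theta123 v1 w1 w2 z1 z2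
        z3) + w1.sgn K * val g (theta123 w2 v1 v2 z1 z2 z3) - w2.sgn K * val g (theta123 w1 v1 v2
        z1 z2 z3) - z1.sgn K * val g (theta222 v1 v2 w1 w2 z2 z3) + z2.sgn K * val g (theta222 v1
        v2 w1 w2 z1 z3) - z3.sgn K * val g (theta222 v1 v2 w1 w2 z1 z2) := by
  refine (pair_prodE_circ_mc (theta223 v1 v2 w1 w2 z1 z2 z3) (by simp [theta223]) g).trans ?_
  refine (sum_seven
    (contract_eq hg 0 2 v1 ![0, 1, 2, 3, 4] ![0, 1, 2, 3, 4] (by decide) (-1)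
      (theta123 v2 w1 w2 z1 z2 z3) (by decide +kernel)
      (.refl _))
    (contract_eq hg 2 1 v2 ![1, 0, 2, 3, 4] ![1, 0, 2, 3, 4] (by decide) 1
      (theta123 v1 w1 w2 z1 z2 z3) (by decide +kernel)
      (.refl _))
    (contract_eq hg 0 3 w1 ![0, 1, 2, 3, 4] ![0, 1, 2, 3, 4] (by decide) 1
      (theta123 w2 v1 v2 z1 z2 z3) (by decide +kernel)
      (by exact (List.perm_append_comm (l₁ := [_, _]) (l₂ := [_])).append_right [_, _, _]))
    (contract_eq hg 3 1 w2 ![1, 0, 2, 3, 4] ![1, 0, 2, 3, 4] (by decide) (-1)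
      (theta123 w1 v1 v2 z1 z2 z3) (by decide +kernel)
      (by exact (List.perm_append_comm (l₁ := [_, _]) (l₂ := [_])).append_right [_, _, _]))
    (contract_eq hg 0 4 z1 ![0, 1, 2, 3, 4] ![0, 1, 2, 3, 4] (by decide) (-1)
      (theta222 v1 v2 w1 w2 z2 z3) (by decide +kernel)
      (.refl _))
    (contract_eq hg 4 5 z2 ![1, 2, 3, 4, 0] ![4, 0, 1, 2, 3] (by decide) 1
      (theta222 v1 v2 w1 w2 z1 z3) (by decide +kernel)
      (.refl _))
    (contract_eq hg 5 1 z3 ![1, 0, 2, 3, 4] ![1, 0, 2, 3, 4] (by decide) (-1)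
      (theta222 v1 v2 w1 w2 z1 z2) (by decide +kernel)
      (.refl _))).trans ?_
  push_cast
  ring

theorem eight25_circ {g : Gra K 4} (hg : Alternating g) (hl : NoLoops g)
    (w1 w2 z1 z2 z3 z4 z5 : Letter) :
    val (Gra.circ g (mc K)) (eight25 w1 w2 z1 z2 z3 z4 z5) =
      0 - z1.sgn K * val g (eight24 w1 w2 z2 z3 z4 z5) + z2.sgn K * val g (eight24 w1 w2 z1 z3 z4
        z5) - z3.sgn K * val g (eight24 w1 w2 z1 z2 z4 z5) + z4.sgn K * val g (eight24 w1 w2 z1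
        z2 z3 z5) - z5.sgn K * val g (eight24 w1 w2 z1 z2 z3 z4) := by
  refine (pair_prodE_circ_mc (eight25 w1 w2 z1 z2 z3 z4 z5) (by simp [eight25]) g).trans ?_
  refine (sum_seven
    (contract_loop hl _ _ _ _ (by exact ⟨0, _, .head _⟩))
    (contract_loop hl _ _ _ _ (by exact ⟨0, _, .head _⟩))
    (contract_eq hg 0 2 z1 ![0, 1, 2, 3, 4] ![0, 1, 2, 3, 4] (by decide) (-1)
      (eight24 w1 w2 z2 z3 z4 z5) (by decide +kernel)
      (.refl _))
    (contract_eq hg 2 3 z2 ![1, 2, 0, 3, 4] ![2, 0, 1, 3, 4] (by decide) 1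
      (eight24 w1 w2 z1 z3 z4 z5) (by decide +kernel)
      (.refl _))
    (contract_eq hg 3 4 z3 ![1, 2, 3, 0, 4] ![3, 0, 1, 2, 4] (by decide) (-1)
      (eight24 w1 w2 z1 z2 z4 z5) (by decide +kernel)
      (.refl _))
    (contract_eq hg 4 5 z4 ![1, 2, 3, 4, 0] ![4, 0, 1, 2, 3] (by decide) 1
      (eight24 w1 w2 z1 z2 z3 z5) (by decide +kernel)
      (.refl _))
    (contract_eq hg 5 0 z5 ![0, 1, 2, 3, 4] ![0, 1, 2, 3, 4] (by decide) (-1)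
      (eight24 w1 w2 z1 z2 z3 z4) (by decide +kernel)
      (.refl _))).trans ?_
  push_cast
  ring

theorem eight34_circ {g : Gra K 4} (hg : Alternating g)
    (w1 w2 w3 z1 z2 z3 z4 : Letter) :
    val (Gra.circ g (mc K)) (eight34 w1 w2 w3 z1 z2 z3 z4) =
      w1.sgn K * val g (eight24 w2 w3 z1 z2 z3 z4) - w2.sgn K * val g (eight24 w1 w3 z1 z2 z3 z4)
        + w3.sgn K * val g (eight24 w1 w2 z1 z2 z3 z4) + z1.sgn K * val g (eight33 w1 w2 w3 z2 z3
        z4) - z2.sgn K * val g (eight33 w1 w2 w3 z1 z3 z4) + z3.sgn K * val g (eight33 w1 w2 w3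
        z1 z2 z4) - z4.sgn K * val g (eight33 w1 w2 w3 z1 z2 z3) := by
  refine (pair_prodE_circ_mc (eight34 w1 w2 w3 z1 z2 z3 z4) (by simp [eight34]) g).trans ?_
  refine (sum_seven
    (contract_eq hg 0 1 w1 ![0, 1, 2, 3, 4] ![0, 1, 2, 3, 4] (by decide) 1
      (eight24 w2 w3 z1 z2 z3 z4) (by decide +kernel)
      (.refl _))
    (contract_eq hg 1 2 w2 ![1, 0, 2, 3, 4] ![1, 0, 2, 3, 4] (by decide) (-1)
      (eight24 w1 w3 z1 z2 z3 z4) (by decide +kernel)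
      (.refl _))
    (contract_eq hg 2 0 w3 ![0, 1, 2, 3, 4] ![0, 1, 2, 3, 4] (by decide) 1
      (eight24 w1 w2 z1 z2 z3 z4) (by decide +kernel)
      (.refl _))
    (contract_eq hg 0 3 z1 ![0, 1, 2, 3, 4] ![0, 1, 2, 3, 4] (by decide) 1
      (eight33 w1 w2 w3 z2 z3 z4) (by decide +kernel)
      (.refl _))
    (contract_eq hg 3 4 z2 ![1, 2, 3, 0, 4] ![3, 0, 1, 2, 4] (by decide) (-1)
      (eight33 w1 w2 w3 z1 z3 z4) (by decide +kernel)
      (.refl _))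
    (contract_eq hg 4 5 z3 ![1, 2, 3, 4, 0] ![4, 0, 1, 2, 3] (by decide) 1
      (eight33 w1 w2 w3 z1 z2 z4) (by decide +kernel)
      (.refl _))
    (contract_eq hg 5 0 z4 ![0, 1, 2, 3, 4] ![0, 1, 2, 3, 4] (by decide) (-1)
      (eight33 w1 w2 w3 z1 z2 z3) (by decide +kernel)
      (.refl _))).trans ?_
  push_cast
  ring

end BiGC

end

noncomputable section

namespace BiGC

open MvPolynomial

variable {K : Type*} [Field K]

/-! ### Graphs given by lists of edges -/

/-- The graph with the given edges. -/
def graph {V : Type} (l : List (V × V × Letter)) : BiGraph V :=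
  (l.map fun e => Finsupp.single (edge e.1 e.2.1 e.2.2) 1).sum

theorem graph_cons {V : Type} (e : V × V × Letter) (l : List (V × V × Letter)) :
    graph (e :: l) = Finsupp.single (edge e.1 e.2.1 e.2.2) 1 + graph l := by
  simp [graph]

theorem prodE_eq_monomial {V : Type} (l : List (V × V × Letter)) :
    prodE K l = monomial (graph l) 1 := by
  induction l with
  | nil => simp [prodE, graph]
  | cons e l ih =>
    have h : prodE K (e :: l) = E K e.1 e.2.1 e.2.2 * prodE K l := by simp [prodE]
    rw [h, ih, graph_cons, E, X, monomial_mul, one_mul]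

theorem mem_support_graph {V : Type} (l : List (V × V × Letter)) (x : BiEdge V) :
    x ∈ (graph l).support ↔ ∃ e ∈ l, edge e.1 e.2.1 e.2.2 = x := by
  classical
  induction l with
  | nil => simp [graph]
  | cons e l ih =>
    rw [graph_cons, Finsupp.mem_support_iff, Finsupp.add_apply, Ne, Nat.add_eq_zero_iff, not_and_or,
      ← Ne, ← Ne, ← Finsupp.mem_support_iff, ← Finsupp.mem_support_iff, ih]
    simp [eq_comm]

theorem toMultiset_graph {V : Type} (l : List (V × V × Letter)) :
    Finsupp.toMultiset (graph l) = ↑(l.map fun e => edge e.1 e.2.1 e.2.2) := by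
  induction l with
  | nil => simp [graph]
  | cons e l ih => rw [graph_cons, map_add, ih]; simp

theorem sym2_edge {V : Type} (s t : V) (l : Letter) :
    s((edge s t l).1, (edge s t l).2.1) = s(s, t) := by
  rcases l with ⟨_ | _, _ | _⟩ <;> simp [edge, Sym2.eq_swap]

theorem shape_graph {V : Type} (l : List (V × V × Letter)) :
    (graph l).shape = ↑(l.map fun e => s(e.1, e.2.1)) := by
  rw [BiGraph.shape, toMultiset_graph, Multiset.map_coe, List.map_map]
  congr 1
  refine List.map_congr_left fun e _ => ?_
  exact sym2_edge _ _ _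

/-- Induction on `S`: an edge of `G` over the first pair is split off, and its letter is read off
from whether its black arrow follows the orientation of that pair. -/
theorem exists_graph_of_shape {V : Type} (S : List (V × V)) (G : BiGraph V)
    (h : G.shape = ↑(S.map fun e => s(e.1, e.2))) :
    ∃ l : List (V × V × Letter), l.map (fun e => (e.1, e.2.1)) = S ∧ G = graph l := by
  classical
  induction S generalizing G with
  | nil =>
    refine ⟨[], rfl, ?_⟩
    have h0 : Finsupp.toMultiset G = 0 := by simpa [BiGraph.shape] using h
    have h1 : G = 0 := by
      ext x
      rw [← Finsupp.count_toMultiset, h0]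
      rfl
    simp [graph, h1]
  | cons a S ih =>
    rw [List.map_cons, ← Multiset.cons_coe, BiGraph.shape, ← Multiset.map_eq_cons] at h
    obtain ⟨e, he, h1, h2⟩ := h
    have h3 : Finsupp.toMultiset (G - Finsupp.single e 1) = (Finsupp.toMultiset G).erase e := by
      ext x
      rw [Finsupp.count_toMultiset, Finsupp.tsub_apply]
      by_cases hx : x = e
      · subst hx
        simp [Finsupp.count_toMultiset]
      · rw [Multiset.count_erase_of_ne hx, Finsupp.count_toMultiset,
          Finsupp.single_eq_of_ne hx, tsub_zero]
    rw [← h3] at h2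
    obtain ⟨l, hl, hG⟩ := ih _ h2
    have h4 : ∃ ℓ : Letter, edge a.1 a.2 ℓ = e := by
      obtain ⟨s, t, r⟩ := e
      obtain ⟨u, v⟩ := a
      rcases Sym2.eq_iff.1 h1 with ⟨rfl, rfl⟩ | ⟨rfl, rfl⟩
      · exact ⟨(true, r), rfl⟩
      · exact ⟨(false, !r), by simp [edge]⟩
    obtain ⟨ℓ, hℓ⟩ := h4
    refine ⟨(a.1, a.2, ℓ) :: l, by simp [hl], ?_⟩
    rw [graph_cons, ← hG, hℓ, add_comm, tsub_add_cancel_of_le]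
    rw [Finsupp.single_le_iff, Nat.one_le_iff_ne_zero]
    exact Finsupp.mem_support_iff.1 ((Finsupp.mem_toMultiset G e).1 he)

theorem val_ne_zero {p : ℕ} {g : Gra K p} {l : List (Fin (p + 1) × Fin (p + 1) × Letter)}
    (h : val g l ≠ 0) : graph l ∈ g.support := by
  rw [val, prodE_eq_monomial] at h
  exact mem_support_of_pair_ne_zero h

/-! ### Cycles -/

/-- The arrows of one colour. -/
def arrows {V : Type} (c : Letter → Bool) (l : List (V × V × Letter)) : List (V × V) :=
  l.map fun e => if c e.2.2 then (e.1, e.2.1) else (e.2.1, e.1)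

theorem black_graph {V : Type} (l : List (V × V × Letter)) (u v : V) :
    (graph l).Black u v ↔ (u, v) ∈ arrows Prod.fst l := by
  simp only [BiGraph.Black, mem_support_graph, arrows, List.mem_map]
  constructor
  · rintro ⟨_, ⟨⟨s, t, b, r⟩, he, rfl⟩, rfl, rfl⟩
    exact ⟨_, he, by cases b <;> rfl⟩
  · rintro ⟨⟨s, t, b, r⟩, he, h⟩
    refine ⟨_, ⟨_, he, rfl⟩, ?_⟩
    cases b <;> simp_all [edge]

theorem red_graph {V : Type} (l : List (V × V × Letter)) (u v : V) :
    (graph l).Red u v ↔ (u, v) ∈ arrows Prod.snd l := by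
  simp only [BiGraph.Red, mem_support_graph, arrows, List.mem_map]
  constructor
  · rintro ⟨_, ⟨⟨s, t, b, r⟩, he, rfl⟩, h⟩
    refine ⟨_, he, ?_⟩
    cases b <;> cases r <;> simp_all [edge]
  · rintro ⟨⟨s, t, b, r⟩, he, h⟩
    refine ⟨_, ⟨_, he, rfl⟩, ?_⟩
    cases b <;> cases r <;> simp_all [edge]

/-- The length of a longest path of arrows ending in a vertex, up to `n`. -/
def height {V : Type} [DecidableEq V] (A : List (V × V)) : ℕ → V → ℕ
  | 0, _ => 0
  | n + 1, v => (A.map fun a => if a.2 = v then height A n a.1 + 1 else 0).foldl max 0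

/-- A sufficient criterion for the absence of cycles. -/
def acyclic {V : Type} [DecidableEq V] (n : ℕ) (A : List (V × V)) : Bool :=
  A.all fun a => height A n a.1 < height A n a.2

/-- A function that increases strictly along arrows, here `height`, excludes cycles. This makes
acyclicity a decidable check on lists. -/
theorem not_cycle {V : Type} (R : V → V → Prop) (r : V → ℕ) (h : ∀ u v, R u v → r u < r v) :
    ¬ ∃ v, Relation.TransGen R v v := by
  rintro ⟨v, hv⟩
  have h1 : ∀ u w, Relation.TransGen R u w → r u < r w := by
    intro u w huw
    induction huw with
    | single h2 => exact h _ _ h2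
    | tail _ h2 ih => exact ih.trans (h _ _ h2)
  exact lt_irrefl _ (h1 v v hv)

theorem not_cycle_of_acyclic {V : Type} [DecidableEq V] {R : V → V → Prop} {A : List (V × V)}
    {n : ℕ} (hR : ∀ u v, R u v ↔ (u, v) ∈ A) (h : acyclic n A = true) :
    ¬ ∃ v, Relation.TransGen R v v := by
  refine not_cycle R (height A n) fun u v huv => ?_
  rw [acyclic, List.all_eq_true] at h
  simpa using h _ ((hR u v).1 huv)

theorem not_hasBlackCycle {V : Type} [DecidableEq V] (n : ℕ) {l : List (V × V × Letter)}
    (h : acyclic n (arrows Prod.fst l) = true) : ¬ (graph l).HasBlackCycle :=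
  not_cycle_of_acyclic (black_graph l) h

theorem not_hasRedCycle {V : Type} [DecidableEq V] (n : ℕ) {l : List (V × V × Letter)}
    (h : acyclic n (arrows Prod.snd l) = true) : ¬ (graph l).HasRedCycle :=
  not_cycle_of_acyclic (red_graph l) h

end BiGC

end

noncomputable section

namespace BiGC

open MvPolynomial

variable {K : Type*} [Field K]

/-! ### Symmetries and the cycles of theta graphs -/

/-- Three arms with the given directions form a directed cycle. -/
def cyclicArms (a b c : List Bool) : Bool :=
  (a.all id || b.all id || c.all id) && (a.all not || b.all not || c.all not)

/-- One of two loops with the given directions is a directed cycle. -/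
def cyclicLoops (a b : List Bool) : Bool :=
  a.all id || b.all id || a.all not || b.all not

/-- A cycle in a theta graph runs forward along one arm and backward along another. Only the red
component of a letter matters, so both components are set equal and all colourings are inspected. -/
theorem acyclic_theta123 : ∀ x w1 w2 z1 z2 z3 : Bool,
    cyclicArms [x] [w1, w2] [z1, z2, z3] = false → acyclic 5 (arrows Prod.snd
      (theta123 (x, x) (w1, w1) (w2, w2) (z1, z1) (z2, z2) (z3, z3))) = true := by
  decide +kernel

theorem acyclic_theta222 : ∀ x1 x2 w1 w2 z1 z2 : Bool,
    cyclicArms [x1, x2] [w1, w2] [z1, z2] = false → acyclic 5 (arrows Prod.snd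
      (theta222 (x1, x1) (x2, x2) (w1, w1) (w2, w2) (z1, z1) (z2, z2))) = true := by
  decide +kernel

theorem acyclic_theta114 : ∀ x w z1 z2 z3 z4 : Bool,
    cyclicArms [x] [w] [z1, z2, z3, z4] = false → acyclic 5 (arrows Prod.snd
      (theta114 (x, x) (w, w) (z1, z1) (z2, z2) (z3, z3) (z4, z4))) = true := by
  decide +kernel

theorem acyclic_eight24 : ∀ w1 w2 z1 z2 z3 z4 : Bool,
    cyclicLoops [w1, w2] [z1, z2, z3, z4] = false → acyclic 5 (arrows Prod.snd
      (eight24 (w1, w1) (w2, w2) (z1, z1) (z2, z2) (z3, z3) (z4, z4))) = true := by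
  decide +kernel

theorem acyclic_eight33 : ∀ w1 w2 w3 z1 z2 z3 : Bool,
    cyclicLoops [w1, w2, w3] [z1, z2, z3] = false → acyclic 5 (arrows Prod.snd
      (eight33 (w1, w1) (w2, w2) (w3, w3) (z1, z1) (z2, z2) (z3, z3))) = true := by
  decide +kernel

theorem noUnivalent_prodE (L : List (Fin 6 × Fin 6 × Letter))
    (h : ∀ v, 2 ≤ (L.filter fun e => e.1 = v ∨ e.2.1 = v).length) :
    NoUnivalent (prodE K L : Gra K 5) := by
  intro v
  have h1 := h v
  have hE : ∀ e ∈ L.filter fun e => e.1 = v ∨ e.2.1 = v,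
      ∃ s l, E K e.1 e.2.1 e.2.2 = E K v s l := by
    intro e he
    rcases e with ⟨s, t, l⟩
    have h2 : s = v ∨ t = v := by simpa using (List.mem_filter.1 he).2
    rcases h2 with rfl | rfl
    · exact ⟨t, l, rfl⟩
    · exact ⟨s, l.rev, (E_rev _ _ _).symm⟩
  have hp := List.filter_append_perm (fun e : Fin 6 × Fin 6 × Letter => e.1 = v ∨ e.2.1 = v) L
  match hf : L.filter fun e => e.1 = v ∨ e.2.1 = v with
  | [] => rw [hf] at h1; simp at h1
  | [_] => rw [hf] at h1; simp at h1
  | e :: e' :: r =>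
    rw [hf] at hp hE
    obtain ⟨s, l, hs⟩ := hE e (by simp)
    obtain ⟨t, l', ht⟩ := hE e' (by simp)
    refine ⟨s, t, l, l', prodE K (r ++ L.filter fun e => !decide (e.1 = v ∨ e.2.1 = v)), ?_⟩
    rw [← prodE_perm hp, ← hs, ← ht]
    simp only [prodE, List.cons_append, List.map_cons, List.prod_cons]

/-- Turning the theta graph around exchanges the trivalent vertices and reverses the arm of length
three; this product of two transpositions is even. -/
theorem val_theta123_rev {g : Gra K 4} (hg : Alternating g) (x w1 w2 z1 z2 z3 : Letter) :
    val g (theta123 x.rev w2.rev w1.rev z3.rev z2.rev z1.rev) =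
      val g (theta123 x w1 w2 z1 z2 z3) := by
  have h := pair_prodE_perm hg (permOf ![1, 0, 2, 4, 3] ![1, 0, 2, 4, 3] (by decide)) 1 (by decide)
    (l := theta123 x.rev w2.rev w1.rev z3.rev z2.rev z1.rev) (l' := theta123 x w1 w2 z1 z2 z3)
    (by simp [prodE, mapV, theta123, permOf, E_rev, -mul_eq_mul_left_iff, -mul_eq_mul_right_iff]
        ring)
  rw [val, h, val]
  simp

theorem val_theta114_swap {g : Gra K 4} (x y z1 z2 z3 z4 : Letter) :
    val g (theta114 y x z1 z2 z3 z4) = val g (theta114 x y z1 z2 z3 z4) := by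
  have h : prodE K (theta114 y x z1 z2 z3 z4) = prodE K (theta114 x y z1 z2 z3 z4) := by
    simp [prodE, theta114, -mul_eq_mul_left_iff, -mul_eq_mul_right_iff]
    ring
  rw [val, h, val]

theorem val_theta114_rev {g : Gra K 4} (hg : Alternating g) (x y z1 z2 z3 z4 : Letter) :
    val g (theta114 x.rev y.rev z4.rev z3.rev z2.rev z1.rev) =
      val g (theta114 x y z1 z2 z3 z4) := by
  have h := pair_prodE_perm hg (permOf ![1, 0, 4, 3, 2] ![1, 0, 4, 3, 2] (by decide)) 1 (by decide)
    (l := theta114 x.rev y.rev z4.rev z3.rev z2.rev z1.rev) (l' := theta114 x y z1 z2 z3 z4)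
    (by simp [prodE, mapV, theta114, permOf, E_rev, -mul_eq_mul_left_iff, -mul_eq_mul_right_iff]
        ring)
  rw [val, h, val]
  simp

theorem val_theta222_rev {g : Gra K 4} (hg : Alternating g) (x1 x2 w1 w2 z1 z2 : Letter) :
    val g (theta222 x2.rev x1.rev z2.rev z1.rev w2.rev w1.rev) =
      val g (theta222 x1 x2 w1 w2 z1 z2) := by
  have h := pair_prodE_perm hg (permOf ![1, 0, 2, 4, 3] ![1, 0, 2, 4, 3] (by decide)) 1 (by decide)
    (l := theta222 x2.rev x1.rev z2.rev z1.rev w2.rev w1.rev) (l' := theta222 x1 x2 w1 w2 z1 z2)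
    (by simp [prodE, mapV, theta222, permOf, E_rev, -mul_eq_mul_left_iff, -mul_eq_mul_right_iff]
        ring)
  rw [val, h, val]
  simp

/-- Exchanging two arms of length two transposes their midpoints, which is odd. -/
theorem val_theta222_swap {g : Gra K 4} (hg : Alternating g) (x1 x2 w1 w2 z1 z2 : Letter) :
    val g (theta222 x1 x2 z1 z2 w1 w2) = -val g (theta222 x1 x2 w1 w2 z1 z2) := by
  have h := pair_prodE_perm hg (permOf ![0, 1, 2, 4, 3] ![0, 1, 2, 4, 3] (by decide)) (-1)
    (by decide) (l := theta222 x1 x2 z1 z2 w1 w2) (l' := theta222 x1 x2 w1 w2 z1 z2)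
    (by simp [prodE, mapV, theta222, permOf, -mul_eq_mul_left_iff, -mul_eq_mul_right_iff]
        ring)
  rw [val, h, val]
  simp

theorem val_theta222_swap' {g : Gra K 4} (hg : Alternating g) (x1 x2 w1 w2 z1 z2 : Letter) :
    val g (theta222 w1 w2 x1 x2 z1 z2) = -val g (theta222 x1 x2 w1 w2 z1 z2) := by
  have h := pair_prodE_perm hg (permOf ![0, 1, 3, 2, 4] ![0, 1, 3, 2, 4] (by decide)) (-1)
    (by decide) (l := theta222 w1 w2 x1 x2 z1 z2) (l' := theta222 x1 x2 w1 w2 z1 z2)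
    (by simp [prodE, mapV, theta222, permOf, -mul_eq_mul_left_iff, -mul_eq_mul_right_iff]
        ring)
  rw [val, h, val]
  simp

theorem val_eight24_rev {g : Gra K 4} (w1 w2 z1 z2 z3 z4 : Letter) :
    val g (eight24 w2.rev w1.rev z1 z2 z3 z4) = val g (eight24 w1 w2 z1 z2 z3 z4) := by
  have h : prodE K (eight24 w2.rev w1.rev z1 z2 z3 z4) = prodE K (eight24 w1 w2 z1 z2 z3 z4) := by
    simp [prodE, eight24, E_rev, -mul_eq_mul_left_iff, -mul_eq_mul_right_iff]
    ring
  rw [val, h, val]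

theorem val_eight24_rev' {g : Gra K 4} (hg : Alternating g) (w1 w2 z1 z2 z3 z4 : Letter) :
    val g (eight24 w1 w2 z4.rev z3.rev z2.rev z1.rev) = -val g (eight24 w1 w2 z1 z2 z3 z4) := by
  have h := pair_prodE_perm hg (permOf ![0, 1, 4, 3, 2] ![0, 1, 4, 3, 2] (by decide)) (-1)
    (by decide) (l := eight24 w1 w2 z4.rev z3.rev z2.rev z1.rev) (l' := eight24 w1 w2 z1 z2 z3 z4)
    (by simp [prodE, mapV, eight24, permOf, E_rev, -mul_eq_mul_left_iff, -mul_eq_mul_right_iff]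
        ring)
  rw [val, h, val]
  simp

theorem val_eight33_swap {g : Gra K 4} (hg : Alternating g) (w1 w2 w3 z1 z2 z3 : Letter) :
    val g (eight33 z1 z2 z3 w1 w2 w3) = val g (eight33 w1 w2 w3 z1 z2 z3) := by
  have h := pair_prodE_perm hg (permOf ![0, 3, 4, 1, 2] ![0, 3, 4, 1, 2] (by decide)) 1
    (by decide) (l := eight33 z1 z2 z3 w1 w2 w3) (l' := eight33 w1 w2 w3 z1 z2 z3)
    (by simp [prodE, mapV, eight33, permOf, -mul_eq_mul_left_iff, -mul_eq_mul_right_iff]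
        ring)
  rw [val, h, val]
  simp

theorem val_eight33_rev {g : Gra K 4} (hg : Alternating g) (w1 w2 w3 z1 z2 z3 : Letter) :
    val g (eight33 w3.rev w2.rev w1.rev z1 z2 z3) = -val g (eight33 w1 w2 w3 z1 z2 z3) := by
  have h := pair_prodE_perm hg (permOf ![0, 2, 1, 3, 4] ![0, 2, 1, 3, 4] (by decide)) (-1)
    (by decide) (l := eight33 w3.rev w2.rev w1.rev z1 z2 z3) (l' := eight33 w1 w2 w3 z1 z2 z3)
    (by simp [prodE, mapV, eight33, permOf, E_rev, -mul_eq_mul_left_iff, -mul_eq_mul_right_iff]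
        ring)
  rw [val, h, val]
  simp

/-! ### Shapes -/

theorem not_hasShape_C {L : List (Fin 6 × Fin 6 × Letter)} (S : Multiset (Sym2 (Fin 6)))
    (hS : ((L.map fun e => s(e.1, e.2.1) : List (Sym2 (Fin 6))) : Multiset (Sym2 (Fin 6))) = S)
    (h : ∀ φ : Fin 6 ≃ Fin 6, shapeC.map (Sym2.map φ) ≠ S) : ¬ (graph L).HasShape shapeC := by
  rintro ⟨φ, hφ⟩
  rw [shape_graph, hS] at hφ
  exact h φ hφ

end BiGC

end

noncomputable section

namespace BiGC

open MvPolynomial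

variable {K : Type*} [Field K]

/-! ### Cocycles of graphs with red cycles -/

/-- Combinations of graphs with red cycles, the differential of which consists of graphs of
shape `C` without red cycles, up to graphs with univalent vertices. -/
structure RedCocycle (g : Gra K 4) : Prop where
  alt : Alternating g
  loops : NoLoops g
  red : ∀ L, val g L ≠ 0 → (graph L).HasRedCycle
  shape_C : ∀ L, NoUnivalent (prodE K L : Gra K 5) → val (Gra.circ g (mc K)) L ≠ 0 →
    (graph L).HasShape shapeC
  not_red : ∀ L, NoUnivalent (prodE K L : Gra K 5) → val (Gra.circ g (mc K)) L ≠ 0 →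
    ¬ (graph L).HasRedCycle

theorem noUnivalent_theta115 (x y z1 z2 z3 z4 z5 : Letter) :
    NoUnivalent (prodE K (theta115 x y z1 z2 z3 z4 z5) : Gra K 5) :=
  noUnivalent_prodE _ fun v => by fin_cases v <;> simp [theta115]

theorem noUnivalent_theta124 (x w1 w2 z1 z2 z3 z4 : Letter) :
    NoUnivalent (prodE K (theta124 x w1 w2 z1 z2 z3 z4) : Gra K 5) :=
  noUnivalent_prodE _ fun v => by fin_cases v <;> simp [theta124]

theorem noUnivalent_theta133 (x w1 w2 w3 z1 z2 z3 : Letter) :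
    NoUnivalent (prodE K (theta133 x w1 w2 w3 z1 z2 z3) : Gra K 5) :=
  noUnivalent_prodE _ fun v => by fin_cases v <;> simp [theta133]

theorem noUnivalent_theta223 (v1 v2 w1 w2 z1 z2 z3 : Letter) :
    NoUnivalent (prodE K (theta223 v1 v2 w1 w2 z1 z2 z3) : Gra K 5) :=
  noUnivalent_prodE _ fun v => by fin_cases v <;> simp [theta223]

theorem noUnivalent_eight25 (w1 w2 z1 z2 z3 z4 z5 : Letter) :
    NoUnivalent (prodE K (eight25 w1 w2 z1 z2 z3 z4 z5) : Gra K 5) :=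
  noUnivalent_prodE _ fun v => by fin_cases v <;> simp [eight25]

theorem noUnivalent_eight34 (w1 w2 w3 z1 z2 z3 z4 : Letter) :
    NoUnivalent (prodE K (eight34 w1 w2 w3 z1 z2 z3 z4) : Gra K 5) :=
  noUnivalent_prodE _ fun v => by fin_cases v <;> simp [eight34]

theorem not_hasShape_theta115 (x y z1 z2 z3 z4 z5 : Letter) :
    ¬ (graph (theta115 x y z1 z2 z3 z4 z5)).HasShape shapeC :=
  not_hasShape_C {s(0, 1), s(0, 1), s(0, 2), s(2, 3), s(3, 4), s(4, 5), s(5, 1)} rfl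
    (by decide +kernel)

theorem not_hasShape_theta124 (x w1 w2 z1 z2 z3 z4 : Letter) :
    ¬ (graph (theta124 x w1 w2 z1 z2 z3 z4)).HasShape shapeC :=
  not_hasShape_C {s(0, 1), s(0, 2), s(2, 1), s(0, 3), s(3, 4), s(4, 5), s(5, 1)} rfl
    (by decide +kernel)

theorem not_hasShape_theta223 (v1 v2 w1 w2 z1 z2 z3 : Letter) :
    ¬ (graph (theta223 v1 v2 w1 w2 z1 z2 z3)).HasShape shapeC :=
  not_hasShape_C {s(0, 2), s(2, 1), s(0, 3), s(3, 1), s(0, 4), s(4, 5), s(5, 1)} rfl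
    (by decide +kernel)

theorem not_hasShape_eight25 (w1 w2 z1 z2 z3 z4 z5 : Letter) :
    ¬ (graph (eight25 w1 w2 z1 z2 z3 z4 z5)).HasShape shapeC :=
  not_hasShape_C {s(0, 1), s(1, 0), s(0, 2), s(2, 3), s(3, 4), s(4, 5), s(5, 0)} rfl
    (by decide +kernel)

theorem not_hasShape_eight34 (w1 w2 w3 z1 z2 z3 z4 : Letter) :
    ¬ (graph (eight34 w1 w2 w3 z1 z2 z3 z4)).HasShape shapeC :=
  not_hasShape_C {s(0, 1), s(1, 2), s(2, 0), s(0, 3), s(3, 4), s(4, 5), s(5, 0)} rfl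
    (by decide +kernel)

namespace RedCocycle

variable {g : Gra K 4}

/-- This lemma and its four analogues discard terms in all linear equations below: contractions
without red cycle have coefficient zero. -/
theorem red123 (h : RedCocycle g) (x w1 w2 z1 z2 z3 : Letter)
    (hc : cyclicArms [x.2] [w1.2, w2.2] [z1.2, z2.2, z3.2] = false) :
    val g (theta123 x w1 w2 z1 z2 z3) = 0 := by
  by_contra h0
  refine not_hasRedCycle 5 ?_ (h.red _ h0)
  rw [show arrows Prod.snd (theta123 x w1 w2 z1 z2 z3) =
      arrows Prod.snd (theta123 (x.2, x.2) (w1.2, w1.2) (w2.2, w2.2)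
    (z1.2, z1.2) (z2.2, z2.2) (z3.2, z3.2)) from rfl]
  exact acyclic_theta123 _ _ _ _ _ _ hc

theorem red222 (h : RedCocycle g) (x1 x2 w1 w2 z1 z2 : Letter)
    (hc : cyclicArms [x1.2, x2.2] [w1.2, w2.2] [z1.2, z2.2] = false) :
    val g (theta222 x1 x2 w1 w2 z1 z2) = 0 := by
  by_contra h0
  refine not_hasRedCycle 5 ?_ (h.red _ h0)
  rw [show arrows Prod.snd (theta222 x1 x2 w1 w2 z1 z2) =
      arrows Prod.snd (theta222 (x1.2, x1.2) (x2.2, x2.2) (w1.2, w1.2)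
    (w2.2, w2.2) (z1.2, z1.2) (z2.2, z2.2)) from rfl]
  exact acyclic_theta222 _ _ _ _ _ _ hc

theorem red114 (h : RedCocycle g) (x w z1 z2 z3 z4 : Letter)
    (hc : cyclicArms [x.2] [w.2] [z1.2, z2.2, z3.2, z4.2] = false) :
    val g (theta114 x w z1 z2 z3 z4) = 0 := by
  by_contra h0
  refine not_hasRedCycle 5 ?_ (h.red _ h0)
  rw [show arrows Prod.snd (theta114 x w z1 z2 z3 z4) =
      arrows Prod.snd (theta114 (x.2, x.2) (w.2, w.2) (z1.2, z1.2)
    (z2.2, z2.2) (z3.2, z3.2) (z4.2, z4.2)) from rfl]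
  exact acyclic_theta114 _ _ _ _ _ _ hc

theorem red24 (h : RedCocycle g) (w1 w2 z1 z2 z3 z4 : Letter)
    (hc : cyclicLoops [w1.2, w2.2] [z1.2, z2.2, z3.2, z4.2] = false) :
    val g (eight24 w1 w2 z1 z2 z3 z4) = 0 := by
  by_contra h0
  refine not_hasRedCycle 5 ?_ (h.red _ h0)
  rw [show arrows Prod.snd (eight24 w1 w2 z1 z2 z3 z4) =
      arrows Prod.snd (eight24 (w1.2, w1.2) (w2.2, w2.2) (z1.2, z1.2)
    (z2.2, z2.2) (z3.2, z3.2) (z4.2, z4.2)) from rfl]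
  exact acyclic_eight24 _ _ _ _ _ _ hc

theorem red33 (h : RedCocycle g) (w1 w2 w3 z1 z2 z3 : Letter)
    (hc : cyclicLoops [w1.2, w2.2, w3.2] [z1.2, z2.2, z3.2] = false) :
    val g (eight33 w1 w2 w3 z1 z2 z3) = 0 := by
  by_contra h0
  refine not_hasRedCycle 5 ?_ (h.red _ h0)
  rw [show arrows Prod.snd (eight33 w1 w2 w3 z1 z2 z3) =
      arrows Prod.snd (eight33 (w1.2, w1.2) (w2.2, w2.2) (w3.2, w3.2)
    (z1.2, z1.2) (z2.2, z2.2) (z3.2, z3.2)) from rfl]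
  exact acyclic_eight33 _ _ _ _ _ _ hc

theorem zero_theta115 (h : RedCocycle g) (x y z1 z2 z3 z4 z5 : Letter) :
    val (Gra.circ g (mc K)) (theta115 x y z1 z2 z3 z4 z5) = 0 := by
  by_contra h0
  exact not_hasShape_theta115 x y z1 z2 z3 z4 z5 (h.shape_C _
      (noUnivalent_theta115 x y z1 z2 z3 z4 z5) h0)

theorem zero_theta124 (h : RedCocycle g) (x w1 w2 z1 z2 z3 z4 : Letter) :
    val (Gra.circ g (mc K)) (theta124 x w1 w2 z1 z2 z3 z4) = 0 := by
  by_contra h0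
  exact not_hasShape_theta124 x w1 w2 z1 z2 z3 z4 (h.shape_C _
      (noUnivalent_theta124 x w1 w2 z1 z2 z3 z4) h0)

theorem zero_theta223 (h : RedCocycle g) (v1 v2 w1 w2 z1 z2 z3 : Letter) :
    val (Gra.circ g (mc K)) (theta223 v1 v2 w1 w2 z1 z2 z3) = 0 := by
  by_contra h0
  exact not_hasShape_theta223 v1 v2 w1 w2 z1 z2 z3 (h.shape_C _
      (noUnivalent_theta223 v1 v2 w1 w2 z1 z2 z3) h0)

theorem zero_eight25 (h : RedCocycle g) (w1 w2 z1 z2 z3 z4 z5 : Letter) :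
    val (Gra.circ g (mc K)) (eight25 w1 w2 z1 z2 z3 z4 z5) = 0 := by
  by_contra h0
  exact not_hasShape_eight25 w1 w2 z1 z2 z3 z4 z5 (h.shape_C _
      (noUnivalent_eight25 w1 w2 z1 z2 z3 z4 z5) h0)

theorem zero_eight34 (h : RedCocycle g) (w1 w2 w3 z1 z2 z3 z4 : Letter) :
    val (Gra.circ g (mc K)) (eight34 w1 w2 w3 z1 z2 z3 z4) = 0 := by
  by_contra h0
  exact not_hasShape_eight34 w1 w2 w3 z1 z2 z3 z4 (h.shape_C _
      (noUnivalent_eight34 w1 w2 w3 z1 z2 z3 z4) h0)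

/-- Shape C is allowed in the differential, but here the arm `w` together with `x` is a red cycle 0
→ 2 → 3 → 1 → 0, which is not. -/
theorem zero_theta133 (h : RedCocycle g) (x w1 w2 w3 z1 z2 z3 : Letter) (hx : x.2 = false)
    (h1 : w1.2 = true) (h2 : w2.2 = true) (h3 : w3.2 = true) :
    val (Gra.circ g (mc K)) (theta133 x w1 w2 w3 z1 z2 z3) = 0 := by
  by_contra h0
  refine h.not_red _ (noUnivalent_theta133 x w1 w2 w3 z1 z2 z3) h0 ⟨0, ?_⟩
  refine .head (b := 2) ?_ (.head (b := 3) ?_ (.head (b := 1) ?_ (.single ?_))) <;>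
    simp [red_graph, arrows, theta133, hx, h1, h2, h3]

end RedCocycle

end BiGC

end

/-! ### Vanishing at figure eights and at thetas with arms 1, 1, 4 -/

noncomputable section

namespace BiGC

open MvPolynomial

variable {K : Type*} [Field K]

theorem Letter.sgn_ne_zero (l : Letter) : l.sgn K ≠ 0 := by
  rcases l with ⟨_ | _, _⟩ <;> simp [Letter.sgn]

theorem Letter.sgn_true (r : Bool) : Letter.sgn K (true, r) = 1 := rfl

theorem Letter.sgn_false (r : Bool) : Letter.sgn K (false, r) = -1 := rfl

namespace RedCocycle

variable {g : Gra K 4}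

/-- A red cycle would need the long arm to run entirely against `r`. The long arm is extended by a
letter of red direction `r`, so that every contraction keeping this letter has no red cycle, and
only its own contraction remains. -/
theorem theta114_same (h : RedCocycle g) (x y z1 z2 z3 z4 : Letter) (hxy : x.2 = y.2) :
    val g (theta114 x y z1 z2 z3 z4) = 0 := by
  obtain ⟨bx, r⟩ := x
  obtain ⟨y, _⟩ := y
  obtain rfl : r = _ := hxy
  obtain ⟨b1, r1⟩ := z1
  obtain ⟨b2, r2⟩ := z2
  obtain ⟨b3, r3⟩ := z3
  obtain ⟨b4, r4⟩ := z4
  have e := (theta115_circ h.alt h.loops (bx, r) (y, r) (b1, r1) (b2, r2) (b3, r3) (b4, r4)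
    (true, r)).symm.trans (h.zero_theta115 ..)
  cases r <;> cases r1 <;> cases r2 <;> cases r3 <;> cases r4 <;>
  first
  | exact h.red114 _ _ _ _ _ _ rfl
  | simpa [h.red114, cyclicArms, Letter.sgn_true] using e

/-- The short loop is no red cycle, so the long one must be constant. The extra letter has the
opposite red direction and breaks every term that keeps it. -/
theorem eight24_mixed (h : RedCocycle g) (w1 w2 z1 z2 z3 z4 : Letter) (hw : w1.2 ≠ w2.2) :
    val g (eight24 w1 w2 z1 z2 z3 z4) = 0 := by
  obtain ⟨bx, r⟩ := w1
  obtain ⟨y, r'⟩ := w2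
  obtain ⟨b1, r1⟩ := z1
  obtain ⟨b2, r2⟩ := z2
  obtain ⟨b3, r3⟩ := z3
  obtain ⟨b4, r4⟩ := z4
  have e := (eight25_circ h.alt h.loops (bx, r) (y, r') (b1, r1) (b2, r2) (b3, r3) (b4, r4)
    (true, !r4)).symm.trans (h.zero_eight25 ..)
  cases r <;> cases r' <;> cases r1 <;> cases r2 <;> cases r3 <;> cases r4 <;>
  first
  | exact absurd rfl hw
  | exact h.red24 _ _ _ _ _ _ rfl
  | simpa [h.red24, cyclicLoops, Letter.sgn_true] using e

/-- The vertex is blown up to an edge `x` that is red-forward like `w1` and `w2`. In the other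
contractions an arm from `z` still contains a forward letter, so no arm runs backward; the figure
eight is the only term left. -/
theorem eight24_aux (h : RedCocycle g) (w1 w2 z1 z2 z3 z4 : Letter) (hw1 : w1.2 = true)
    (hw2 : w2.2 = true)
    (hz : 2 ≤ ([z1.2, z2.2, z3.2, z4.2].count true)) :
    val g (eight24 w1 w2 z1 z2 z3 z4) = 0 := by
  obtain ⟨bx, r⟩ := w1
  obtain ⟨y, r'⟩ := w2
  obtain ⟨b1, r1⟩ := z1
  obtain ⟨b2, r2⟩ := z2
  obtain ⟨b3, r3⟩ := z3
  obtain ⟨b4, r4⟩ := z4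
  have e := (theta124_circ h.alt (true, true) (bx, r) (y, r') (b1, r1) (b2, r2) (b3, r3)
    (b4, r4)).symm.trans (h.zero_theta124 ..)
  obtain rfl : r = true := hw1
  obtain rfl : r' = true := hw2
  cases r1 <;> cases r2 <;> cases r3 <;> cases r4 <;>
  first
  | simpa [h.red114, h.red123, cyclicArms, Letter.sgn_true] using e
  | simp at hz

theorem eight24 (h : RedCocycle g) (w1 w2 z1 z2 z3 z4 : Letter) :
    val g (eight24 w1 w2 z1 z2 z3 z4) = 0 := by
  have key : ∀ w1 w2 z1 z2 z3 z4 : Letter, w1.2 = true → w2.2 = true →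
      val g (BiGC.eight24 w1 w2 z1 z2 z3 z4) = 0 := by
    intro w1 w2 z1 z2 z3 z4 h1 h2
    by_cases hz : 2 ≤ ([z1.2, z2.2, z3.2, z4.2].count true)
    · exact h.eight24_aux _ _ _ _ _ _ h1 h2 hz
    -- With fewer than two forward letters among four, the reversed loop has at least three.
    · rw [← neg_eq_zero, ← val_eight24_rev' h.alt]
      refine h.eight24_aux _ _ _ _ _ _ h1 h2 ?_
      obtain ⟨b1, r1⟩ := z1
      obtain ⟨b2, r2⟩ := z2
      obtain ⟨b3, r3⟩ := z3
      obtain ⟨b4, r4⟩ := z4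
      revert hz
      simp only [Letter.rev]
      revert r1 r2 r3 r4
      decide
  by_cases hw : w1.2 = w2.2
  · by_cases h1 : w1.2 = true
    · exact key _ _ _ _ _ _ h1 (hw ▸ h1)
    · rw [← val_eight24_rev]
      exact key _ _ _ _ _ _ (by simp [Letter.rev, ← hw, h1]) (by simp [Letter.rev, h1])
  · exact h.eight24_mixed _ _ _ _ _ _ hw

/-- The edge `y` is prolonged by a backward letter. The figure eight and the theta with two backward
short arms are already known to vanish. In the (1,2,3) terms the arm of length two is mixed and that
of length three keeps a backward letter, so no forward arm is left to close a cycle with `x`. -/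
theorem theta114_opposite (h : RedCocycle g) (x y z1 z2 z3 z4 : Letter) (hx : x.2 = false)
    (hy : y.2 = true) (hz : 2 ≤ ([z1.2, z2.2, z3.2, z4.2].count false)) :
    val g (theta114 x y z1 z2 z3 z4) = 0 := by
  obtain ⟨bx, r⟩ := x
  obtain ⟨y, r'⟩ := y
  obtain ⟨b1, r1⟩ := z1
  obtain ⟨b2, r2⟩ := z2
  obtain ⟨b3, r3⟩ := z3
  obtain ⟨b4, r4⟩ := z4
  obtain rfl : r = false := hx
  obtain rfl : r' = true := hy
  have e := (theta124_circ h.alt (bx, false) (y, true) (true, false) (b1, r1) (b2, r2) (b3, r3)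
    (b4, r4)).symm.trans (h.zero_theta124 ..)
  rw [h.eight24, h.theta114_same (bx, false) (true, false) _ _ _ _ rfl] at e
  cases r1 <;> cases r2 <;> cases r3 <;> cases r4 <;>
  first
  | simpa [h.red123, cyclicArms, Letter.sgn_true] using e
  | simp at hz

theorem theta114 (h : RedCocycle g) (x y z1 z2 z3 z4 : Letter) :
    val g (theta114 x y z1 z2 z3 z4) = 0 := by
  have key : ∀ x y z1 z2 z3 z4 : Letter, x.2 = false → y.2 = true →
      val g (BiGC.theta114 x y z1 z2 z3 z4) = 0 := by
    intro x y z1 z2 z3 z4 h1 h2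
    by_cases hz : 2 ≤ ([z1.2, z2.2, z3.2, z4.2].count false)
    · exact h.theta114_opposite _ _ _ _ _ _ h1 h2 hz
    · rw [← val_theta114_rev h.alt, val_theta114_swap]
      refine h.theta114_opposite _ _ _ _ _ _ (by simp [Letter.rev, h2])
        (by simp [Letter.rev, h1]) ?_
      obtain ⟨b1, r1⟩ := z1
      obtain ⟨b2, r2⟩ := z2
      obtain ⟨b3, r3⟩ := z3
      obtain ⟨b4, r4⟩ := z4
      revert hz
      simp only [Letter.rev]
      revert r1 r2 r3 r4
      decide
  by_cases hxy : x.2 = y.2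
  · exact h.theta114_same _ _ _ _ _ _ hxy
  · by_cases hx : x.2 = false
    · exact key _ _ _ _ _ _ hx (by rw [hx] at hxy; simpa using Ne.symm hxy)
    · rw [val_theta114_swap]
      have hx' : x.2 = true := by simpa using hx
      exact key _ _ _ _ _ _ (by rw [hx'] at hxy; simpa using Ne.symm hxy) hx'

/-- As for `eight24_mixed`: the loop `z` would have to be constant, and the extra letter opposes it.
The terms of type (2,4) vanish already. -/
theorem eight33_mixed (h : RedCocycle g) (w1 w2 w3 z1 z2 z3 : Letter)
    (hw : w1.2 ≠ w2.2 ∨ w2.2 ≠ w3.2) : val g (eight33 w1 w2 w3 z1 z2 z3) = 0 := by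
  obtain ⟨bx, r⟩ := w1
  obtain ⟨y, r'⟩ := w2
  obtain ⟨y', r''⟩ := w3
  obtain ⟨b1, r1⟩ := z1
  obtain ⟨b2, r2⟩ := z2
  obtain ⟨b3, r3⟩ := z3
  have e := (eight34_circ h.alt (bx, r) (y, r') (y', r'') (b1, r1) (b2, r2) (b3, r3)
    (true, !r3)).symm.trans (h.zero_eight34 ..)
  simp only [h.eight24] at e
  cases r <;> cases r' <;> cases r'' <;> cases r1 <;> cases r2 <;> cases r3 <;>
  first
  | exact h.red33 _ _ _ _ _ _ rfl
  | simpa [h.red33, cyclicLoops, Letter.sgn_true] using e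
  | simp at hw

theorem eight33 (h : RedCocycle g) (w1 w2 w3 z1 z2 z3 : Letter) :
    val g (eight33 w1 w2 w3 z1 z2 z3) = 0 := by
  by_cases hw : w1.2 ≠ w2.2 ∨ w2.2 ≠ w3.2
  · exact h.eight33_mixed _ _ _ _ _ _ hw
  by_cases hz : z1.2 ≠ z2.2 ∨ z2.2 ≠ z3.2
  · rw [← val_eight33_swap h.alt]
    exact h.eight33_mixed _ _ _ _ _ _ hz
  have e := (eight34_circ h.alt w1 w2 w3 z1 z2 z3 (true, !z3.2)).symm.trans (h.zero_eight34 ..)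
  simp only [h.eight24] at e
  -- In the terms that keep the opposing fourth letter the second loop is mixed; swapping the loops
  -- reduces them to `eight33_mixed`.
  rw [← val_eight33_swap h.alt _ _ _ z1 z2, ← val_eight33_swap h.alt _ _ _ z1 z3,
    ← val_eight33_swap h.alt _ _ _ z2 z3, h.eight33_mixed z1 z2 (true, !z3.2),
    h.eight33_mixed z1 z3 (true, !z3.2), h.eight33_mixed z2 z3 (true, !z3.2)] at e
  · simpa [Letter.sgn_true] using e
  all_goals
    have hz' : z1.2 = z2.2 ∧ z2.2 = z3.2 := by simpa using hz
    simp [hz'.1, hz'.2]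

end RedCocycle

end BiGC

end

/-! ### Reduction of the remaining coefficients to one scalar -/

noncomputable section

namespace BiGC

open MvPolynomial

variable {K : Type*} [Field K]

namespace RedCocycle

variable {g : Gra K 4}

/-- A red cycle requires the arm `z` to be all forward. Extending it by a backward letter kills
every term except the one in which this letter is contracted. -/
theorem theta123_eq_zero_of_mixed (h : RedCocycle g) (x w1 w2 z1 z2 z3 : Letter)
    (hx : x.2 = false) (hw : w1.2 = false ∨ w2.2 = false) :
    val g (theta123 x w1 w2 z1 z2 z3) = 0 := by
  obtain ⟨x, _⟩ := x
  obtain ⟨y, r⟩ := w1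
  obtain ⟨y', r'⟩ := w2
  obtain ⟨b1, r1⟩ := z1
  obtain ⟨b2, r2⟩ := z2
  obtain ⟨b3, r3⟩ := z3
  obtain rfl : _ = false := hx
  have e := (theta124_circ h.alt (x, false) (y, r) (y', r') (b1, r1) (b2, r2) (b3, r3)
    (true, false)).symm.trans (h.zero_theta124 ..)
  simp only [h.eight24, h.theta114] at e
  cases r <;> cases r' <;> cases r1 <;> cases r2 <;> cases r3 <;>
  first
  | exact h.red123 _ _ _ _ _ _ rfl
  | simpa [h.red123, cyclicArms, Letter.sgn_true] using e
  | simp at hw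

/-- The arm `x` is extended by a forward letter and becomes mixed. Deleting one letter of `z` leaves
a forward one, so in all other contractions no arm is entirely backward. -/
theorem theta123_eq_zero_of_two (h : RedCocycle g) (x w1 w2 z1 z2 z3 : Letter)
    (hx : x.2 = false) (hw1 : w1.2 = true) (hw2 : w2.2 = true)
    (hz : 2 ≤ [z1.2, z2.2, z3.2].count true) :
    val g (theta123 x w1 w2 z1 z2 z3) = 0 := by
  obtain ⟨x, _⟩ := x
  obtain ⟨y, r⟩ := w1
  obtain ⟨y', r'⟩ := w2
  obtain ⟨b1, r1⟩ := z1
  obtain ⟨b2, r2⟩ := z2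
  obtain ⟨b3, r3⟩ := z3
  obtain rfl : _ = false := hx
  obtain rfl : r = true := hw1
  obtain rfl : r' = true := hw2
  have e := (theta223_circ h.alt (x, false) (true, true) (y, true) (y', true) (b1, r1) (b2, r2)
    (b3, r3)).symm.trans (h.zero_theta223 ..)
  cases r1 <;> cases r2 <;> cases r3 <;>
  first
  | simpa [h.red123, h.red222, cyclicArms, Letter.sgn_true] using e
  | simp at hz

/-- The equation at a graph of shape C with a red cycle. The figure eight and the contractions in
`z` vanish, the latter because the arm of length three is then `w`, which is all forward; what
remains is the deletion of a letter of `w`. -/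
theorem theta123_closed (h : RedCocycle g) (x w1 w2 w3 z1 z2 z3 : Letter)
    (hx : x.2 = false) (hw1 : w1.2 = true) (hw2 : w2.2 = true) (hw3 : w3.2 = true) :
    w1.sgn K * val g (theta123 x w2 w3 z1 z2 z3) - w2.sgn K * val g (theta123 x w1 w3 z1 z2 z3)
      + w3.sgn K * val g (theta123 x w1 w2 z1 z2 z3) = 0 := by
  have e := (theta133_circ h.alt x w1 w2 w3 z1 z2 z3).symm.trans
    (h.zero_theta133 x w1 w2 w3 z1 z2 z3 hx hw1 hw2 hw3)
  have key : ∀ y y', val g (theta123 x y y' w1 w2 w3) = 0 := by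
    intro y y'
    by_cases hy : y.2 = false ∨ y'.2 = false
    · exact h.theta123_eq_zero_of_mixed _ _ _ _ _ _ hx hy
    · simp only [not_or, Bool.not_eq_false] at hy
      exact h.theta123_eq_zero_of_two _ _ _ _ _ _ hx hy.1 hy.2 (by simp [hw1, hw2, hw3])
  rw [key, key, key, h.eight33] at e
  linear_combination -e

/-- On the two forward letters a = pp, c = mp, closedness at aaa, ccc and aca gives f(aa) = 0, f(cc)
= 0 and f(ca) = -f(ac). So f(ac) determines f, as in the word β of the construction. -/
theorem theta123_two_eq_zero [CharZero K] (h : RedCocycle g) (x w1 w2 z1 z2 z3 : Letter)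
    (hx : x.2 = false) (hw1 : w1.2 = true) (hw2 : w2.2 = true)
    (h0 : val g (theta123 x (true, true) (false, true) z1 z2 z3) = 0) :
    val g (theta123 x w1 w2 z1 z2 z3) = 0 := by
  obtain ⟨y, _⟩ := w1
  obtain ⟨y', _⟩ := w2
  obtain rfl : _ = true := hw1
  obtain rfl : _ = true := hw2
  have e1 := h.theta123_closed x (true, true) (true, true) (true, true) z1 z2 z3 hx rfl rfl rfl
  have e2 := h.theta123_closed x (false, true) (false, true) (false, true) z1 z2 z3 hx rfl rfl rfl
  have e3 := h.theta123_closed x (true, true) (false, true) (true, true) z1 z2 z3 hx rfl rfl rfl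
  simp only [Letter.sgn_true, Letter.sgn_false] at e1 e2 e3
  cases y <;> cases y'
  · linear_combination -e2
  · linear_combination e3 - e1 - h0
  · exact h0
  · linear_combination e1

/-- The bridge between shapes A and B. The first term does not involve `p` and the second does not
involve `q`, so `p` and `q` may be changed at will in vanishing statements. -/
theorem theta123_theta222 (h : RedCocycle g) (x p w1 w2 z1 q z3 : Letter)
    (hx : x.2 = false) (hp : p.2 = true) (hw1 : w1.2 = true) (hw2 : w2.2 = true)
    (hz1 : z1.2 = false) (hq : q.2 = true) (hz3 : z3.2 = false) :
    p.sgn K * val g (theta123 x w1 w2 z1 q z3) +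
      q.sgn K * val g (theta222 x p w1 w2 z1 z3) = 0 := by
  have e := (theta223_circ h.alt x p w1 w2 z1 q z3).symm.trans (h.zero_theta223 ..)
  simpa [h.red123, h.red222, cyclicArms, hx, hp, hw1, hw2, hz1, hq, hz3] using e

theorem theta222_eq_zero_of_theta123 (h : RedCocycle g) (x p w1 w2 z1 q z3 : Letter)
    (hx : x.2 = false) (hp : p.2 = true) (hw1 : w1.2 = true) (hw2 : w2.2 = true)
    (hz1 : z1.2 = false) (hq : q.2 = true) (hz3 : z3.2 = false)
    (h0 : val g (theta123 x w1 w2 z1 q z3) = 0) : val g (theta222 x p w1 w2 z1 z3) = 0 := by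
  have e := h.theta123_theta222 x p w1 w2 z1 q z3 hx hp hw1 hw2 hz1 hq hz3
  rw [h0, mul_zero, zero_add] at e
  exact (mul_eq_zero.1 e).resolve_left (Letter.sgn_ne_zero _)

theorem theta123_eq_zero_of_theta222 (h : RedCocycle g) (x p w1 w2 z1 q z3 : Letter)
    (hx : x.2 = false) (hp : p.2 = true) (hw1 : w1.2 = true) (hw2 : w2.2 = true)
    (hz1 : z1.2 = false) (hq : q.2 = true) (hz3 : z3.2 = false)
    (h0 : val g (theta222 x p w1 w2 z1 z3) = 0) : val g (theta123 x w1 w2 z1 q z3) = 0 := by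
  have e := h.theta123_theta222 x p w1 w2 z1 q z3 hx hp hw1 hw2 hz1 hq hz3
  rw [h0, mul_zero, add_zero] at e
  exact (mul_eq_zero.1 e).resolve_left (Letter.sgn_ne_zero _)

/-- The coefficient that determines a cocycle of graphs with red cycles. -/
def scalar (g : Gra K 4) : K :=
  val g (BiGC.theta123 (true, false) (true, true) (false, true) (true, false) (false, true)
    (false, false))

/-- The vanishing spreads from one graph by three moves: the bridge to shape A frees the letter `p`,
closedness frees the forward word, and turning the graph around exchanges the roles of the forward
and the backward word and of the two letters of the first arm. -/
theorem theta222_special [CharZero K] (h : RedCocycle g) (h0 : scalar g = 0)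
    (x p w1 w2 z1 z3 : Letter) (hx : x.2 = false) (hp : p.2 = true) (hw1 : w1.2 = true)
    (hw2 : w2.2 = true) (hz1 : z1.2 = false) (hz3 : z3.2 = false) :
    val g (theta222 x p w1 w2 z1 z3) = 0 := by
  have h1 : ∀ p : Letter, p.2 = true → val g (BiGC.theta222 (true, false) p (true, true)
      (false, true) (true, false) (false, false)) = 0 := fun p hp =>
    h.theta222_eq_zero_of_theta123 _ _ _ _ _ (false, true) _ rfl hp rfl rfl rfl rfl rfl h0
  have h2 : ∀ m : Letter, m.2 = false → val g (BiGC.theta222 m (false, true) (true, true)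
      (false, true) (true, false) (false, false)) = 0 := by
    intro m hm
    rw [← val_theta222_rev h.alt]
    exact h1 m.rev (by simp [Letter.rev, hm])
  have h3 : ∀ m p : Letter, m.2 = false → p.2 = true → ∀ w1 w2 : Letter, w1.2 = true →
      w2.2 = true → val g (BiGC.theta222 m p w1 w2 (true, false) (false, false)) = 0 := by
    intro m p hm hp w1 w2 hw1 hw2
    refine h.theta222_eq_zero_of_theta123 _ _ _ _ _ (true, true) _ hm hp hw1 hw2 rfl rfl rfl ?_
    refine h.theta123_two_eq_zero _ _ _ _ _ _ hm hw1 hw2 ?_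
    exact h.theta123_eq_zero_of_theta222 _ _ _ _ _ _ _ hm rfl rfl rfl rfl rfl rfl (h2 m hm)
  have h4 : ∀ m p : Letter, m.2 = false → p.2 = true → ∀ z1 z3 : Letter, z1.2 = false →
      z3.2 = false → val g (BiGC.theta222 m p (true, true) (false, true) z1 z3) = 0 := by
    intro m p hm hp z1 z3 hz1 hz3
    rw [← val_theta222_rev h.alt]
    exact h3 _ _ (by simp [Letter.rev, hp]) (by simp [Letter.rev, hm]) _ _
      (by simp [Letter.rev, hz3]) (by simp [Letter.rev, hz1])
  refine h.theta222_eq_zero_of_theta123 _ _ _ _ _ (true, true) _ hx hp hw1 hw2 hz1 rfl hz3 ?_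
  refine h.theta123_two_eq_zero _ _ _ _ _ _ hx hw1 hw2 ?_
  exact h.theta123_eq_zero_of_theta222 _ p _ _ _ _ _ hx hp rfl rfl hz1 rfl hz3
    (h4 _ _ hx hp _ _ hz1 hz3)

/-- The only case left has `w` forward and at most one forward letter in `z`. Prolonging `x` by a
forward letter expresses it through shape B, where `theta222_special` applies. -/
theorem theta123 [CharZero K] (h : RedCocycle g) (h0 : scalar g = 0)
    (x w1 w2 z1 z2 z3 : Letter) : val g (theta123 x w1 w2 z1 z2 z3) = 0 := by
  have key : ∀ x w1 w2 z1 z2 z3 : Letter, x.2 = false →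
      val g (BiGC.theta123 x w1 w2 z1 z2 z3) = 0 := by
    intro x w1 w2 z1 z2 z3 hx
    by_cases hw : w1.2 = false ∨ w2.2 = false
    · exact h.theta123_eq_zero_of_mixed _ _ _ _ _ _ hx hw
    simp only [not_or, Bool.not_eq_false] at hw
    by_cases hz : 2 ≤ [z1.2, z2.2, z3.2].count true
    · exact h.theta123_eq_zero_of_two _ _ _ _ _ _ hx hw.1 hw.2 hz
    have e := (theta223_circ h.alt x (true, true) w1 w2 z1 z2 z3).symm.trans
      (h.zero_theta223 ..)
    have r1 : val g (BiGC.theta123 (true, true) w1 w2 z1 z2 z3) = 0 := by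
      rw [← val_theta123_rev h.alt]
      exact h.theta123_eq_zero_of_mixed _ _ _ _ _ _ rfl (by simp [Letter.rev, hw])
    have r2 : ∀ w : Letter, w.2 = true →
        val g (BiGC.theta123 w x (true, true) z1 z2 z3) = 0 := by
      intro w hw
      rw [← val_theta123_rev h.alt]
      exact h.theta123_eq_zero_of_mixed _ _ _ _ _ _ (by simp [Letter.rev, hw])
        (by simp [Letter.rev])
    have r3 : ∀ y y' : Letter, val g (theta222 x (true, true) w1 w2 y y') = 0 := by
      intro y y'
      by_cases hy : y.2 = false ∧ y'.2 = false
      · exact h.theta222_special h0 _ _ _ _ _ _ hx rfl hw.1 hw.2 hy.1 hy.2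
      · refine h.red222 _ _ _ _ _ _ ?_
        simpa [cyclicArms, hx, hw] using hy
    rw [r1, r2 _ hw.1, r2 _ hw.2, r3, r3, r3, Letter.sgn_true] at e
    linear_combination e
  by_cases hx : x.2 = false
  · exact key _ _ _ _ _ _ hx
  · rw [← val_theta123_rev h.alt]
    exact key _ _ _ _ _ _ (by simpa [Letter.rev] using hx)

/-- Unless the first two arms already form a red cycle, the third arm must be constant. A letter
opposing it is appended; shape A vanishes and the terms that keep this letter have no red cycle. -/
theorem theta222_aux [CharZero K] (h : RedCocycle g) (h0 : scalar g = 0)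
    (v1 v2 w1 w2 z1 z2 : Letter) (hc : ¬ (v1.2 = v2.2 ∧ w1.2 = w2.2 ∧ v1.2 ≠ w1.2)) :
    val g (theta222 v1 v2 w1 w2 z1 z2) = 0 := by
  obtain ⟨x, r⟩ := v1
  obtain ⟨x', r'⟩ := v2
  obtain ⟨y, s⟩ := w1
  obtain ⟨y', s'⟩ := w2
  obtain ⟨b1, r1⟩ := z1
  obtain ⟨b2, r2⟩ := z2
  have e := (theta223_circ h.alt (x, r) (x', r') (y, s) (y', s') (b1, r1) (b2, r2)
    (true, !r2)).symm.trans (h.zero_theta223 ..)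
  simp only [h.theta123 h0] at e
  cases r <;> cases r' <;> cases s <;> cases s' <;> cases r1 <;> cases r2 <;>
  first
  | exact h.red222 _ _ _ _ _ _ rfl
  | simpa [h.red222, cyclicArms, Letter.sgn_true] using e
  | simp at hc

theorem theta222 [CharZero K] (h : RedCocycle g) (h0 : scalar g = 0)
    (v1 v2 w1 w2 z1 z2 : Letter) : val g (theta222 v1 v2 w1 w2 z1 z2) = 0 := by
  by_cases h1 : v1.2 = v2.2 ∧ w1.2 = w2.2 ∧ v1.2 ≠ w1.2
  · by_cases h2 : v1.2 = v2.2 ∧ z1.2 = z2.2 ∧ v1.2 ≠ z1.2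
    -- Both `w` and `z` oppose `v`, so they run in the same direction; the arms are permuted to put
    -- such a pair first.
    · rw [← neg_eq_zero, ← val_theta222_swap' h.alt, ← neg_eq_zero, ← val_theta222_swap h.alt]
      refine h.theta222_aux h0 _ _ _ _ _ _ ?_
      rintro ⟨-, -, h3⟩
      revert h1 h2 h3
      generalize w1.2 = a, z1.2 = b, v1.2 = c
      rintro ⟨-, -, h1⟩ ⟨-, -, h2⟩ h3
      revert h1 h2 h3 a b c
      decide
    · rw [← neg_eq_zero, ← val_theta222_swap h.alt]
      exact h.theta222_aux h0 _ _ _ _ _ _ h2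
  · exact h.theta222_aux h0 _ _ _ _ _ _ h1

theorem theta133 [CharZero K] (h : RedCocycle g) (h0 : scalar g = 0)
    (x w1 w2 w3 z1 z2 z3 : Letter) :
    val (Gra.circ g (mc K)) (theta133 x w1 w2 w3 z1 z2 z3) = 0 := by
  rw [theta133_circ h.alt]
  simp [h.theta123 h0, h.eight33]

end RedCocycle

end BiGC

end

/-! ### Recovering cochains from coefficients, and uniqueness -/

noncomputable section

namespace BiGC

open MvPolynomial

variable {K : Type*} [Field K]

/-! ### Combinations of graphs of a given shape -/

/-- Alternation makes coefficients invariant up to sign under renumbering, so a graph of shape `S`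
can be moved to the standard numbering `S₀`. Characteristic zero keeps the factorials of the pairing
invertible. -/
theorem exists_val_ne_zero [CharZero K] {p : ℕ} {g : Gra K p} (hg : Alternating g)
    {S : Multiset (Sym2 (Fin (p + 1)))} (S₀ : List (Fin (p + 1) × Fin (p + 1)))
    (ρ : Equiv.Perm (Fin (p + 1))) (hS : S = ↑(S₀.map fun e => s(ρ e.1, ρ e.2)))
    {G : BiGraph (Fin (p + 1))} (hG : G ∈ g.support) (h : G.HasShape S) :
    ∃ l : List (Fin (p + 1) × Fin (p + 1) × Letter),
      l.map (fun e => (e.1, e.2.1)) = S₀ ∧ val g l ≠ 0 := by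
  obtain ⟨φ, hφ⟩ := h
  have h1 : G.shape = ↑((S₀.map fun e => ((ρ.trans φ) e.1, (ρ.trans φ) e.2)).map
      fun e => s(e.1, e.2)) := by
    rw [← hφ, hS, Multiset.map_coe, List.map_map, List.map_map]
    rfl
  obtain ⟨l, hl, rfl⟩ := exists_graph_of_shape _ _ h1
  have h2 : mapV (ρ.trans φ) (mapV (ρ.trans φ).symm l) = l := by
    rw [mapV, mapV, List.map_map]
    refine List.map_id'' (fun e => ?_) l
    simp
  refine ⟨mapV (ρ.trans φ).symm l, ?_, ?_⟩
  · have h3 := congrArg (List.map fun e => ((ρ.trans φ).symm e.1, (ρ.trans φ).symm e.2)) hl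
    rw [List.map_map, List.map_map] at h3
    rw [mapV, List.map_map]
    refine h3.trans (List.map_id'' (fun e => ?_) S₀)
    simp
  · intro h4
    have h5 := pair_monomial_ne_zero hG
    rw [← prodE_eq_monomial, ← h2, ← rename_prodE] at h5
    have h6 := hg.pair_perm (ρ.trans φ) (prodE K (mapV (ρ.trans φ).symm l))
    rw [Gra.perm] at h6
    rw [h6] at h5
    refine h5 ?_
    rw [val] at h4
    rw [h4, mul_zero]

theorem shapeA_eq : shapeA = ↑(([(0, 1), (0, 2), (2, 1), (0, 3), (3, 4), (4, 1)] :
    List (Fin 5 × Fin 5)).map fun e => s(permOf ![3, 1, 0, 4, 2] ![2, 1, 4, 0, 3] (by decide) e.1,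
      permOf ![3, 1, 0, 4, 2] ![2, 1, 4, 0, 3] (by decide) e.2)) := by
  decide +kernel

theorem shapeB_eq : shapeB = ↑(([(0, 2), (2, 1), (0, 3), (3, 1), (0, 4), (4, 1)] :
    List (Fin 5 × Fin 5)).map fun e => s(permOf ![3, 2, 4, 1, 0] ![4, 3, 1, 0, 2] (by decide) e.1,
      permOf ![3, 2, 4, 1, 0] ![4, 3, 1, 0, 2] (by decide) e.2)) := by
  decide +kernel

theorem shapeC_eq : ∃ ρ : Equiv.Perm (Fin 6), shapeC =
    ↑(([(0, 1), (0, 2), (2, 3), (3, 1), (0, 4), (4, 5), (5, 1)] :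
      List (Fin 6 × Fin 6)).map fun e => s(ρ e.1, ρ e.2)) :=
  ⟨⟨![3, 2, 0, 5, 1, 4], ![2, 4, 1, 0, 5, 3], by decide, by decide⟩, by decide +kernel⟩

theorem eq_zero_of_shape_C [CharZero K] {g : Gra K 5} (hg : Alternating g)
    (hC : ∀ G ∈ g.support, BiGraph.HasShape G shapeC)
    (h : ∀ x w1 w2 w3 z1 z2 z3, val g (theta133 x w1 w2 w3 z1 z2 z3) = 0) : g = 0 := by
  by_contra h0
  obtain ⟨G, hG⟩ := support_nonempty.2 h0
  obtain ⟨ρ, hρ⟩ := shapeC_eq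
  obtain ⟨l, hl, hv⟩ := exists_val_ne_zero hg _ ρ hρ hG (hC G hG)
  match l, hl with
  | [(_, _, x), (_, _, w1), (_, _, w2), (_, _, w3), (_, _, z1), (_, _, z2), (_, _, z3)], hl =>
    simp only [List.map_cons, List.map_nil, List.cons.injEq, Prod.mk.injEq, and_true] at hl
    obtain ⟨⟨rfl, rfl⟩, ⟨rfl, rfl⟩, ⟨rfl, rfl⟩, ⟨rfl, rfl⟩, ⟨rfl, rfl⟩, ⟨rfl, rfl⟩, rfl, rfl⟩ := hl
    exact hv (h x w1 w2 w3 z1 z2 z3)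

theorem eq_zero_of_shape_AB [CharZero K] {g : Gra K 4} (hg : Alternating g)
    (hAB : ∀ G ∈ g.support, BiGraph.HasShape G shapeA ∨ BiGraph.HasShape G shapeB)
    (hA : ∀ x w1 w2 z1 z2 z3, val g (theta123 x w1 w2 z1 z2 z3) = 0)
    (hB : ∀ v1 v2 w1 w2 z1 z2, val g (theta222 v1 v2 w1 w2 z1 z2) = 0) : g = 0 := by
  by_contra h0
  obtain ⟨G, hG⟩ := support_nonempty.2 h0
  rcases hAB G hG with h | h
  · obtain ⟨l, hl, hv⟩ := exists_val_ne_zero hg _ _ shapeA_eq hG h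
    match l, hl with
    | [(_, _, x), (_, _, w1), (_, _, w2), (_, _, z1), (_, _, z2), (_, _, z3)], hl =>
      simp only [List.map_cons, List.map_nil, List.cons.injEq, Prod.mk.injEq, and_true] at hl
      obtain ⟨⟨rfl, rfl⟩, ⟨rfl, rfl⟩, ⟨rfl, rfl⟩, ⟨rfl, rfl⟩, ⟨rfl, rfl⟩, rfl, rfl⟩ := hl
      exact hv (hA x w1 w2 z1 z2 z3)
  · obtain ⟨l, hl, hv⟩ := exists_val_ne_zero hg _ _ shapeB_eq hG h
    match l, hl with
    | [(_, _, x), (_, _, w1), (_, _, w2), (_, _, z1), (_, _, z2), (_, _, z3)], hl =>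
      simp only [List.map_cons, List.map_nil, List.cons.injEq, Prod.mk.injEq, and_true] at hl
      obtain ⟨⟨rfl, rfl⟩, ⟨rfl, rfl⟩, ⟨rfl, rfl⟩, ⟨rfl, rfl⟩, ⟨rfl, rfl⟩, rfl, rfl⟩ := hl
      exact hv (hB x w1 w2 z1 z2 z3)

theorem eq_of_hasShape {n p : ℕ} {G : BiGraph (Fin (p + 1))} {S : Multiset (Sym2 (Fin n))}
    (h : G.HasShape S) : n = p + 1 := by
  obtain ⟨φ, -⟩ := h
  simpa using Fintype.card_congr φ

theorem apply_eq_zero_of_shape_C {Θ : Cochain K} (h : EachGraph (fun _ G => G.HasShape shapeC) Θ)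
    {p : ℕ} (hp : p ≠ 5) : Θ p = 0 := by
  by_contra h0
  obtain ⟨G, hG⟩ := support_nonempty.2 h0
  have := eq_of_hasShape (h p G hG)
  omega

theorem apply_eq_zero_of_shape_AB {ϑ : Cochain K} (h : OfShapeAB ϑ) {p : ℕ} (hp : p ≠ 4) :
    ϑ p = 0 := by
  by_contra h0
  obtain ⟨G, hG⟩ := support_nonempty.2 h0
  rcases h p G hG with h1 | h1
  all_goals
    have := eq_of_hasShape h1
    omega

/-! ### The pairs of cochains -/

theorem val_delta (γ : Cochain K) {L : List (Fin 6 × Fin 6 × Letter)}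
    (hL : NoUnivalent (prodE K L : Gra K 5)) :
    val (-delta γ 5) L = val (Gra.circ (γ 4) (mc K)) L := by
  have h1 := pair_mc_circ _ hL (γ 4)
  rw [val, delta_apply_five, neg_sub, map_sub, h1, sub_zero]
  rfl

theorem noLoops_of_black {g : Gra K 4} (h : ∀ G ∈ g.support, ¬ BiGraph.HasBlackCycle G) :
    NoLoops g := by
  rintro L ⟨v, l, hl⟩
  by_contra h0
  refine h _ (val_ne_zero h0) ⟨v, .single ?_⟩
  rw [black_graph, arrows, List.mem_map]
  exact ⟨_, hl, ite_self _⟩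

theorem alternating_of_mem {γ : Cochain K} (h : γ ∈ fcGCBlack K) (p : ℕ) : Alternating (γ p) :=
  h.1.1 p

theorem IsPair.redCocycle {Θ ϑ : Cochain K} (h : IsPair Θ ϑ) (hΘ : Θ ∈ fcGCBi K)
    (hϑ : ϑ ∈ fcGCBlack K) : RedCocycle (ϑ 4) where
  alt := alternating_of_mem hϑ 4
  loops := noLoops_of_black fun G hG => hϑ.2 4 G hG
  red L hL := h.red_cycle 4 _ (val_ne_zero hL)
  shape_C L hn hL := by
    rw [← val_delta ϑ hn] at hL
    refine h.shape_C 5 _ (val_ne_zero ?_)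
    rwa [h.eq_neg_delta]
  not_red L hn hL := by
    rw [← val_delta ϑ hn] at hL
    refine hΘ.2 5 _ (val_ne_zero ?_)
    rwa [h.eq_neg_delta]

theorem circ_sub_smul {p q : ℕ} (c : K) (a a' : Gra K p) (b : Gra K q) :
    Gra.circ (a - c • a') b = Gra.circ a b - c • Gra.circ a' b := by
  simp only [Gra.circ, Gra.comp, Gra.perm, map_sub, map_smul, sub_mul, smul_mul_assoc, smul_sub,
    Finset.sum_sub_distrib, Finset.smul_sum]
  congr 1
  exact Finset.sum_congr rfl fun σ _ => smul_comm _ _ _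

theorem val_sub_smul {p : ℕ} (c : K) (a a' : Gra K p) (L) :
    val (a - c • a') L = val a L - c * val a' L := by
  simp [val]

theorem Alternating.sub_smul {p : ℕ} {a a' : Gra K p} (h : Alternating a) (h' : Alternating a')
    (c : K) : Alternating (a - c • a') := by
  intro σ
  have h1 := h σ
  have h2 := h' σ
  rw [Gra.perm] at h1 h2 ⊢
  rw [map_sub, map_smul, h1, h2, smul_sub, smul_comm]

theorem val_ne_zero_of_sub {p : ℕ} {c : K} {a a' : Gra K p} {L}
    (h : val (a - c • a') L ≠ 0) : val a L ≠ 0 ∨ val a' L ≠ 0 := by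
  by_contra! h0
  rw [val_sub_smul, h0.1, h0.2] at h
  simp at h

theorem RedCocycle.sub_smul {a a' : Gra K 4} (h : RedCocycle a) (h' : RedCocycle a') (c : K) :
    RedCocycle (a - c • a') where
  alt := h.alt.sub_smul h'.alt c
  loops L hL := by rw [val_sub_smul, h.loops L hL, h'.loops L hL, mul_zero, sub_zero]
  red L hL := (val_ne_zero_of_sub hL).elim (h.red L) (h'.red L)
  shape_C L hn hL := by
    rw [circ_sub_smul] at hL
    exact (val_ne_zero_of_sub hL).elim (h.shape_C L hn) (h'.shape_C L hn)
  not_red L hn hL := by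
    rw [circ_sub_smul] at hL
    exact (val_ne_zero_of_sub hL).elim (h.not_red L hn) (h'.not_red L hn)

theorem mem_support_sub_smul {I : Type*} {c : K} {a a' : MvPolynomial I K} {m : I →₀ ℕ}
    (h : m ∈ (a - c • a').support) : m ∈ a.support ∨ m ∈ a'.support := by
  simp only [mem_support_iff, coeff_sub, coeff_smul] at h ⊢
  by_contra! h0
  rw [h0.1, h0.2] at h
  simp at h

/-- The pairs are determined up to a scalar, and graphs that are not of shape `A` or `B`. -/
theorem IsPair.unique [CharZero K] {Θ ϑ Θ' ϑ' : Cochain K} (h : IsPair Θ ϑ)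
    (hΘ : Θ ∈ fcGCBi K) (hϑ : ϑ ∈ fcGCBlack K) (hAB : OfShapeAB ϑ)
    (hs : RedCocycle.scalar (ϑ 4) ≠ 0) (h' : IsPair Θ' ϑ') (hΘ' : Θ' ∈ fcGCBi K)
    (hϑ' : ϑ' ∈ fcGCBlack K) :
    ∃ c : K, Θ' = c • Θ ∧ (OfShapeAB ϑ' → ϑ' = c • ϑ) := by
  -- The factor is the ratio of the scalars, so that the difference is again a `RedCocycle`, of
  -- scalar zero.
  obtain ⟨c, hc⟩ : ∃ c : K, c * RedCocycle.scalar (ϑ 4) = RedCocycle.scalar (ϑ' 4) :=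
    ⟨_, div_mul_cancel₀ _ hs⟩
  have hr := (h'.redCocycle hΘ' hϑ').sub_smul (h.redCocycle hΘ hϑ) c
  have h0 : RedCocycle.scalar (ϑ' 4 - c • ϑ 4) = 0 := by
    rw [RedCocycle.scalar, val_sub_smul]
    exact sub_eq_zero.2 hc.symm
  refine ⟨c, ?_, fun hAB' => ?_⟩
  · ext1 p
    rw [DFinsupp.smul_apply]
    by_cases hp : p = 5
    · subst hp
      rw [← sub_eq_zero]
      refine eq_zero_of_shape_C ((alternating_of_mem hΘ'.1 5).sub_smul
        (alternating_of_mem hΘ.1 5) c) (fun G hG => ?_) fun x w1 w2 w3 z1 z2 z3 => ?_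
      · exact (mem_support_sub_smul hG).elim (h'.shape_C 5 G) (h.shape_C 5 G)
      · have hn := noUnivalent_theta133 (K := K) x w1 w2 w3 z1 z2 z3
        have h1 := hr.theta133 h0 x w1 w2 w3 z1 z2 z3
        rw [circ_sub_smul, val_sub_smul, ← val_delta ϑ' hn, ← val_delta ϑ hn,
          ← val_sub_smul] at h1
        rw [h'.eq_neg_delta, h.eq_neg_delta]
        exact h1
    · rw [apply_eq_zero_of_shape_C h.shape_C hp, apply_eq_zero_of_shape_C h'.shape_C hp, smul_zero]
  · ext1 p
    rw [DFinsupp.smul_apply]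
    by_cases hp : p = 4
    · subst hp
      rw [← sub_eq_zero]
      refine eq_zero_of_shape_AB hr.alt (fun G hG => ?_) (hr.theta123 h0) (hr.theta222 h0)
      exact (mem_support_sub_smul hG).elim (hAB' 4 G) (hAB 4 G)
    · rw [apply_eq_zero_of_shape_AB hAB hp, apply_eq_zero_of_shape_AB hAB' hp, smul_zero]

end BiGC

end

/-! ### Non-exactness among graphs without cycles -/

noncomputable section

namespace BiGC

open MvPolynomial

variable {K : Type*} [Field K]

/-! ### The four letters -/

/-- Both arrows point forward. -/
abbrev Letter.pp : Letter := (true, true)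

/-- The black arrow points forward, the red arrow backward. -/
abbrev Letter.pm : Letter := (true, false)

/-- The black arrow points backward, the red arrow forward. -/
abbrev Letter.mp : Letter := (false, true)

/-- Both arrows point backward. -/
abbrev Letter.mm : Letter := (false, false)

open Letter

/-! ### Coboundaries of graphs without cycles -/

/-- Walks of length at most `n`. -/
def reachable {V : Type} [DecidableEq V] (A : List (V × V)) : ℕ → V → V → Bool
  | 0, _, _ => false
  | n + 1, u, v => A.any fun a => a.1 = u && (a.2 = v || reachable A n a.2 v)

theorem transGen_of_reachable {V : Type} [DecidableEq V] {A : List (V × V)} {n : ℕ} {u v : V}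
    (h : reachable A n u v = true) : Relation.TransGen (fun u v => (u, v) ∈ A) u v := by
  induction n generalizing u with
  | zero => simp [reachable] at h
  | succ n ih =>
    simp only [reachable, List.any_eq_true, Bool.and_eq_true, Bool.or_eq_true,
      decide_eq_true_eq] at h
    obtain ⟨⟨a, b⟩, hA, rfl, h | h⟩ := h
    · exact h ▸ .single hA
    · exact .head hA (ih h)

theorem hasBlackCycle_of_reachable {V : Type} [DecidableEq V] {L : List (V × V × Letter)}
    {n : ℕ} {v : V} (h : reachable (arrows Prod.fst L) n v v = true) :
    (graph L).HasBlackCycle :=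
  ⟨v, Relation.TransGen.mono (fun _ _ h => (black_graph L _ _).2 h) _ _ (transGen_of_reachable h)⟩

theorem hasRedCycle_of_reachable {V : Type} [DecidableEq V] {L : List (V × V × Letter)}
    {n : ℕ} {v : V} (h : reachable (arrows Prod.snd L) n v v = true) :
    (graph L).HasRedCycle :=
  ⟨v, Relation.TransGen.mono (fun _ _ h => (red_graph L _ _).2 h) _ _ (transGen_of_reachable h)⟩

theorem reachable_theta123 : ∀ x w1 w2 z1 z2 z3 : Bool,
    cyclicArms [x] [w1, w2] [z1, z2, z3] = true → reachable (arrows Prod.snd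
      (theta123 (x, x) (w1, w1) (w2, w2) (z1, z1) (z2, z2) (z3, z3))) 5 0 0 = true := by
  decide +kernel

theorem reachable_theta222 : ∀ x1 x2 w1 w2 z1 z2 : Bool,
    cyclicArms [x1, x2] [w1, w2] [z1, z2] = true → reachable (arrows Prod.snd
      (theta222 (x1, x1) (x2, x2) (w1, w1) (w2, w2) (z1, z1) (z2, z2))) 5 0 0 = true := by
  decide +kernel

/-- Alternating combinations of graphs without black or red cycles. -/
structure Acyclic (k : Gra K 4) : Prop where
  alt : Alternating k
  black : ∀ L, val k L ≠ 0 → ¬ (graph L).HasBlackCycle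
  red : ∀ L, val k L ≠ 0 → ¬ (graph L).HasRedCycle

namespace Acyclic

variable {k : Gra K 4}

theorem zero123 (hk : Acyclic k) (x w1 w2 z1 z2 z3 : Letter)
    (h : cyclicArms [x.1] [w1.1, w2.1] [z1.1, z2.1, z3.1] = true ∨
      cyclicArms [x.2] [w1.2, w2.2] [z1.2, z2.2, z3.2] = true) :
    val k (theta123 x w1 w2 z1 z2 z3) = 0 := by
  by_contra h0
  rcases h with h | h
  · exact hk.black _ h0 (hasBlackCycle_of_reachable (reachable_theta123 _ _ _ _ _ _ h))
  · exact hk.red _ h0 (hasRedCycle_of_reachable (reachable_theta123 _ _ _ _ _ _ h))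

theorem zero222 (hk : Acyclic k) (x1 x2 w1 w2 z1 z2 : Letter)
    (h : cyclicArms [x1.1, x2.1] [w1.1, w2.1] [z1.1, z2.1] = true ∨
      cyclicArms [x1.2, x2.2] [w1.2, w2.2] [z1.2, z2.2] = true) :
    val k (theta222 x1 x2 w1 w2 z1 z2) = 0 := by
  by_contra h0
  rcases h with h | h
  · exact hk.black _ h0 (hasBlackCycle_of_reachable (reachable_theta222 _ _ _ _ _ _ h))
  · exact hk.red _ h0 (hasRedCycle_of_reachable (reachable_theta222 _ _ _ _ _ _ h))

/-- A linear relation between the coefficients of a coboundary. -/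
theorem relation [CharZero K] (hk : Acyclic k) :
    - 2 * val (Gra.circ k (mc K)) (theta133 mp pp pm mm pp pm mp)
    - 2 * val (Gra.circ k (mc K)) (theta133 mp pp mp mm pp pm mp)
    + 1 * val (Gra.circ k (mc K)) (theta223 mp mm pm mp pp mp mm)
    + 1 * val (Gra.circ k (mc K)) (theta223 mp mm pm mp pp pm mm)
    - 1 * val (Gra.circ k (mc K)) (theta223 mp mm pp mp pp mp mm)
    - 1 * val (Gra.circ k (mc K)) (theta223 mp mm pp mp pp pm mm)
    - 2 * val (Gra.circ k (mc K)) (theta223 mp mm pp mp pp pm mp)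
    + 1 * val (Gra.circ k (mc K)) (theta223 pm mm pm mp pp mp mm)
    + 1 * val (Gra.circ k (mc K)) (theta223 pm mm pm mp pp pm mm) = 0 := by
  have sa : pp.sgn K = 1 := rfl
  have sb : pm.sgn K = 1 := rfl
  have sc : mp.sgn K = -1 := rfl
  have se : mm.sgn K = -1 := rfl
  -- In the names below, f stands for arms 1, 2, 3 and g for arms 2, 2, 2, and the letters a, b, c,
  -- e stand for pp, pm, mp, mm. Each coefficient is either zero because of a cycle or an odd
  -- symmetry, or brought to a representative under the symmetries.
  have hf_cbeabc : val k (theta123 mp pm mm pp pm mp) = 0 := hk.zero123 _ _ _ _ _ _ (by decide)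
  have hf_cbcabe : val k (theta123 mp pm mp pp pm mm) = val k (theta123 pm pm mp pp mp mm) :=
    val_theta123_rev hk.alt pm pm mp pp mp mm
  have hf_caeabc : val k (theta123 mp pp mm pp pm mp) = val k (theta123 pm pp mm pm mp mm) :=
    val_theta123_rev hk.alt pm pp mm pm mp mm
  have hf_cacabe : val k (theta123 mp pp mp pp pm mm) = val k (theta123 pm pm mm pp mp mm) :=
    val_theta123_rev hk.alt pm pm mm pp mp mm
  have hf_cababc : val k (theta123 mp pp pm pp pm mp) = 0 := hk.zero123 _ _ _ _ _ _ (by decide)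
  have hf_cababe : val k (theta123 mp pp pm pp pm mm) = 0 := hk.zero123 _ _ _ _ _ _ (by decide)
  have hf_cceabc : val k (theta123 mp mp mm pp pm mp) = val k (theta123 pm pp pm pm mp mm) :=
    val_theta123_rev hk.alt pm pp pm pm mp mm
  have hf_cbcace : val k (theta123 mp pm mp pp mp mm) = val k (theta123 pm pm mp pp pm mm) :=
    val_theta123_rev hk.alt pm pm mp pp pm mm
  have hf_cacace : val k (theta123 mp pp mp pp mp mm) = val k (theta123 pm pm mm pp pm mm) :=
    val_theta123_rev hk.alt pm pm mm pp pm mm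
  have hf_cacabc : val k (theta123 mp pp mp pp pm mp) = val k (theta123 pm pm mm pm mp mm) :=
    val_theta123_rev hk.alt pm pm mm pm mp mm
  have hf_cabace : val k (theta123 mp pp pm pp mp mm) = 0 := hk.zero123 _ _ _ _ _ _ (by decide)
  have hf_ebcace : val k (theta123 mm pm mp pp mp mm) = val k (theta123 pp pm mp pp pm mm) :=
    val_theta123_rev hk.alt pp pm mp pp pm mm
  have hf_cceace : val k (theta123 mp mp mm pp mp mm) = val k (theta123 pm pp pm pp pm mm) :=
    val_theta123_rev hk.alt pm pp pm pp pm mm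
  have hf_bceace : val k (theta123 pm mp mm pp mp mm) = 0 := hk.zero123 _ _ _ _ _ _ (by decide)
  have hg_cebcce : val k (theta222 mp mm pm mp mp mm) = 0 := by
    refine self_eq_neg.1 ?_
    linear_combination (id (val_theta222_swap hk.alt mp mm mp mm pm mp) : val k (theta222 mp mm pm
      mp mp mm) = -val k (theta222 mp mm mp mm pm mp))
      - (id (val_theta222_swap' hk.alt mp mm mp mm pm mp) : val k (theta222 mp mm mp mm pm mp) =
        -val k (theta222 mp mm mp mm pm mp))
      + (id (val_theta222_swap hk.alt mp mm pm mp mp mm) : val k (theta222 mp mm mp mm pm mp) =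
        -val k (theta222 mp mm pm mp mp mm))
  have hg_cebcae : val k (theta222 mp mm pm mp pp mm) = val k (theta222 pp pm pp mm pm mp) :=
    val_theta222_rev hk.alt pp pm pp mm pm mp
  have hg_cebcac : val k (theta222 mp mm pm mp pp mp) = -val k (theta222 pp pm pm mp pm mm) := by
    linear_combination (id (val_theta222_swap hk.alt mp mm pp mp pm mp) : val k (theta222 mp mm pm
      mp pp mp) = -val k (theta222 mp mm pp mp pm mp))
      - (id (val_theta222_rev hk.alt pp pm pm mp pm mm) : val k (theta222 mp mm pp mp pm mp) = val
        k (theta222 pp pm pm mp pm mm))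
  have hf_ebcabe : val k (theta123 mm pm mp pp pm mm) = val k (theta123 pp pm mp pp mp mm) :=
    val_theta123_rev hk.alt pp pm mp pp mp mm
  have hf_cceabe : val k (theta123 mp mp mm pp pm mm) = val k (theta123 pm pp pm pp mp mm) :=
    val_theta123_rev hk.alt pm pp pm pp mp mm
  have hf_bceabe : val k (theta123 pm mp mm pp pm mm) = 0 := hk.zero123 _ _ _ _ _ _ (by decide)
  have hg_cebcbe : val k (theta222 mp mm pm mp pm mm) = val k (theta222 pp pm pp mp pm mp) :=
    val_theta222_rev hk.alt pp pm pp mp pm mp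
  have hg_cebcab : val k (theta222 mp mm pm mp pp pm) = 0 := hk.zero222 _ _ _ _ _ _ (by decide)
  have hf_eacace : val k (theta123 mm pp mp pp mp mm) = 0 := hk.zero123 _ _ _ _ _ _ (by decide)
  have hf_aceace : val k (theta123 pp mp mm pp mp mm) = 0 := hk.zero123 _ _ _ _ _ _ (by decide)
  have hg_ceacce : val k (theta222 mp mm pp mp mp mm) = 0 := by
    refine self_eq_neg.1 ?_
    linear_combination (id (val_theta222_swap hk.alt mp mm mp mm pp mp) : val k (theta222 mp mm pp
      mp mp mm) = -val k (theta222 mp mm mp mm pp mp))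
      - (id (val_theta222_swap' hk.alt mp mm mp mm pp mp) : val k (theta222 mp mm mp mm pp mp) =
        -val k (theta222 mp mm mp mm pp mp))
      + (id (val_theta222_swap hk.alt mp mm pp mp mp mm) : val k (theta222 mp mm mp mm pp mp) =
        -val k (theta222 mp mm pp mp mp mm))
  have hg_ceacae : val k (theta222 mp mm pp mp pp mm) = val k (theta222 pp pm pp mm pm mm) :=
    val_theta222_rev hk.alt pp pm pp mm pm mm
  have hg_ceacac : val k (theta222 mp mm pp mp pp mp) = 0 := by
    refine self_eq_neg.1 ?_
    linear_combination (id (val_theta222_swap hk.alt mp mm pp mp pp mp) : val k (theta222 mp mm pp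
      mp pp mp) = -val k (theta222 mp mm pp mp pp mp))
  have hf_eacabe : val k (theta123 mm pp mp pp pm mm) = 0 := hk.zero123 _ _ _ _ _ _ (by decide)
  have hf_aceabe : val k (theta123 pp mp mm pp pm mm) = 0 := hk.zero123 _ _ _ _ _ _ (by decide)
  have hg_ceacbe : val k (theta222 mp mm pp mp pm mm) = 0 := hk.zero222 _ _ _ _ _ _ (by decide)
  have hg_ceacab : val k (theta222 mp mm pp mp pp pm) = 0 := hk.zero222 _ _ _ _ _ _ (by decide)
  have hf_eacabc : val k (theta123 mm pp mp pp pm mp) = 0 := hk.zero123 _ _ _ _ _ _ (by decide)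
  have hf_aceabc : val k (theta123 pp mp mm pp pm mp) = 0 := hk.zero123 _ _ _ _ _ _ (by decide)
  have hg_ceacbc : val k (theta222 mp mm pp mp pm mp) = val k (theta222 pp pm pm mp pm mm) :=
    val_theta222_rev hk.alt pp pm pm mp pm mm
  have hf_cbeace : val k (theta123 mp pm mm pp mp mm) = 0 := hk.zero123 _ _ _ _ _ _ (by decide)
  have hg_bebcce : val k (theta222 pm mm pm mp mp mm) = -val k (theta222 pp pm pp mp pm mp) := by
    linear_combination (id (val_theta222_rev hk.alt pp mp pp pm pm mp) : val k (theta222 pm mm pm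
      mp mp mm) = val k (theta222 pp mp pp pm pm mp))
      + (id (val_theta222_swap' hk.alt pp pm pp mp pm mp) : val k (theta222 pp mp pp pm pm mp) =
        -val k (theta222 pp pm pp mp pm mp))
  have hg_bebcae : val k (theta222 pm mm pm mp pp mm) = val k (theta222 pp mp pp mm pm mp) :=
    val_theta222_rev hk.alt pp mp pp mm pm mp
  have hg_bebcac : val k (theta222 pm mm pm mp pp mp) = 0 := hk.zero222 _ _ _ _ _ _ (by decide)
  have hf_cbeabe : val k (theta123 mp pm mm pp pm mm) = 0 := hk.zero123 _ _ _ _ _ _ (by decide)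
  have hg_bebcbe : val k (theta222 pm mm pm mp pm mm) = 0 := by
    refine self_eq_neg.1 ?_
    linear_combination (id (val_theta222_swap hk.alt pm mm pm mm pm mp) : val k (theta222 pm mm pm
      mp pm mm) = -val k (theta222 pm mm pm mm pm mp))
      - (id (val_theta222_swap' hk.alt pm mm pm mm pm mp) : val k (theta222 pm mm pm mm pm mp) =
        -val k (theta222 pm mm pm mm pm mp))
      + (id (val_theta222_swap hk.alt pm mm pm mp pm mm) : val k (theta222 pm mm pm mm pm mp) =
        -val k (theta222 pm mm pm mp pm mm))
  have hg_bebcab : val k (theta222 pm mm pm mp pp pm) = -val k (theta222 pp pm pm mp pm mm) := by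
    linear_combination (id (val_theta222_swap hk.alt pm mm pp pm pm mp) : val k (theta222 pm mm pm
      mp pp pm) = -val k (theta222 pm mm pp pm pm mp))
      - (id (val_theta222_swap' hk.alt pp pm pm mm pm mp) : val k (theta222 pm mm pp pm pm mp) =
        -val k (theta222 pp pm pm mm pm mp))
      + (id (val_theta222_swap hk.alt pp pm pm mp pm mm) : val k (theta222 pp pm pm mm pm mp) =
        -val k (theta222 pp pm pm mp pm mm))
  -- The two contractions to figure eights differ by the reversal of a loop, which is odd, and so
  -- cancel.
  have h8 : val k (eight33 pp mp mm pp pm mp) = -val k (eight33 pp pm mm pp pm mp) :=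
    val_eight33_rev hk.alt pp pm mm pp pm mp
  have e0 := theta133_circ hk.alt mp pp pm mm pp pm mp
  have e1 := theta133_circ hk.alt mp pp mp mm pp pm mp
  have e2 := theta223_circ hk.alt mp mm pm mp pp mp mm
  have e3 := theta223_circ hk.alt mp mm pm mp pp pm mm
  have e4 := theta223_circ hk.alt mp mm pp mp pp mp mm
  have e5 := theta223_circ hk.alt mp mm pp mp pp pm mm
  have e6 := theta223_circ hk.alt mp mm pp mp pp pm mp
  have e7 := theta223_circ hk.alt pm mm pm mp pp mp mm
  have e8 := theta223_circ hk.alt pm mm pm mp pp pm mm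
  simp only [hf_cbeabc, hf_cbcabe, hf_caeabc, hf_cacabe, hf_cababc, hf_cababe, hf_cceabc,
    hf_cbcace, hf_cacace, hf_cacabc, hf_cabace, hf_ebcace, hf_cceace, hf_bceace, hg_cebcce,
    hg_cebcae, hg_cebcac, hf_ebcabe, hf_cceabe, hf_bceabe, hg_cebcbe, hg_cebcab, hf_eacace,
    hf_aceace, hg_ceacce, hg_ceacae, hg_ceacac, hf_eacabe, hf_aceabe, hg_ceacbe, hg_ceacab,
    hf_eacabc, hf_aceabc, hg_ceacbc, hf_cbeace, hg_bebcce, hg_bebcae, hg_bebcac, hf_cbeabe,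
    hg_bebcbe, hg_bebcab, h8, sa, sb, sc, se] at e0 e1 e2 e3 e4 e5 e6 e7 e8
  -- Dually, these coefficients form a cycle for edge contraction once graphs with a black or red
  -- cycle are discarded; all representatives cancel.
  linear_combination - 2 * e0 - 2 * e1 + 1 * e2 + 1 * e3 - 1 * e4 - 1 * e5 - 2 * e6 + 1 * e7 + 1 *
    e8

/-- A cocycle of graphs with red cycles has the differential of a combination of graphs without
cycles only if its coefficient vanishes. -/
theorem scalar_eq_zero [CharZero K] (hk : Acyclic k) {g : Gra K 4} (h : RedCocycle g)
    (hg : ∀ L, NoUnivalent (prodE K L : Gra K 5) →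
      val (Gra.circ g (mc K)) L = val (Gra.circ k (mc K)) L) : RedCocycle.scalar g = 0 := by
  have e := hk.relation
  have h133 := fun x w1 w2 w3 z1 z2 z3 => hg _ (noUnivalent_theta133 x w1 w2 w3 z1 z2 z3)
  have h223 := fun v1 v2 w1 w2 z1 z2 z3 => hg _ (noUnivalent_theta223 v1 v2 w1 w2 z1 z2 z3)
  simp only [← h133, ← h223, h.zero_theta223] at e
  rw [theta133_circ h.alt, theta133_circ h.alt] at e
  have hs : val g (theta123 mp pm mm pp pm mp) = RedCocycle.scalar g :=
    val_theta123_rev h.alt pm pp mp pm mp mm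
  have h2 : (2 : K) ≠ 0 := two_ne_zero
  -- The coefficients at arms 2, 2, 3 vanish for a `RedCocycle`. Of the two at arms 1, 3, 3 only the
  -- first keeps a contraction with a red cycle, and the relation becomes 2 times the scalar.
  simpa [h.red123, cyclicArms, h.eight33, hs, Letter.sgn_true, Letter.sgn_false] using e

end Acyclic

theorem acyclic_of_mem {κ : Cochain K} (h : κ ∈ fcGCBi K) : Acyclic (κ 4) where
  alt := alternating_of_mem h.1 4
  black _ hL := h.1.2 4 _ (val_ne_zero hL)
  red _ hL := h.2 4 _ (val_ne_zero hL)

theorem IsPair.not_exact [CharZero K] {Θ ϑ : Cochain K} (h : IsPair Θ ϑ) (hΘ : Θ ∈ fcGCBi K)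
    (hϑ : ϑ ∈ fcGCBlack K) (hs : RedCocycle.scalar (ϑ 4) ≠ 0) :
    ¬ ∃ κ ∈ fcGCBi K, Θ = -delta κ := by
  rintro ⟨κ, hκ, hd⟩
  refine hs ((acyclic_of_mem hκ).scalar_eq_zero (h.redCocycle hΘ hϑ) fun L hL => ?_)
  rw [← val_delta ϑ hL, ← val_delta κ hL]
  have h5 := DFunLike.congr_fun (h.eq_neg_delta.symm.trans hd) 5
  exact congrArg (fun a => val a L) h5

end BiGC

end

/-! ### Differential of antisymmetrized graphs -/

noncomputable section

namespace BiGC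

open MvPolynomial

variable {K : Type*} [Field K]

/-! ### Antisymmetrization -/

/-- The signed sum over all permutations of the vertices. -/
def alt {p : ℕ} : Gra K p →ₗ[K] Gra K p :=
  ∑ τ : Equiv.Perm (Fin (p + 1)),
    ((Equiv.Perm.sign τ : ℤˣ) : ℤ) • (rename (R := K) (BiEdge.map τ)).toLinearMap

theorem alt_apply {p : ℕ} (f : Gra K p) :
    alt f = ∑ τ : Equiv.Perm (Fin (p + 1)), ((Equiv.Perm.sign τ : ℤˣ) : ℤ) • Gra.perm τ f := by
  simp only [alt, LinearMap.sum_apply, LinearMap.smul_apply]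
  rfl

theorem sign_mul_self {n : ℕ} (σ : Equiv.Perm (Fin n)) :
    ((Equiv.Perm.sign σ : ℤˣ) : ℤ) * ((Equiv.Perm.sign σ : ℤˣ) : ℤ) = 1 := by
  rw [← Units.val_mul, Int.units_mul_self, Units.val_one]

theorem alt_perm {p : ℕ} (σ : Equiv.Perm (Fin (p + 1))) (f : Gra K p) :
    alt (Gra.perm σ f) = ((Equiv.Perm.sign σ : ℤˣ) : ℤ) • alt f := by
  rw [alt_apply, alt_apply, Finset.smul_sum]
  refine Fintype.sum_equiv (Equiv.mulRight σ) _ _ fun τ => ?_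
  rw [Equiv.coe_mulRight, ← Gra.perm_mul, smul_smul, Equiv.Perm.sign_mul, Units.val_mul,
    mul_left_comm, sign_mul_self, mul_one]

theorem alternating_alt {p : ℕ} (f : Gra K p) : Alternating (alt f) := by
  intro σ
  rw [alt_apply, Finset.smul_sum]
  simp only [Gra.perm, map_sum, map_zsmul]
  refine Fintype.sum_equiv (Equiv.mulLeft σ) _ _ fun τ => ?_
  rw [Equiv.coe_mulLeft, smul_smul, Equiv.Perm.sign_mul, Units.val_mul, ← mul_assoc,
    sign_mul_self, one_mul]
  congr 1
  exact (Gra.perm_mul σ τ f).symm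

/-- The extension of a permutation of `0, …, 4` that fixes `5`. -/
def extend (τ : Equiv.Perm (Fin 5)) : Equiv.Perm (Fin 6) :=
  (finSuccEquivLast (n := 5)).symm.permCongr (Equiv.optionCongr τ)

theorem extend_castSucc (τ : Equiv.Perm (Fin 5)) (v : Fin 5) :
    extend τ v.castSucc = (τ v).castSucc := by
  simp [extend, Equiv.permCongr_apply]

theorem extend_five (τ : Equiv.Perm (Fin 5)) : extend τ 5 = 5 := by
  have h : finSuccEquivLast (5 : Fin 6) = none := finSuccEquivLast_last
  rw [extend, Equiv.permCongr_apply, Equiv.symm_symm, h]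
  rfl

theorem sign_extend (τ : Equiv.Perm (Fin 5)) :
    Equiv.Perm.sign (extend τ) = Equiv.Perm.sign τ := by
  rw [extend, Equiv.Perm.sign_permCongr, Equiv.optionCongr_sign]

theorem extend_injective : Function.Injective extend := by
  intro τ τ' h
  ext v
  have h1 := Equiv.congr_fun h v.castSucc
  rw [extend_castSucc, extend_castSucc] at h1
  rw [Fin.castSucc_injective _ h1]

/-! ### The differential of an antisymmetrization -/

/-- The Maurer-Cartan element at the vertices `v` and `5`. -/
def mcAt (K : Type*) [Field K] (v : Fin 6) : Gra K 5 := ∑ r : Bool, (X (v, 5, r) - X (5, v, r))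

theorem perm_mcAt (σ : Equiv.Perm (Fin 6)) (h5 : σ 5 = 5) (v : Fin 6) :
    Gra.perm σ (mcAt K v) = mcAt K (σ v) := by
  simp [Gra.perm, mcAt, BiEdge.map, h5]

theorem aeval_reattach_mc : aeval (reattach 1 4) (mc K) = ∑ v : Fin 5, mcAt K v.castSucc := by
  have h0 : attach 1 4 0 = Finset.univ.image (Fin.castSucc : Fin 5 → Fin 6) := by decide
  have h1 : attach 1 4 1 = {(5 : Fin 6)} := by decide
  simp only [mc, map_sum, map_sub, aeval_X, reattach, h0, h1, Finset.sum_singleton, mcAt]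
  simp only [Finset.sum_image fun _ _ _ _ h => Fin.castSucc_injective 5 h]
  rw [Finset.sum_comm]
  simp only [Finset.sum_sub_distrib]

/-- A graph with an additional edge from `v` to the new vertex `5`. -/
def hair (v : Fin 5) (P : Gra K 4) : Gra K 5 :=
  rename (BiEdge.map Fin.castSucc) P * mcAt K v.castSucc

theorem comp_mc (P : Gra K 4) : Gra.comp (mc K) P = ∑ v, hair v P := by
  simp only [hair, ← Finset.mul_sum]
  rw [← aeval_reattach_mc, mul_comm]
  rfl

theorem sum_hair_perm (τ : Equiv.Perm (Fin 5)) (P : Gra K 4) :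
    ∑ v, hair v (Gra.perm τ P) = Gra.perm (extend τ) (∑ v, hair v P) := by
  have h : rename (BiEdge.map Fin.castSucc) (Gra.perm τ P) =
      Gra.perm (extend τ) (rename (BiEdge.map Fin.castSucc) P) := by
    have h0 : Fin.castSucc ∘ τ = extend τ ∘ Fin.castSucc :=
      funext fun v => (extend_castSucc τ v).symm
    simp only [Gra.perm, rename_rename, BiEdge.map_comp, h0]
  simp only [hair, ← Finset.mul_sum, h]
  rw [Gra.perm, Gra.perm, map_mul, map_sum]
  congr 1
  refine Fintype.sum_equiv τ.symm _ _ fun v => ?_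
  have h1 := perm_mcAt (K := K) (extend τ) (extend_five τ) (τ.symm v).castSucc
  rw [extend_castSucc, Equiv.apply_symm_apply] at h1
  exact h1.symm

theorem shuffles_one_four_injOn : ∀ σ ∈ shuffles 1 4, ∀ σ' ∈ shuffles 1 4,
    σ (5 : Fin 6) = σ' (5 : Fin 6) → σ = σ' := by
  have h : Set.InjOn (fun σ : Equiv.Perm (Fin 6) => σ 5) (shuffles 1 4) := by
    rw [← Finset.card_image_iff]
    decide +kernel
  exact fun σ hσ σ' hσ' e => h hσ hσ' e

theorem card_shuffles_one_four : (shuffles 1 4).card = 6 := by decide +kernel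

-- Every permutation of six vertices is uniquely a shuffle times one that fixes 5 (720 = 6 · 120),
-- so the shuffle sum completes the antisymmetrization.
set_option linter.constructorNameAsVariable false in
theorem circ_mc_alt (P : Gra K 4) : Gra.circ (mc K) (alt P) = alt (∑ v, hair v P) := by
  have h1 : ∀ σ : Equiv.Perm (Fin 6), ∀ τ : Equiv.Perm (Fin 5),
      Gra.perm σ (∑ v, hair v (Gra.perm τ P)) = Gra.perm (σ * extend τ) (∑ v, hair v P) := by
    intro σ τ
    rw [sum_hair_perm, Gra.perm_mul]
  have h2 : Gra.circ (mc K) (alt P) = ∑ x ∈ shuffles 1 4 ×ˢ (Finset.univ : Finset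
      (Equiv.Perm (Fin 5))), ((Equiv.Perm.sign (x.1 * extend x.2) : ℤˣ) : ℤ) •
        Gra.perm (p := 5) (x.1 * extend x.2) (∑ v, hair v P) := by
    rw [Finset.sum_product, Gra.circ]
    refine Finset.sum_congr rfl fun σ _ => ?_
    have h3 : Gra.comp (mc K) (alt P) = ∑ τ : Equiv.Perm (Fin 5),
        ((Equiv.Perm.sign τ : ℤˣ) : ℤ) • ∑ v, hair v (Gra.perm τ P) := by
      rw [comp_mc, alt_apply]
      simp only [hair, map_sum, map_zsmul, Finset.sum_mul, Finset.smul_sum, smul_mul_assoc]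
      rw [Finset.sum_comm]
    rw [h3]
    have h4 : Gra.perm σ (∑ τ : Equiv.Perm (Fin 5),
        ((Equiv.Perm.sign τ : ℤˣ) : ℤ) • ∑ v, hair v (Gra.perm τ P)) =
        ∑ τ : Equiv.Perm (Fin 5), ((Equiv.Perm.sign τ : ℤˣ) : ℤ) •
          Gra.perm σ (∑ v, hair v (Gra.perm τ P)) := by
      simp only [Gra.perm, map_sum, map_zsmul]
    rw [h4, Finset.smul_sum]
    refine Finset.sum_congr rfl fun τ _ => ?_
    rw [h1, smul_smul, Equiv.Perm.sign_mul, sign_extend, Units.val_mul]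
  have h5 : Set.InjOn (fun x : Equiv.Perm (Fin 6) × Equiv.Perm (Fin 5) => x.1 * extend x.2)
      (shuffles 1 4 ×ˢ (Finset.univ : Finset (Equiv.Perm (Fin 5))) : Finset _) := by
    rintro ⟨σ, τ⟩ hx ⟨σ', τ'⟩ hx' h
    simp only [Finset.coe_product, Set.mem_prod, Finset.mem_coe] at hx hx'
    have h6 := Equiv.congr_fun h 5
    simp only [Equiv.Perm.mul_apply, extend_five] at h6
    obtain rfl := shuffles_one_four_injOn σ hx.1 σ' hx'.1 h6
    exact congrArg (Prod.mk σ) (extend_injective (mul_left_cancel h))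
  have h7 : (shuffles 1 4 ×ˢ (Finset.univ : Finset (Equiv.Perm (Fin 5)))).image
      (fun x : Equiv.Perm (Fin 6) × Equiv.Perm (Fin 5) => x.1 * extend x.2) = Finset.univ := by
    rw [← Finset.card_eq_iff_eq_univ, Finset.card_image_of_injOn h5, Finset.card_product,
      card_shuffles_one_four, Finset.card_univ, Fintype.card_perm, Fintype.card_perm,
      Fintype.card_fin, Fintype.card_fin]
    norm_num [Nat.factorial]
  rw [h2, alt_apply, ← h7, Finset.sum_image h5]

/-- The map that identifies the vertices `v` and `5`. -/
def identify (v : Fin 5) (u : Fin 6) : Fin 5 := if h : u = 5 then v else u.castLT (by omega)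

/-- The sum of all the ways of reattaching an edge to `v` and `5`, when it is incident to `v`. -/
def lift (v : Fin 5) (e : BiEdge (Fin 5)) : Gra K 5 :=
  ∑ u with identify v u = e.1, ∑ w with identify v w = e.2.1, X (u, w, e.2.2)

/-- The sum of all the ways of splitting the vertex `v` into `v` and `5`. -/
def split (v : Fin 5) (P : Gra K 4) : Gra K 5 := aeval (lift v) P * mcAt K v.castSucc

/-- The cyclic permutation of `1, …, 5`. -/
def shift : Equiv.Perm (Fin 6) :=
  ⟨![0, 2, 3, 4, 5, 1], ![0, 5, 1, 2, 3, 4], by decide, by decide⟩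

theorem collapse_shift (v : Fin 6) : collapse (shift v) = identify 0 v := by
  revert v; decide

theorem identify_extend (τ : Equiv.Perm (Fin 5)) (v : Fin 5) (u : Fin 6) :
    identify (τ v) (extend τ u) = τ (identify v u) := by
  rcases Fin.eq_castSucc_or_eq_last u with ⟨w, rfl⟩ | rfl
  · rw [extend_castSucc, identify, identify, dif_neg, dif_neg]
    · simp
    · exact (Fin.castSucc_lt_last w).ne
    · exact (Fin.castSucc_lt_last (τ w)).ne
  · have h : Fin.last 5 = 5 := rfl
    rw [h, extend_five]
    simp [identify]

/-- `split` puts the new vertex last, whereas `Gra.comp` inserts it right after 0; the even cycle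
`shift` translates between the two numberings. -/
theorem comp_perm_mc (τ : Equiv.Perm (Fin 5)) (v : Fin 5) (hv : τ v = 0) (P : Gra K 4) :
    Gra.comp (Gra.perm τ P) (mc K) = Gra.perm (p := 5) (shift * extend τ) (split v P) := by
  have hc : ∀ u, collapse ((shift * extend τ) u) = τ (identify v u) := by
    intro u
    rw [Equiv.Perm.mul_apply, collapse_shift, ← hv, identify_extend]
  have h1 : ∀ e : BiEdge (Fin 5), (reattach 4 1 (BiEdge.map τ e) : Gra K 5) =
      Gra.perm (p := 5) (shift * extend τ) (lift v e) := by
    intro e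
    simp only [reattach, Gra.perm, lift, map_sum, rename_X, BiEdge.map]
    have h2 : ∀ i u, u ∈ Finset.univ.filter (fun u => identify v u = i) ↔
        (shift * extend τ) u ∈ attach 4 1 (τ i) := by
      intro i u
      rw [mem_attach, hc, Finset.mem_filter]
      simp
    symm
    refine Finset.sum_equiv (shift * extend τ) (h2 _) fun u _ => ?_
    exact Finset.sum_equiv (shift * extend τ) (h2 _) fun w _ => rfl
  rw [Gra.comp, split]
  simp only [Gra.perm, map_mul]
  congr 1
  · rw [aeval_rename]
    have h3 : (rename (R := K) (BiEdge.map ⇑(shift * extend τ))).comp (aeval (lift v)) =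
        aeval (reattach 4 1 ∘ BiEdge.map τ) := by
      refine algHom_ext fun e => ?_
      rw [AlgHom.comp_apply, aeval_X, aeval_X]
      exact (h1 e).symm
    rw [← h3]
    rfl
  · have h4 : (shift * extend τ) v.castSucc = 0 := by
      rw [Equiv.Perm.mul_apply, extend_castSucc, hv]
      rfl
    have h5 : (shift * extend τ) 5 = 1 := by
      rw [Equiv.Perm.mul_apply, extend_five]
      rfl
    simp only [mc, mcAt, map_sum, map_sub, rename_X, BiEdge.map, h4, h5]
    rfl

theorem card_shuffles_four_one : (shuffles 4 1).card = 15 := by decide +kernel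

theorem card_filter_apply_eq_zero : ∀ v : Fin 5,
    (Finset.univ.filter fun τ : Equiv.Perm (Fin 5) => τ v = 0).card = 24 := by
  decide +kernel

theorem card_filter_lt : ∀ v : Fin 5,
    (Finset.univ.filter fun ρ : Equiv.Perm (Fin 6) => ρ v.castSucc < ρ 5).card = 360 := by
  decide +kernel

/-- The places of `v` and 5 under the product are `σ 0 < σ 1`, hence they determine `σ` and then
`τ`. The count 15 · 24 = 360 shows that exactly half of all permutations arise. -/
theorem sum_shuffles {M : Type*} [AddCommMonoid M] (v : Fin 5) (F : Equiv.Perm (Fin 6) → M) :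
    ∑ x ∈ shuffles 4 1 ×ˢ Finset.univ.filter (fun τ : Equiv.Perm (Fin 5) => τ v = 0),
      F (x.1 * (shift * extend x.2)) = ∑ ρ with ρ v.castSucc < ρ 5, F ρ := by
  have hx : ∀ (σ : Equiv.Perm (Fin 6)) (τ : Equiv.Perm (Fin 5)), τ v = 0 →
      (σ * (shift * extend τ)) v.castSucc = σ 0 ∧ (σ * (shift * extend τ)) 5 = σ 1 := by
    intro σ τ h
    simp only [Equiv.Perm.mul_apply, extend_castSucc, extend_five, h]
    exact ⟨rfl, rfl⟩
  have h1 : Set.InjOn (fun x : Equiv.Perm (Fin 6) × Equiv.Perm (Fin 5) =>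
      x.1 * (shift * extend x.2)) (shuffles 4 1 ×ˢ Finset.univ.filter
        (fun τ : Equiv.Perm (Fin 5) => τ v = 0) : Finset _) := by
    rintro ⟨σ, τ⟩ h ⟨σ', τ'⟩ h' e
    rw [Finset.mem_coe, Finset.mem_product, Finset.mem_filter] at h h'
    have e0 := Equiv.congr_fun e v.castSucc
    have e1 := Equiv.congr_fun e 5
    simp only [(hx _ _ h.2.2).1, (hx _ _ h'.2.2).1] at e0
    simp only [(hx _ _ h.2.2).2, (hx _ _ h'.2.2).2] at e1
    obtain rfl : σ = σ' := shuffles_injOn h.1 h'.1 (Prod.ext e0 e1)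
    exact congrArg (Prod.mk σ) (extend_injective (mul_left_cancel (mul_left_cancel e)))
  have h2 : (shuffles 4 1 ×ˢ Finset.univ.filter (fun τ : Equiv.Perm (Fin 5) => τ v = 0)).image
      (fun x : Equiv.Perm (Fin 6) × Equiv.Perm (Fin 5) => x.1 * (shift * extend x.2)) =
      Finset.univ.filter fun ρ : Equiv.Perm (Fin 6) => ρ v.castSucc < ρ 5 := by
    refine Finset.eq_of_subset_of_card_le ?_ ?_
    · intro ρ hρ
      obtain ⟨⟨σ, τ⟩, h, rfl⟩ := Finset.mem_image.1 hρ
      rw [Finset.mem_product, Finset.mem_filter] at h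
      rw [Finset.mem_filter, (hx _ _ h.2.2).1, (hx _ _ h.2.2).2]
      exact ⟨Finset.mem_univ _, (shuffles_spec σ h.1).1⟩
    · rw [Finset.card_image_of_injOn h1, Finset.card_product, card_shuffles_four_one,
        card_filter_apply_eq_zero, card_filter_lt]
  rw [← h2, Finset.sum_image h1]

/-- Right multiplication by the transposition of `v` and 5 maps the permutations with the inequality
onto those without, so antisymmetrizing in these two vertices makes up for the missing half. -/
theorem sum_filter_lt (v : Fin 5) (Z : Gra K 5) :
    ∑ ρ : Equiv.Perm (Fin 6) with ρ v.castSucc < ρ 5, ((Equiv.Perm.sign ρ : ℤˣ) : ℤ) •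
      Gra.perm (p := 5) ρ (Z - Gra.perm (p := 5) (Equiv.swap v.castSucc 5) Z) = alt Z := by
  have hv : v.castSucc ≠ (5 : Fin 6) := (Fin.castSucc_lt_last v).ne
  have h1 : ∀ ρ : Equiv.Perm (Fin 6), ((Equiv.Perm.sign ρ : ℤˣ) : ℤ) •
      Gra.perm (p := 5) ρ (Z - Gra.perm (p := 5) (Equiv.swap v.castSucc 5) Z) =
      ((Equiv.Perm.sign ρ : ℤˣ) : ℤ) • Gra.perm (p := 5) ρ Z +
      ((Equiv.Perm.sign (ρ * Equiv.swap v.castSucc 5) : ℤˣ) : ℤ) •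
        Gra.perm (p := 5) (ρ * Equiv.swap v.castSucc 5) Z := by
    intro ρ
    rw [Gra.perm_mul, Equiv.Perm.sign_mul, Equiv.Perm.sign_swap hv]
    rw [Gra.perm, map_sub, smul_sub, mul_neg, mul_one, Units.val_neg, neg_smul, ← sub_eq_add_neg]
    rfl
  simp only [h1]
  rw [alt_apply, Finset.sum_add_distrib, ← Finset.sum_filter_add_sum_filter_not Finset.univ
    (fun ρ : Equiv.Perm (Fin 6) => ρ v.castSucc < ρ 5)]
  congr 1
  refine Finset.sum_equiv (Equiv.mulRight (Equiv.swap v.castSucc 5)) (fun ρ => ?_) fun ρ _ => rfl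
  simp only [Finset.mem_filter, Finset.mem_univ, true_and, Equiv.coe_mulRight,
    Equiv.Perm.mul_apply, Equiv.swap_apply_left, Equiv.swap_apply_right, not_lt]
  exact ⟨le_of_lt, fun h => lt_of_le_of_ne h fun e => hv (ρ.injective e)⟩

/-- Reattachment is symmetric in `v` and 5, and the new edge antisymmetric. The ways of distributing
the half edges thus come in complementary pairs, and `Z v` lists one from each pair. -/
theorem circ_alt_mc (P : Gra K 4) (Z : Fin 5 → Gra K 5)
    (hZ : ∀ v, split v P = Z v - Gra.perm (p := 5) (Equiv.swap v.castSucc 5) (Z v)) :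
    Gra.circ (alt P) (mc K) = alt (∑ v, Z v) := by
  have h1 : Gra.circ (alt P) (mc K) = ∑ σ ∈ shuffles 4 1, ∑ τ : Equiv.Perm (Fin 5),
      ((Equiv.Perm.sign (σ * (shift * extend τ)) : ℤˣ) : ℤ) •
        Gra.perm (p := 5) (σ * (shift * extend τ)) (split (τ.symm 0) P) := by
    rw [Gra.circ]
    refine Finset.sum_congr rfl fun σ _ => ?_
    have h3 : Gra.comp (alt P) (mc K) = ∑ τ : Equiv.Perm (Fin 5),
        ((Equiv.Perm.sign τ : ℤˣ) : ℤ) • Gra.comp (Gra.perm τ P) (mc K) := by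
      rw [alt_apply]
      simp only [Gra.comp, map_sum, map_zsmul, Finset.sum_mul, smul_mul_assoc]
    rw [h3]
    have h4 : Gra.perm σ (∑ τ : Equiv.Perm (Fin 5),
        ((Equiv.Perm.sign τ : ℤˣ) : ℤ) • Gra.comp (Gra.perm τ P) (mc K)) =
        ∑ τ : Equiv.Perm (Fin 5), ((Equiv.Perm.sign τ : ℤˣ) : ℤ) •
          Gra.perm σ (Gra.comp (Gra.perm τ P) (mc K)) := by
      simp only [Gra.perm, map_sum, map_zsmul]
    rw [h4, Finset.smul_sum]
    refine Finset.sum_congr rfl fun τ _ => ?_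
    have hs : Equiv.Perm.sign shift = 1 := by decide
    rw [comp_perm_mc τ (τ.symm 0) (τ.apply_symm_apply 0), smul_smul, Equiv.Perm.sign_mul,
      Equiv.Perm.sign_mul, sign_extend, hs, one_mul, Units.val_mul]
    congr 1
    exact (Gra.perm_mul (p := 5) _ _ _).symm
  rw [h1, Finset.sum_comm, map_sum, ← Finset.sum_fiberwise Finset.univ
    (fun τ : Equiv.Perm (Fin 5) => τ.symm 0)]
  refine Finset.sum_congr rfl fun v _ => ?_
  rw [← sum_filter_lt v, ← hZ, ← sum_shuffles v, Finset.sum_product_right]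
  refine Finset.sum_congr ?_ fun τ hτ => ?_
  · ext τ
    rw [Finset.mem_filter, Finset.mem_filter, Equiv.symm_apply_eq, eq_comm]
  · have h : τ v = 0 := (Finset.mem_filter.1 hτ).2
    rw [← h, Equiv.symm_apply_apply]

/-- The differential of an antisymmetrization. -/
theorem circ_alt_sub (P : Gra K 4) (Z : Fin 5 → Gra K 5)
    (hZ : ∀ v, split v P = (hair v P + Z v) -
      Gra.perm (p := 5) (Equiv.swap v.castSucc 5) (hair v P + Z v)) :
    Gra.circ (alt P) (mc K) - Gra.circ (mc K) (alt P) = alt (∑ v, Z v) := by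
  -- Leaving all half edges at `v` yields the hairs, which the other half of the bracket removes.
  rw [circ_alt_mc P _ hZ, circ_mc_alt, Finset.sum_add_distrib, map_add, add_sub_cancel_left]

end BiGC

end

noncomputable section

namespace BiGC

open MvPolynomial

variable {K : Type*} [Field K]

/-! ### The differential of theta graphs -/

theorem sum_identify {M : Type*} [AddCommMonoid M] (v s : Fin 5) (f : Fin 6 → M) :
    ∑ u with identify v u = s, f u = f s.castSucc + if s = v then f 5 else 0 := by
  have h1 : ∀ u : Fin 5, identify v u.castSucc = u := by revert v; decide
  have h2 : identify v (Fin.last 5) = v := by simp [identify]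
  rw [Finset.sum_filter, Fin.sum_univ_castSucc, h2]
  simp only [h1, Finset.sum_ite_eq', Finset.mem_univ, if_true, eq_comm (a := v)]
  rfl

theorem aeval_lift_E (v s t : Fin 5) (l : Letter) :
    aeval (lift v) (E K s t l) = E K s.castSucc t.castSucc l +
      (if s = v then E K 5 t.castSucc l else 0) + (if t = v then E K s.castSucc 5 l else 0) +
      if s = v ∧ t = v then E K 5 5 l else 0 := by
  rcases l with ⟨_ | _, r⟩ <;>
  simp only [E, edge, aeval_X, lift, sum_identify] <;>
  by_cases hs : s = v <;> by_cases ht : t = v <;>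
  simp [hs, ht] <;> ring

theorem rename_swap_mcAt (v : Fin 6) :
    rename (BiEdge.map (Equiv.swap v 5)) (mcAt K v) = -mcAt K v := by
  simp only [mcAt, map_sum, map_sub, rename_X, BiEdge.map, Equiv.swap_apply_left,
    Equiv.swap_apply_right, ← Finset.sum_neg_distrib, neg_sub]

theorem mcAt_eq (v : Fin 6) : mcAt K v = ∑ l : Letter, l.sgn K • E K v 5 l := by
  simp only [mcAt, Fintype.sum_prod_type, Fintype.sum_bool, Letter.sgn, E, edge, if_true, one_smul,
    neg_smul, Bool.false_eq_true, if_false, Bool.not_true, Bool.not_false]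
  ring

theorem mcAt_eq_rev (v : Fin 6) : mcAt K v = -∑ l : Letter, l.sgn K • E K 5 v l := by
  simp only [mcAt, Fintype.sum_prod_type, Fintype.sum_bool, Letter.sgn, E, edge, if_true, one_smul,
    neg_smul, Bool.false_eq_true, if_false, Bool.not_true, Bool.not_false]
  ring

theorem alt_prodE (ρ : Equiv.Perm (Fin 6)) (L : List (Fin 6 × Fin 6 × Letter)) :
    alt (p := 5) (prodE K (mapV ρ L)) =
      ((Equiv.Perm.sign ρ : ℤˣ) : ℤ) • alt (p := 5) (prodE K L) := by
  rw [← alt_perm (p := 5)]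
  exact congrArg (alt (p := 5)) (rename_prodE _ _).symm

theorem alt_mul_mcAt {N : Gra K 5} {L : Letter → List (Fin 6 × Fin 6 × Letter)} (v : Fin 6)
    (ρ : Equiv.Perm (Fin 6)) (s : ℤ) (hs : ((Equiv.Perm.sign ρ : ℤˣ) : ℤ) = s)
    (h : ∀ l, N * E K v 5 l = prodE K (mapV ρ (L l))) :
    alt (p := 5) (N * mcAt K v) = ∑ l : Letter, l.sgn K • (s • alt (p := 5) (prodE K (L l))) := by
  rw [mcAt_eq, Finset.mul_sum, map_sum]
  refine Finset.sum_congr rfl fun l _ => ?_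
  rw [mul_smul_comm, h, map_smul, alt_prodE, hs]

theorem alt_mul_mcAt_rev {N : Gra K 5} {L : Letter → List (Fin 6 × Fin 6 × Letter)} (v : Fin 6)
    (ρ : Equiv.Perm (Fin 6)) (s : ℤ) (hs : ((Equiv.Perm.sign ρ : ℤˣ) : ℤ) = -s)
    (h : ∀ l, N * E K 5 v l = prodE K (mapV ρ (L l))) :
    alt (p := 5) (N * mcAt K v) = ∑ l : Letter, l.sgn K • (s • alt (p := 5) (prodE K (L l))) := by
  rw [mcAt_eq_rev, mul_neg, Finset.mul_sum, map_neg, map_sum, ← Finset.sum_neg_distrib]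
  refine Finset.sum_congr rfl fun l _ => ?_
  rw [mul_smul_comm, h, map_smul, alt_prodE, hs, neg_smul, smul_neg, neg_neg]

set_option maxHeartbeats 1000000 in
theorem circ_alt_theta123 (x w1 w2 z1 z2 z3 : Letter) :
    Gra.circ (alt (p := 4) (prodE K (theta123 x w1 w2 z1 z2 z3))) (mc K) -
      Gra.circ (mc K) (alt (p := 4) (prodE K (theta123 x w1 w2 z1 z2 z3))) =
    ∑ l : Letter, l.sgn K • (-alt (p := 5) (prodE K (theta223 l x w1 w2 z1 z2 z3))
      - alt (p := 5) (prodE K (theta133 x l w1 w2 z1 z2 z3))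
      + alt (p := 5) (prodE K (theta124 x w1 w2 l z1 z2 z3))
      + alt (p := 5) (prodE K (theta223 x l w1 w2 z1 z2 z3))
      - alt (p := 5) (prodE K (theta133 x w1 w2 l z1 z2 z3))
      - alt (p := 5) (prodE K (theta124 x w1 w2 z1 z2 z3 l))
      + alt (p := 5) (prodE K (theta133 x w1 l w2 z1 z2 z3))
      - alt (p := 5) (prodE K (theta124 x w1 w2 z1 l z2 z3))
      + alt (p := 5) (prodE K (theta124 x w1 w2 z1 z2 l z3))) := by
  -- Modulo exchanging the new vertex with the old one, a trivalent vertex splits off one of its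
  -- three half edges, and a bivalent one splits in a single way.
  have hZ : ∀ v, split v (prodE K (theta123 x w1 w2 z1 z2 z3)) =
      (hair v (prodE K (theta123 x w1 w2 z1 z2 z3)) + ![
      E K 5 1 x * E K 0 2 w1 * E K 2 1 w2 * E K 0 3 z1 * E K 3 4 z2 * E K 4 1 z3 * mcAt K 0 +
      E K 0 1 x * E K 5 2 w1 * E K 2 1 w2 * E K 0 3 z1 * E K 3 4 z2 * E K 4 1 z3 * mcAt K 0 +
      E K 0 1 x * E K 0 2 w1 * E K 2 1 w2 * E K 5 3 z1 * E K 3 4 z2 * E K 4 1 z3 * mcAt K 0,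
      E K 0 5 x * E K 0 2 w1 * E K 2 1 w2 * E K 0 3 z1 * E K 3 4 z2 * E K 4 1 z3 * mcAt K 1 +
      E K 0 1 x * E K 0 2 w1 * E K 2 5 w2 * E K 0 3 z1 * E K 3 4 z2 * E K 4 1 z3 * mcAt K 1 +
      E K 0 1 x * E K 0 2 w1 * E K 2 1 w2 * E K 0 3 z1 * E K 3 4 z2 * E K 4 5 z3 * mcAt K 1,
      E K 0 1 x * E K 0 2 w1 * E K 5 1 w2 * E K 0 3 z1 * E K 3 4 z2 * E K 4 1 z3 * mcAt K 2,
      E K 0 1 x * E K 0 2 w1 * E K 2 1 w2 * E K 0 3 z1 * E K 5 4 z2 * E K 4 1 z3 * mcAt K 3,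
      E K 0 1 x * E K 0 2 w1 * E K 2 1 w2 * E K 0 3 z1 * E K 3 4 z2 * E K 5 1 z3 * mcAt K 4] v) -
          Gra.perm (p := 5) (Equiv.swap v.castSucc 5)
        (hair v (prodE K (theta123 x w1 w2 z1 z2 z3)) + ![
      E K 5 1 x * E K 0 2 w1 * E K 2 1 w2 * E K 0 3 z1 * E K 3 4 z2 * E K 4 1 z3 * mcAt K 0 +
      E K 0 1 x * E K 5 2 w1 * E K 2 1 w2 * E K 0 3 z1 * E K 3 4 z2 * E K 4 1 z3 * mcAt K 0 +
      E K 0 1 x * E K 0 2 w1 * E K 2 1 w2 * E K 5 3 z1 * E K 3 4 z2 * E K 4 1 z3 * mcAt K 0,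
      E K 0 5 x * E K 0 2 w1 * E K 2 1 w2 * E K 0 3 z1 * E K 3 4 z2 * E K 4 1 z3 * mcAt K 1 +
      E K 0 1 x * E K 0 2 w1 * E K 2 5 w2 * E K 0 3 z1 * E K 3 4 z2 * E K 4 1 z3 * mcAt K 1 +
      E K 0 1 x * E K 0 2 w1 * E K 2 1 w2 * E K 0 3 z1 * E K 3 4 z2 * E K 4 5 z3 * mcAt K 1,
      E K 0 1 x * E K 0 2 w1 * E K 5 1 w2 * E K 0 3 z1 * E K 3 4 z2 * E K 4 1 z3 * mcAt K 2,
      E K 0 1 x * E K 0 2 w1 * E K 2 1 w2 * E K 0 3 z1 * E K 5 4 z2 * E K 4 1 z3 * mcAt K 3,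
      E K 0 1 x * E K 0 2 w1 * E K 2 1 w2 * E K 0 3 z1 * E K 3 4 z2 * E K 5 1 z3 * mcAt K 4] v) :=
          by
    intro v
    fin_cases v <;>
    simp [-aeval_eq_bind₁, split, hair, prodE, theta123, aeval_lift_E, Gra.perm, rename_E,
        rename_swap_mcAt,
      Equiv.swap_apply_def, Fin.ext_iff, -mul_eq_mul_left_iff, -mul_eq_mul_right_iff] <;>
    ring
  rw [circ_alt_sub _ _ hZ, Fin.sum_univ_five]
  have h0 : alt (p := 5) (E K 5 1 x * E K 0 2 w1 * E K 2 1 w2 *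
      E K 0 3 z1 * E K 3 4 z2 * E K 4 1 z3 * mcAt K 0) =
      ∑ l : Letter, l.sgn K • ((-1 : ℤ) • alt (p := 5) (prodE K
          (theta223 l x w1 w2 z1 z2 z3))) := by
    rw [alt_mul_mcAt (L := fun l => theta223 l x w1 w2 z1 z2 z3) 0
        ⟨![0, 1, 5, 2, 3, 4], ![0, 1, 3, 4, 5, 2], by decide, by decide⟩
      (-1) (by decide +kernel) fun l => by
        simp [prodE, mapV, theta223, -mul_eq_mul_left_iff, -mul_eq_mul_right_iff]
        ring]
  have h1 : alt (p := 5) (E K 0 1 x * E K 5 2 w1 * E K 2 1 w2 *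
      E K 0 3 z1 * E K 3 4 z2 * E K 4 1 z3 * mcAt K 0) =
      ∑ l : Letter, l.sgn K • ((-1 : ℤ) • alt (p := 5) (prodE K
          (theta133 x l w1 w2 z1 z2 z3))) := by
    rw [alt_mul_mcAt (L := fun l => theta133 x l w1 w2 z1 z2 z3) 0
        ⟨![0, 1, 5, 2, 3, 4], ![0, 1, 3, 4, 5, 2], by decide, by decide⟩
      (-1) (by decide +kernel) fun l => by
        simp [prodE, mapV, theta133, -mul_eq_mul_left_iff, -mul_eq_mul_right_iff]
        ring]
  have h2 : alt (p := 5) (E K 0 1 x * E K 0 2 w1 * E K 2 1 w2 *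
      E K 5 3 z1 * E K 3 4 z2 * E K 4 1 z3 * mcAt K 0) =
      ∑ l : Letter, l.sgn K • ((1 : ℤ) • alt (p := 5) (prodE K (theta124 x w1 w2 l z1 z2 z3))) := by
    rw [alt_mul_mcAt (L := fun l => theta124 x w1 w2 l z1 z2 z3) 0
        ⟨![0, 1, 2, 5, 3, 4], ![0, 1, 2, 4, 5, 3], by decide, by decide⟩
      (1) (by decide +kernel) fun l => by
        simp [prodE, mapV, theta124, -mul_eq_mul_left_iff, -mul_eq_mul_right_iff]
        ring]
  have h3 : alt (p := 5) (E K 0 5 x * E K 0 2 w1 * E K 2 1 w2 *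
      E K 0 3 z1 * E K 3 4 z2 * E K 4 1 z3 * mcAt K 1) =
      ∑ l : Letter, l.sgn K • ((1 : ℤ) • alt (p := 5) (prodE K (theta223 x l w1 w2 z1 z2 z3))) := by
    rw [alt_mul_mcAt_rev (L := fun l =>
        theta223 x l w1 w2 z1 z2 z3) 1 ⟨![0, 1, 5, 2, 3, 4], ![0, 1, 3, 4, 5, 2], by decide,
        by decide⟩
      (1) (by decide +kernel) fun l => by
        simp [prodE, mapV, theta223, -mul_eq_mul_left_iff, -mul_eq_mul_right_iff]
        ring]
  have h4 : alt (p := 5) (E K 0 1 x * E K 0 2 w1 * E K 2 5 w2 *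
      E K 0 3 z1 * E K 3 4 z2 * E K 4 1 z3 * mcAt K 1) =
      ∑ l : Letter, l.sgn K • ((-1 : ℤ) • alt (p := 5) (prodE K
          (theta133 x w1 w2 l z1 z2 z3))) := by
    rw [alt_mul_mcAt_rev (L := fun l =>
        theta133 x w1 w2 l z1 z2 z3) 1 ⟨![0, 1, 2, 5, 3, 4], ![0, 1, 2, 4, 5, 3], by decide,
        by decide⟩
      (-1) (by decide +kernel) fun l => by
        simp [prodE, mapV, theta133, -mul_eq_mul_left_iff, -mul_eq_mul_right_iff]
        ring]
  have h5 : alt (p := 5) (E K 0 1 x * E K 0 2 w1 * E K 2 1 w2 *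
      E K 0 3 z1 * E K 3 4 z2 * E K 4 5 z3 * mcAt K 1) =
      ∑ l : Letter, l.sgn K • ((-1 : ℤ) • alt (p := 5) (prodE K
          (theta124 x w1 w2 z1 z2 z3 l))) := by
    rw [alt_mul_mcAt_rev (L := fun l =>
        theta124 x w1 w2 z1 z2 z3 l) 1 ⟨![0, 1, 2, 3, 4, 5], ![0, 1, 2, 3, 4, 5], by decide,
        by decide⟩
      (-1) (by decide +kernel) fun l => by
        simp [prodE, mapV, theta124, -mul_eq_mul_left_iff, -mul_eq_mul_right_iff]
        ring]
  have h6 : alt (p := 5) (E K 0 1 x * E K 0 2 w1 * E K 5 1 w2 *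
      E K 0 3 z1 * E K 3 4 z2 * E K 4 1 z3 * mcAt K 2) =
      ∑ l : Letter, l.sgn K • ((1 : ℤ) • alt (p := 5) (prodE K (theta133 x w1 l w2 z1 z2 z3))) := by
    rw [alt_mul_mcAt (L := fun l => theta133 x w1 l w2 z1 z2 z3) 2
        ⟨![0, 1, 2, 5, 3, 4], ![0, 1, 2, 4, 5, 3], by decide, by decide⟩
      (1) (by decide +kernel) fun l => by
        simp [prodE, mapV, theta133, -mul_eq_mul_left_iff, -mul_eq_mul_right_iff]
        ring]
  have h7 : alt (p := 5) (E K 0 1 x * E K 0 2 w1 * E K 2 1 w2 *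
      E K 0 3 z1 * E K 5 4 z2 * E K 4 1 z3 * mcAt K 3) =
      ∑ l : Letter, l.sgn K • ((-1 : ℤ) • alt (p := 5) (prodE K
          (theta124 x w1 w2 z1 l z2 z3))) := by
    rw [alt_mul_mcAt (L := fun l => theta124 x w1 w2 z1 l z2 z3) 3
        ⟨![0, 1, 2, 3, 5, 4], ![0, 1, 2, 3, 5, 4], by decide, by decide⟩
      (-1) (by decide +kernel) fun l => by
        simp [prodE, mapV, theta124, -mul_eq_mul_left_iff, -mul_eq_mul_right_iff]
        ring]
  have h8 : alt (p := 5) (E K 0 1 x * E K 0 2 w1 * E K 2 1 w2 *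
      E K 0 3 z1 * E K 3 4 z2 * E K 5 1 z3 * mcAt K 4) =
      ∑ l : Letter, l.sgn K • ((1 : ℤ) • alt (p := 5) (prodE K (theta124 x w1 w2 z1 z2 l z3))) := by
    rw [alt_mul_mcAt (L := fun l => theta124 x w1 w2 z1 z2 l z3) 4
        ⟨![0, 1, 2, 3, 4, 5], ![0, 1, 2, 3, 4, 5], by decide, by decide⟩
      (1) (by decide +kernel) fun l => by
        simp [prodE, mapV, theta124, -mul_eq_mul_left_iff, -mul_eq_mul_right_iff]
        ring]
  simp only [Matrix.cons_val, map_add, h0, h1, h2, h3, h4, h5, h6, h7, h8, neg_smul, one_smul,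
      smul_add, smul_neg,
    smul_sub, Finset.sum_add_distrib, Finset.sum_sub_distrib, Finset.sum_neg_distrib]
  abel

set_option maxHeartbeats 1000000 in
theorem circ_alt_theta222 (v1 v2 w1 w2 z1 z2 : Letter) :
    Gra.circ (alt (p := 4) (prodE K (theta222 v1 v2 w1 w2 z1 z2))) (mc K) -
      Gra.circ (mc K) (alt (p := 4) (prodE K (theta222 v1 v2 w1 w2 z1 z2))) =
    ∑ l : Letter, l.sgn K • (-alt (p := 5) (prodE K (theta223 w1 w2 z1 z2 l v1 v2))
      + alt (p := 5) (prodE K (theta223 v1 v2 z1 z2 l w1 w2))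
      - alt (p := 5) (prodE K (theta223 v1 v2 w1 w2 l z1 z2))
      - alt (p := 5) (prodE K (theta223 w1 w2 z1 z2 v1 v2 l))
      + alt (p := 5) (prodE K (theta223 v1 v2 z1 z2 w1 w2 l))
      - alt (p := 5) (prodE K (theta223 v1 v2 w1 w2 z1 z2 l))
      + alt (p := 5) (prodE K (theta223 w1 w2 z1 z2 v1 l v2))
      - alt (p := 5) (prodE K (theta223 v1 v2 z1 z2 w1 l w2))
      + alt (p := 5) (prodE K (theta223 v1 v2 w1 w2 z1 l z2))) := by
  have hZ : ∀ v, split v (prodE K (theta222 v1 v2 w1 w2 z1 z2)) =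
      (hair v (prodE K (theta222 v1 v2 w1 w2 z1 z2)) + ![
      E K 5 2 v1 * E K 2 1 v2 * E K 0 3 w1 * E K 3 1 w2 * E K 0 4 z1 * E K 4 1 z2 * mcAt K 0 +
      E K 0 2 v1 * E K 2 1 v2 * E K 5 3 w1 * E K 3 1 w2 * E K 0 4 z1 * E K 4 1 z2 * mcAt K 0 +
      E K 0 2 v1 * E K 2 1 v2 * E K 0 3 w1 * E K 3 1 w2 * E K 5 4 z1 * E K 4 1 z2 * mcAt K 0,
      E K 0 2 v1 * E K 2 5 v2 * E K 0 3 w1 * E K 3 1 w2 * E K 0 4 z1 * E K 4 1 z2 * mcAt K 1 +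
      E K 0 2 v1 * E K 2 1 v2 * E K 0 3 w1 * E K 3 5 w2 * E K 0 4 z1 * E K 4 1 z2 * mcAt K 1 +
      E K 0 2 v1 * E K 2 1 v2 * E K 0 3 w1 * E K 3 1 w2 * E K 0 4 z1 * E K 4 5 z2 * mcAt K 1,
      E K 0 2 v1 * E K 5 1 v2 * E K 0 3 w1 * E K 3 1 w2 * E K 0 4 z1 * E K 4 1 z2 * mcAt K 2,
      E K 0 2 v1 * E K 2 1 v2 * E K 0 3 w1 * E K 5 1 w2 * E K 0 4 z1 * E K 4 1 z2 * mcAt K 3,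
      E K 0 2 v1 * E K 2 1 v2 * E K 0 3 w1 * E K 3 1 w2 * E K 0 4 z1 * E K 5 1 z2 * mcAt K 4] v) -
          Gra.perm (p := 5) (Equiv.swap v.castSucc 5)
        (hair v (prodE K (theta222 v1 v2 w1 w2 z1 z2)) + ![
      E K 5 2 v1 * E K 2 1 v2 * E K 0 3 w1 * E K 3 1 w2 * E K 0 4 z1 * E K 4 1 z2 * mcAt K 0 +
      E K 0 2 v1 * E K 2 1 v2 * E K 5 3 w1 * E K 3 1 w2 * E K 0 4 z1 * E K 4 1 z2 * mcAt K 0 +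
      E K 0 2 v1 * E K 2 1 v2 * E K 0 3 w1 * E K 3 1 w2 * E K 5 4 z1 * E K 4 1 z2 * mcAt K 0,
      E K 0 2 v1 * E K 2 5 v2 * E K 0 3 w1 * E K 3 1 w2 * E K 0 4 z1 * E K 4 1 z2 * mcAt K 1 +
      E K 0 2 v1 * E K 2 1 v2 * E K 0 3 w1 * E K 3 5 w2 * E K 0 4 z1 * E K 4 1 z2 * mcAt K 1 +
      E K 0 2 v1 * E K 2 1 v2 * E K 0 3 w1 * E K 3 1 w2 * E K 0 4 z1 * E K 4 5 z2 * mcAt K 1,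
      E K 0 2 v1 * E K 5 1 v2 * E K 0 3 w1 * E K 3 1 w2 * E K 0 4 z1 * E K 4 1 z2 * mcAt K 2,
      E K 0 2 v1 * E K 2 1 v2 * E K 0 3 w1 * E K 5 1 w2 * E K 0 4 z1 * E K 4 1 z2 * mcAt K 3,
      E K 0 2 v1 * E K 2 1 v2 * E K 0 3 w1 * E K 3 1 w2 * E K 0 4 z1 * E K 5 1 z2 * mcAt K 4] v)
          := by
    intro v
    fin_cases v <;>
    simp [-aeval_eq_bind₁, split, hair, prodE, theta222, aeval_lift_E, Gra.perm, rename_E,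
        rename_swap_mcAt,
      Equiv.swap_apply_def, Fin.ext_iff, -mul_eq_mul_left_iff, -mul_eq_mul_right_iff] <;>
    ring
  rw [circ_alt_sub _ _ hZ, Fin.sum_univ_five]
  have h0 : alt (p := 5) (E K 5 2 v1 * E K 2 1 v2 * E K 0 3 w1 *
      E K 3 1 w2 * E K 0 4 z1 * E K 4 1 z2 * mcAt K 0) =
      ∑ l : Letter, l.sgn K • ((-1 : ℤ) • alt (p := 5) (prodE K
          (theta223 w1 w2 z1 z2 l v1 v2))) := by
    rw [alt_mul_mcAt (L := fun l => theta223 w1 w2 z1 z2 l v1 v2) 0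
        ⟨![0, 1, 3, 4, 5, 2], ![0, 1, 5, 2, 3, 4], by decide, by decide⟩
      (-1) (by decide +kernel) fun l => by
        simp [prodE, mapV, theta223, -mul_eq_mul_left_iff, -mul_eq_mul_right_iff]
        ring]
  have h1 : alt (p := 5) (E K 0 2 v1 * E K 2 1 v2 * E K 5 3 w1 *
      E K 3 1 w2 * E K 0 4 z1 * E K 4 1 z2 * mcAt K 0) =
      ∑ l : Letter, l.sgn K • ((1 : ℤ) • alt (p := 5) (prodE K
          (theta223 v1 v2 z1 z2 l w1 w2))) := by
    rw [alt_mul_mcAt (L := fun l => theta223 v1 v2 z1 z2 l w1 w2) 0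
        ⟨![0, 1, 2, 4, 5, 3], ![0, 1, 2, 5, 3, 4], by decide, by decide⟩
      (1) (by decide +kernel) fun l => by
        simp [prodE, mapV, theta223, -mul_eq_mul_left_iff, -mul_eq_mul_right_iff]
        ring]
  have h2 : alt (p := 5) (E K 0 2 v1 * E K 2 1 v2 * E K 0 3 w1 *
      E K 3 1 w2 * E K 5 4 z1 * E K 4 1 z2 * mcAt K 0) =
      ∑ l : Letter, l.sgn K • ((-1 : ℤ) • alt (p := 5) (prodE K
          (theta223 v1 v2 w1 w2 l z1 z2))) := by
    rw [alt_mul_mcAt (L := fun l => theta223 v1 v2 w1 w2 l z1 z2) 0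
        ⟨![0, 1, 2, 3, 5, 4], ![0, 1, 2, 3, 5, 4], by decide, by decide⟩
      (-1) (by decide +kernel) fun l => by
        simp [prodE, mapV, theta223, -mul_eq_mul_left_iff, -mul_eq_mul_right_iff]
        ring]
  have h3 : alt (p := 5) (E K 0 2 v1 * E K 2 5 v2 * E K 0 3 w1 *
      E K 3 1 w2 * E K 0 4 z1 * E K 4 1 z2 * mcAt K 1) =
      ∑ l : Letter, l.sgn K • ((-1 : ℤ) • alt (p := 5) (prodE K
          (theta223 w1 w2 z1 z2 v1 v2 l))) := by
    rw [alt_mul_mcAt_rev (L := fun l =>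
        theta223 w1 w2 z1 z2 v1 v2 l) 1
        ⟨![0, 1, 3, 4, 2, 5], ![0, 1, 4, 2, 3, 5], by decide, by decide⟩
      (-1) (by decide +kernel) fun l => by
        simp [prodE, mapV, theta223, -mul_eq_mul_left_iff, -mul_eq_mul_right_iff]
        ring]
  have h4 : alt (p := 5) (E K 0 2 v1 * E K 2 1 v2 * E K 0 3 w1 *
      E K 3 5 w2 * E K 0 4 z1 * E K 4 1 z2 * mcAt K 1) =
      ∑ l : Letter, l.sgn K • ((1 : ℤ) • alt (p := 5) (prodE K
          (theta223 v1 v2 z1 z2 w1 w2 l))) := by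
    rw [alt_mul_mcAt_rev (L := fun l =>
        theta223 v1 v2 z1 z2 w1 w2 l) 1
        ⟨![0, 1, 2, 4, 3, 5], ![0, 1, 2, 4, 3, 5], by decide, by decide⟩
      (1) (by decide +kernel) fun l => by
        simp [prodE, mapV, theta223, -mul_eq_mul_left_iff, -mul_eq_mul_right_iff]
        ring]
  have h5 : alt (p := 5) (E K 0 2 v1 * E K 2 1 v2 * E K 0 3 w1 *
      E K 3 1 w2 * E K 0 4 z1 * E K 4 5 z2 * mcAt K 1) =
      ∑ l : Letter, l.sgn K • ((-1 : ℤ) • alt (p := 5) (prodE K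
          (theta223 v1 v2 w1 w2 z1 z2 l))) := by
    rw [alt_mul_mcAt_rev (L := fun l =>
        theta223 v1 v2 w1 w2 z1 z2 l) 1
        ⟨![0, 1, 2, 3, 4, 5], ![0, 1, 2, 3, 4, 5], by decide, by decide⟩
      (-1) (by decide +kernel) fun l => by
        simp [prodE, mapV, theta223, -mul_eq_mul_left_iff, -mul_eq_mul_right_iff]
        ring]
  have h6 : alt (p := 5) (E K 0 2 v1 * E K 5 1 v2 * E K 0 3 w1 *
      E K 3 1 w2 * E K 0 4 z1 * E K 4 1 z2 * mcAt K 2) =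
      ∑ l : Letter, l.sgn K • ((1 : ℤ) • alt (p := 5) (prodE K
          (theta223 w1 w2 z1 z2 v1 l v2))) := by
    rw [alt_mul_mcAt (L := fun l => theta223 w1 w2 z1 z2 v1 l v2) 2
        ⟨![0, 1, 3, 4, 2, 5], ![0, 1, 4, 2, 3, 5], by decide, by decide⟩
      (1) (by decide +kernel) fun l => by
        simp [prodE, mapV, theta223, -mul_eq_mul_left_iff, -mul_eq_mul_right_iff]
        ring]
  have h7 : alt (p := 5) (E K 0 2 v1 * E K 2 1 v2 * E K 0 3 w1 *
      E K 5 1 w2 * E K 0 4 z1 * E K 4 1 z2 * mcAt K 3) =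
      ∑ l : Letter, l.sgn K • ((-1 : ℤ) • alt (p := 5) (prodE K
          (theta223 v1 v2 z1 z2 w1 l w2))) := by
    rw [alt_mul_mcAt (L := fun l => theta223 v1 v2 z1 z2 w1 l w2) 3
        ⟨![0, 1, 2, 4, 3, 5], ![0, 1, 2, 4, 3, 5], by decide, by decide⟩
      (-1) (by decide +kernel) fun l => by
        simp [prodE, mapV, theta223, -mul_eq_mul_left_iff, -mul_eq_mul_right_iff]
        ring]
  have h8 : alt (p := 5) (E K 0 2 v1 * E K 2 1 v2 * E K 0 3 w1 *
      E K 3 1 w2 * E K 0 4 z1 * E K 5 1 z2 * mcAt K 4) =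
      ∑ l : Letter, l.sgn K • ((1 : ℤ) • alt (p := 5) (prodE K
          (theta223 v1 v2 w1 w2 z1 l z2))) := by
    rw [alt_mul_mcAt (L := fun l => theta223 v1 v2 w1 w2 z1 l z2) 4
        ⟨![0, 1, 2, 3, 4, 5], ![0, 1, 2, 3, 4, 5], by decide, by decide⟩
      (1) (by decide +kernel) fun l => by
        simp [prodE, mapV, theta223, -mul_eq_mul_left_iff, -mul_eq_mul_right_iff]
        ring]
  simp only [Matrix.cons_val, map_add, h0, h1, h2, h3, h4, h5, h6, h7, h8, neg_smul, one_smul,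
      smul_add, smul_neg,
    smul_sub, Finset.sum_add_distrib, Finset.sum_sub_distrib, Finset.sum_neg_distrib]
  abel

end BiGC

end

/-! ### The word calculus of the explicit cocycle -/

noncomputable section

namespace BiGC

open MvPolynomial

variable {K : Type*} [Field K]

/-! ### Signed insertions into words -/

/-- The sign of the direction of the black arrow, as an integer. -/
def Letter.sign (l : Letter) : ℤ := if l.1 then 1 else -1

theorem Letter.sgn_smul {M : Type*} [AddCommGroup M] [Module K M] (l : Letter) (m : M) :
    l.sgn K • m = l.sign • m := by
  rcases l with ⟨_ | _, _⟩ <;> simp [Letter.sgn, Letter.sign]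

/-- The signed insertion of a letter into words of length 1. -/
def ins1 (α : Letter → ℤ) (y : Letter × Letter) : ℤ := -(y.1.sign * α y.2) + y.2.sign * α y.1

/-- The signed insertion of a letter into words of length 2. -/
def ins2 (α : Letter × Letter → ℤ) (y : Letter × Letter × Letter) : ℤ :=
  -(y.1.sign * α (y.2.1, y.2.2)) + y.2.1.sign * α (y.1, y.2.2) - y.2.2.sign * α (y.1, y.2.1)

/-- The signed insertion of a letter into words of length 3. -/
def ins3 (α : Letter × Letter × Letter → ℤ) (y : Letter × Letter × Letter × Letter) : ℤ :=
  y.1.sign * α (y.2.1, y.2.2.1, y.2.2.2) - y.2.1.sign * α (y.1, y.2.2.1, y.2.2.2) +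
    y.2.2.1.sign * α (y.1, y.2.1, y.2.2.2) - y.2.2.2.sign * α (y.1, y.2.1, y.2.2.1)

/-- Transposes insertion: inserting a letter into the words of a combination becomes deletion in its
coefficients. The equivalence `e` says where the letter goes. -/
theorem sum_insert {M W Y : Type*} [AddCommGroup M] [Fintype W] [Fintype Y] (e : W × Letter ≃ Y)
    (c : W → ℤ) (B : Y → M) : ∑ w, c w • ∑ l : Letter, l.sign • B (e (w, l)) =
      ∑ y, ((e.symm y).2.sign * c (e.symm y).1) • B y := by
  simp only [Finset.smul_sum, smul_smul]
  rw [← Fintype.sum_prod_type' fun w (l : Letter) => (c w * l.sign) • B (e (w, l))]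
  refine Fintype.sum_equiv e _ _ fun x => ?_
  rw [Equiv.symm_apply_apply, mul_comm]

/-- The letters with a backward red arrow. -/
def backward (x : Letter) : ℤ := if x.2 then 0 else x.sign

/-- The alternating words in the two letters with a forward red arrow. -/
def forwardWord (w : Letter × Letter) : ℤ :=
  if w.1.2 = true ∧ w.2.2 = true then
    (if w.1.1 then 1 else 0) * (if w.2.1 then 0 else 1) -
      (if w.1.1 then 0 else 1) * (if w.2.1 then 1 else 0) else 0

/-- The alternating words in the two letters with a backward red arrow. -/
def backwardWord (w : Letter × Letter) : ℤ :=
  if w.1.2 = false ∧ w.2.2 = false then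
    (if w.1.1 then 1 else 0) * (if w.2.1 then 0 else 1) -
      (if w.1.1 then 0 else 1) * (if w.2.1 then 1 else 0) else 0

/-- Instances of d² = 0: two insertions in either order carry opposite signs. -/
theorem ins2_ins1_backward : ∀ y, ins2 (ins1 backward) y = 0 := by decide +kernel

theorem ins3_ins2_backwardWord : ∀ y, ins3 (ins2 backwardWord) y = 0 := by decide +kernel

theorem ins1_backward_rev : ∀ v : Letter × Letter,
    ins1 backward (v.2.rev, v.1.rev) = ins1 backward v := by
  decide +kernel

theorem backwardWord_rev : ∀ w : Letter × Letter,
    backwardWord (w.2.rev, w.1.rev) = forwardWord w := by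
  decide +kernel

theorem ins2_forwardWord_rev : ∀ y : Letter × Letter × Letter,
    ins2 forwardWord (y.2.2.rev, y.2.1.rev, y.1.rev) = -ins2 backwardWord y := by
  decide +kernel

/-! ### The cocycle -/

theorem Letter.rev_rev (l : Letter) : l.rev.rev = l := by simp [Letter.rev]

/-- The reversal of theta graphs with arms of lengths 2, 2, 3. -/
def reverse : (Letter × Letter) × (Letter × Letter) × (Letter × Letter × Letter) ≃
    (Letter × Letter) × (Letter × Letter) × (Letter × Letter × Letter) where
  toFun y := ((y.1.2.rev, y.1.1.rev), (y.2.1.2.rev, y.2.1.1.rev),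
    (y.2.2.2.2.rev, y.2.2.2.1.rev, y.2.2.1.rev))
  invFun y := ((y.1.2.rev, y.1.1.rev), (y.2.1.2.rev, y.2.1.1.rev),
    (y.2.2.2.2.rev, y.2.2.2.1.rev, y.2.2.1.rev))
  left_inv y := by simp [Letter.rev_rev]
  right_inv y := by simp [Letter.rev_rev]

section Combination

variable {M : Type*} [AddCommGroup M]

/-- A combination of theta graphs with arms of lengths 1, 2, 3. -/
def comb123 (T : Letter → Letter × Letter → Letter × Letter × Letter → M) : M :=
  ∑ p : Letter × (Letter × Letter) × (Letter × Letter × Letter),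
    (backward p.1 * forwardWord p.2.1 * ins2 backwardWord p.2.2) • T p.1 p.2.1 p.2.2

/-- A combination of theta graphs with arms of lengths 2, 2, 2. -/
def comb222 (T : Letter × Letter → Letter × Letter → Letter × Letter → M) : M :=
  ∑ p : (Letter × Letter) × (Letter × Letter) × (Letter × Letter),
    (ins1 backward p.1 * forwardWord p.2.1 * backwardWord p.2.2) • T p.1 p.2.1 p.2.2

/-- A combination of theta graphs with arms of lengths 1, 3, 3. -/
def comb133 (T : Letter → Letter × Letter × Letter → Letter × Letter × Letter → M) : M :=
  ∑ p : Letter × (Letter × Letter × Letter) × (Letter × Letter × Letter),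
    (backward p.1 * ins2 forwardWord p.2.1 * ins2 backwardWord p.2.2) • T p.1 p.2.1 p.2.2

/-- A combination of theta graphs with arms of lengths 2, 2, 3. -/
def comb223 (T : Letter × Letter → Letter × Letter → Letter × Letter × Letter → M) : M :=
  ∑ p : (Letter × Letter) × (Letter × Letter) × (Letter × Letter × Letter),
    (ins1 backward p.1 * forwardWord p.2.1 * ins2 backwardWord p.2.2) • T p.1 p.2.1 p.2.2

/-- Leibniz rule for (α|β|dγ). Insertion into the last arm gives d²γ = 0, which removes the graphs
with arms 1, 2, 4. -/
theorem comb123_eq {T : Letter → Letter × Letter → Letter × Letter × Letter → M}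
    (B223 : Letter × Letter → Letter × Letter → Letter × Letter × Letter → M)
    (B133 : Letter → Letter × Letter × Letter → Letter × Letter × Letter → M)
    (B124 : Letter → Letter × Letter → Letter × Letter × Letter × Letter → M)
    (hT : ∀ x w z, T x w z = ∑ l : Letter, l.sign • (-B223 (l, x) w z + B223 (x, l) w z) +
      ∑ l : Letter, l.sign • (-B133 x (l, w.1, w.2) z + B133 x (w.1, l, w.2) z -
        B133 x (w.1, w.2, l) z) +
      ∑ l : Letter, l.sign • (B124 x w (l, z.1, z.2.1, z.2.2) - B124 x w (z.1, l, z.2.1, z.2.2) +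
        B124 x w (z.1, z.2.1, l, z.2.2) - B124 x w (z.1, z.2.1, z.2.2, l))) :
    comb123 T = comb223 B223 + comb133 B133 := by
  have h1 : ∑ p : Letter × (Letter × Letter) × (Letter × Letter × Letter),
      (backward p.1 * forwardWord p.2.1 * ins2 backwardWord p.2.2) •
      ∑ l : Letter, l.sign • (-B223 (l, p.1) p.2.1 p.2.2 + B223 (p.1, l) p.2.1 p.2.2) =
      comb223 B223 := by
    have a0 := sum_insert
      (⟨fun p => ((p.2, p.1.1), p.1.2.1, p.1.2.2),
        fun y => ((y.1.2, y.2.1, y.2.2), y.1.1),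
        fun _ => rfl, fun _ => rfl⟩)
      (fun p : Letter × (Letter × Letter) × (Letter × Letter × Letter) =>
        backward p.1 * forwardWord p.2.1 * ins2 backwardWord p.2.2)
      fun y : (Letter × Letter) × (Letter × Letter) × (Letter × Letter × Letter) =>
          B223 y.1 y.2.1 y.2.2
    have a1 := sum_insert
      (⟨fun p => ((p.1.1, p.2), p.1.2.1, p.1.2.2),
        fun y => ((y.1.1, y.2.1, y.2.2), y.1.2),
        fun _ => rfl, fun _ => rfl⟩)
      (fun p : Letter × (Letter × Letter) × (Letter × Letter × Letter) =>
        backward p.1 * forwardWord p.2.1 * ins2 backwardWord p.2.2)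
      fun y : (Letter × Letter) × (Letter × Letter) × (Letter × Letter × Letter) =>
          B223 y.1 y.2.1 y.2.2
    simp only [Equiv.coe_fn_mk, Equiv.coe_fn_symm_mk] at a0 a1
    simp only [smul_add, smul_neg, Finset.sum_add_distrib, Finset.sum_neg_distrib, a0, a1]
    simp only [← Finset.sum_neg_distrib, ← Finset.sum_add_distrib, ← neg_smul, ← add_smul]
    refine Finset.sum_congr rfl fun y _ => congrArg (· • _) ?_
    rw [ins1]
    ring
  have h2 : ∑ p : Letter × (Letter × Letter) × (Letter × Letter × Letter),
      (backward p.1 * forwardWord p.2.1 * ins2 backwardWord p.2.2) •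
      ∑ l : Letter, l.sign • (-B133 p.1 (l, p.2.1.1, p.2.1.2) p.2.2 +
        B133 p.1 (p.2.1.1, l, p.2.1.2) p.2.2 - B133 p.1 (p.2.1.1, p.2.1.2, l) p.2.2) =
      comb133 B133 := by
    have a0 := sum_insert
      (⟨fun p => (p.1.1, (p.2, p.1.2.1.1, p.1.2.1.2), p.1.2.2),
        fun y => ((y.1, (y.2.1.2.1, y.2.1.2.2), y.2.2), y.2.1.1),
        fun _ => rfl, fun _ => rfl⟩)
      (fun p : Letter × (Letter × Letter) × (Letter × Letter × Letter) =>
        backward p.1 * forwardWord p.2.1 * ins2 backwardWord p.2.2)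
      fun y : Letter × (Letter × Letter × Letter) × (Letter × Letter × Letter) =>
          B133 y.1 y.2.1 y.2.2
    have a1 := sum_insert
      (⟨fun p => (p.1.1, (p.1.2.1.1, p.2, p.1.2.1.2), p.1.2.2),
        fun y => ((y.1, (y.2.1.1, y.2.1.2.2), y.2.2), y.2.1.2.1),
        fun _ => rfl, fun _ => rfl⟩)
      (fun p : Letter × (Letter × Letter) × (Letter × Letter × Letter) =>
        backward p.1 * forwardWord p.2.1 * ins2 backwardWord p.2.2)
      fun y : Letter × (Letter × Letter × Letter) × (Letter × Letter × Letter) =>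
          B133 y.1 y.2.1 y.2.2
    have a2 := sum_insert
      (⟨fun p => (p.1.1, (p.1.2.1.1, p.1.2.1.2, p.2), p.1.2.2),
        fun y => ((y.1, (y.2.1.1, y.2.1.2.1), y.2.2), y.2.1.2.2),
        fun _ => rfl, fun _ => rfl⟩)
      (fun p : Letter × (Letter × Letter) × (Letter × Letter × Letter) =>
        backward p.1 * forwardWord p.2.1 * ins2 backwardWord p.2.2)
      fun y : Letter × (Letter × Letter × Letter) × (Letter × Letter × Letter) =>
          B133 y.1 y.2.1 y.2.2
    simp only [Equiv.coe_fn_mk, Equiv.coe_fn_symm_mk] at a0 a1 a2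
    simp only [smul_add, smul_sub, smul_neg, Finset.sum_add_distrib, Finset.sum_sub_distrib,
      Finset.sum_neg_distrib, a0, a1, a2]
    simp only [← Finset.sum_neg_distrib, ← Finset.sum_add_distrib, ← Finset.sum_sub_distrib,
      ← neg_smul, ← add_smul, ← sub_smul]
    refine Finset.sum_congr rfl fun y _ => congrArg (· • _) ?_
    simp only [show ∀ u : Letter × Letter × Letter, ins2 forwardWord u =
      -(u.1.sign * forwardWord (u.2.1, u.2.2)) + u.2.1.sign * forwardWord (u.1, u.2.2) -
        u.2.2.sign * forwardWord (u.1, u.2.1) from fun _ => rfl]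
    ring
  have h3 : ∑ p : Letter × (Letter × Letter) × (Letter × Letter × Letter),
      (backward p.1 * forwardWord p.2.1 * ins2 backwardWord p.2.2) •
      ∑ l : Letter, l.sign • (B124 p.1 p.2.1 (l, p.2.2.1, p.2.2.2.1, p.2.2.2.2) -
        B124 p.1 p.2.1 (p.2.2.1, l, p.2.2.2.1, p.2.2.2.2) +
        B124 p.1 p.2.1 (p.2.2.1, p.2.2.2.1, l, p.2.2.2.2) -
        B124 p.1 p.2.1 (p.2.2.1, p.2.2.2.1, p.2.2.2.2, l)) = 0 := by
    have a0 := sum_insert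
      (⟨fun p => (p.1.1, p.1.2.1, (p.2, p.1.2.2.1, p.1.2.2.2.1, p.1.2.2.2.2)),
        fun y => ((y.1, y.2.1, (y.2.2.2.1, y.2.2.2.2.1, y.2.2.2.2.2)), y.2.2.1),
        fun _ => rfl, fun _ => rfl⟩)
      (fun p : Letter × (Letter × Letter) × (Letter × Letter × Letter) =>
        backward p.1 * forwardWord p.2.1 * ins2 backwardWord p.2.2)
      fun y : Letter × (Letter × Letter) × (Letter × Letter × Letter × Letter) =>
          B124 y.1 y.2.1 y.2.2
    have a1 := sum_insert
      (⟨fun p => (p.1.1, p.1.2.1, (p.1.2.2.1, p.2, p.1.2.2.2.1, p.1.2.2.2.2)),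
        fun y => ((y.1, y.2.1, (y.2.2.1, y.2.2.2.2.1, y.2.2.2.2.2)), y.2.2.2.1),
        fun _ => rfl, fun _ => rfl⟩)
      (fun p : Letter × (Letter × Letter) × (Letter × Letter × Letter) =>
        backward p.1 * forwardWord p.2.1 * ins2 backwardWord p.2.2)
      fun y : Letter × (Letter × Letter) × (Letter × Letter × Letter × Letter) =>
          B124 y.1 y.2.1 y.2.2
    have a2 := sum_insert
      (⟨fun p => (p.1.1, p.1.2.1, (p.1.2.2.1, p.1.2.2.2.1, p.2, p.1.2.2.2.2)),
        fun y => ((y.1, y.2.1, (y.2.2.1, y.2.2.2.1, y.2.2.2.2.2)), y.2.2.2.2.1),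
        fun _ => rfl, fun _ => rfl⟩)
      (fun p : Letter × (Letter × Letter) × (Letter × Letter × Letter) =>
        backward p.1 * forwardWord p.2.1 * ins2 backwardWord p.2.2)
      fun y : Letter × (Letter × Letter) × (Letter × Letter × Letter × Letter) =>
          B124 y.1 y.2.1 y.2.2
    have a3 := sum_insert
      (⟨fun p => (p.1.1, p.1.2.1, (p.1.2.2.1, p.1.2.2.2.1, p.1.2.2.2.2, p.2)),
        fun y => ((y.1, y.2.1, (y.2.2.1, y.2.2.2.1, y.2.2.2.2.1)), y.2.2.2.2.2),
        fun _ => rfl, fun _ => rfl⟩)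
      (fun p : Letter × (Letter × Letter) × (Letter × Letter × Letter) =>
        backward p.1 * forwardWord p.2.1 * ins2 backwardWord p.2.2)
      fun y : Letter × (Letter × Letter) × (Letter × Letter × Letter × Letter) =>
          B124 y.1 y.2.1 y.2.2
    simp only [Equiv.coe_fn_mk, Equiv.coe_fn_symm_mk] at a0 a1 a2 a3
    simp only [smul_add, smul_sub, Finset.sum_add_distrib, Finset.sum_sub_distrib, a0, a1, a2, a3]
    simp only [← Finset.sum_add_distrib, ← Finset.sum_sub_distrib, ← add_smul, ← sub_smul]
    refine Finset.sum_eq_zero fun y _ => ?_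
    convert zero_smul ℤ _ using 2
    have h := ins3_ins2_backwardWord y.2.2
    rw [ins3] at h
    linear_combination backward y.1 * forwardWord y.2.1 * h
  rw [← h1, ← h2, ← add_zero (_ + _), ← h3, ← Finset.sum_add_distrib, ← Finset.sum_add_distrib,
    comb123]
  refine Finset.sum_congr rfl fun p _ => ?_
  rw [hT, smul_add, smul_add]

/-- Leibniz rule for (dα|β|γ): the first arm contributes d²α = 0, and the other two contribute the
same combination. -/
theorem comb222_eq {T : Letter × Letter → Letter × Letter → Letter × Letter → M}
    (B : Letter × Letter → Letter × Letter → Letter × Letter × Letter → M)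
    (hB : ∀ v w z, B (v.2.rev, v.1.rev) (w.2.rev, w.1.rev) (z.2.2.rev, z.2.1.rev, z.1.rev) =
      B v w z)
    (hT : ∀ v w z, T v w z =
      ∑ l : Letter, l.sign • (-B w z (l, v.1, v.2) + B w z (v.1, l, v.2) - B w z (v.1, v.2, l)) -
      ∑ l : Letter, l.sign • (-B v z (l, w.1, w.2) + B v z (w.1, l, w.2) - B v z (w.1, w.2, l)) +
      ∑ l : Letter, l.sign • (-B v w (l, z.1, z.2) + B v w (z.1, l, z.2) - B v w (z.1, z.2, l))) :
    comb222 T = (2 : ℤ) • comb223 B := by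
  have h1 : ∑ p : (Letter × Letter) × (Letter × Letter) × (Letter × Letter),
      (ins1 backward p.1 * forwardWord p.2.1 * backwardWord p.2.2) •
      ∑ l : Letter, l.sign • (-B p.2.1 p.2.2 (l, p.1.1, p.1.2) + B p.2.1 p.2.2 (p.1.1, l, p.1.2) -
        B p.2.1 p.2.2 (p.1.1, p.1.2, l)) = 0 := by
    have a0 := sum_insert
      (⟨fun p => (p.1.2.1, p.1.2.2, (p.2, p.1.1.1, p.1.1.2)),
        fun y => (((y.2.2.2.1, y.2.2.2.2), y.1, y.2.1), y.2.2.1),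
        fun _ => rfl, fun _ => rfl⟩)
      (fun p : (Letter × Letter) × (Letter × Letter) × (Letter × Letter) =>
        ins1 backward p.1 * forwardWord p.2.1 * backwardWord p.2.2)
      fun y : (Letter × Letter) × (Letter × Letter) × (Letter × Letter × Letter) =>
          B y.1 y.2.1 y.2.2
    have a1 := sum_insert
      (⟨fun p => (p.1.2.1, p.1.2.2, (p.1.1.1, p.2, p.1.1.2)),
        fun y => (((y.2.2.1, y.2.2.2.2), y.1, y.2.1), y.2.2.2.1),
        fun _ => rfl, fun _ => rfl⟩)
      (fun p : (Letter × Letter) × (Letter × Letter) × (Letter × Letter) =>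
        ins1 backward p.1 * forwardWord p.2.1 * backwardWord p.2.2)
      fun y : (Letter × Letter) × (Letter × Letter) × (Letter × Letter × Letter) =>
          B y.1 y.2.1 y.2.2
    have a2 := sum_insert
      (⟨fun p => (p.1.2.1, p.1.2.2, (p.1.1.1, p.1.1.2, p.2)),
        fun y => (((y.2.2.1, y.2.2.2.1), y.1, y.2.1), y.2.2.2.2),
        fun _ => rfl, fun _ => rfl⟩)
      (fun p : (Letter × Letter) × (Letter × Letter) × (Letter × Letter) =>
        ins1 backward p.1 * forwardWord p.2.1 * backwardWord p.2.2)
      fun y : (Letter × Letter) × (Letter × Letter) × (Letter × Letter × Letter) =>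
          B y.1 y.2.1 y.2.2
    simp only [Equiv.coe_fn_mk, Equiv.coe_fn_symm_mk] at a0 a1 a2
    simp only [smul_add, smul_sub, smul_neg, Finset.sum_add_distrib, Finset.sum_sub_distrib,
      Finset.sum_neg_distrib, a0, a1, a2]
    simp only [← Finset.sum_neg_distrib, ← Finset.sum_add_distrib, ← Finset.sum_sub_distrib,
      ← neg_smul, ← add_smul, ← sub_smul]
    refine Finset.sum_eq_zero fun y _ => ?_
    convert zero_smul ℤ _ using 2
    have h := ins2_ins1_backward y.2.2
    rw [ins2] at h
    linear_combination forwardWord y.1 * backwardWord y.2.1 * h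
  have h2 : ∑ p : (Letter × Letter) × (Letter × Letter) × (Letter × Letter),
      (ins1 backward p.1 * forwardWord p.2.1 * backwardWord p.2.2) •
      ∑ l : Letter, l.sign • (-B p.1 p.2.2 (l, p.2.1.1, p.2.1.2) + B p.1 p.2.2 (p.2.1.1, l,
          p.2.1.2) -
        B p.1 p.2.2 (p.2.1.1, p.2.1.2, l)) = -comb223 B := by
    have a0 := sum_insert
      (⟨fun p => (p.1.1, p.1.2.2, (p.2, p.1.2.1.1, p.1.2.1.2)),
        fun y => ((y.1, (y.2.2.2.1, y.2.2.2.2), y.2.1), y.2.2.1),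
        fun _ => rfl, fun _ => rfl⟩)
      (fun p : (Letter × Letter) × (Letter × Letter) × (Letter × Letter) =>
        ins1 backward p.1 * forwardWord p.2.1 * backwardWord p.2.2)
      fun y : (Letter × Letter) × (Letter × Letter) × (Letter × Letter × Letter) =>
          B y.1 y.2.1 y.2.2
    have a1 := sum_insert
      (⟨fun p => (p.1.1, p.1.2.2, (p.1.2.1.1, p.2, p.1.2.1.2)),
        fun y => ((y.1, (y.2.2.1, y.2.2.2.2), y.2.1), y.2.2.2.1),
        fun _ => rfl, fun _ => rfl⟩)
      (fun p : (Letter × Letter) × (Letter × Letter) × (Letter × Letter) =>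
        ins1 backward p.1 * forwardWord p.2.1 * backwardWord p.2.2)
      fun y : (Letter × Letter) × (Letter × Letter) × (Letter × Letter × Letter) =>
          B y.1 y.2.1 y.2.2
    have a2 := sum_insert
      (⟨fun p => (p.1.1, p.1.2.2, (p.1.2.1.1, p.1.2.1.2, p.2)),
        fun y => ((y.1, (y.2.2.1, y.2.2.2.1), y.2.1), y.2.2.2.2),
        fun _ => rfl, fun _ => rfl⟩)
      (fun p : (Letter × Letter) × (Letter × Letter) × (Letter × Letter) =>
        ins1 backward p.1 * forwardWord p.2.1 * backwardWord p.2.2)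
      fun y : (Letter × Letter) × (Letter × Letter) × (Letter × Letter × Letter) =>
          B y.1 y.2.1 y.2.2
    simp only [Equiv.coe_fn_mk, Equiv.coe_fn_symm_mk] at a0 a1 a2
    simp only [smul_add, smul_sub, smul_neg, Finset.sum_add_distrib, Finset.sum_sub_distrib,
      Finset.sum_neg_distrib, a0, a1, a2]
    simp only [← Finset.sum_neg_distrib, ← Finset.sum_add_distrib, ← Finset.sum_sub_distrib,
      ← neg_smul, ← add_smul, ← sub_smul]
    rw [comb223, ← Finset.sum_neg_distrib]
    -- Turning the graph around fixes dα, takes γ to β, and takes dβ to -dγ; this is where the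
    -- contribution of the second arm is matched with that of the third.
    refine Fintype.sum_equiv reverse _ _ fun y => ?_
    simp only [reverse, Equiv.coe_fn_mk, hB, ← neg_smul]
    refine congrArg (· • _) ?_
    have h := ins2_forwardWord_rev (y.2.2.2.2.rev, y.2.2.2.1.rev, y.2.2.1.rev)
    have hw := backwardWord_rev (y.2.1.2.rev, y.2.1.1.rev)
    simp only [Letter.rev_rev] at h hw
    rw [show ins2 forwardWord (y.2.2.1, y.2.2.2.1, y.2.2.2.2) =
      -(y.2.2.1.sign * forwardWord (y.2.2.2.1, y.2.2.2.2)) +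
        y.2.2.2.1.sign * forwardWord (y.2.2.1, y.2.2.2.2) -
        y.2.2.2.2.sign * forwardWord (y.2.2.1, y.2.2.2.1) from rfl] at h
    rw [ins1_backward_rev, ← hw]
    linear_combination ins1 backward y.1 * backwardWord y.2.1 * h
  have h3 : ∑ p : (Letter × Letter) × (Letter × Letter) × (Letter × Letter),
      (ins1 backward p.1 * forwardWord p.2.1 * backwardWord p.2.2) •
      ∑ l : Letter, l.sign • (-B p.1 p.2.1 (l, p.2.2.1, p.2.2.2) + B p.1 p.2.1 (p.2.2.1, l,
          p.2.2.2) -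
        B p.1 p.2.1 (p.2.2.1, p.2.2.2, l)) = comb223 B := by
    have a0 := sum_insert
      (⟨fun p => (p.1.1, p.1.2.1, (p.2, p.1.2.2.1, p.1.2.2.2)),
        fun y => ((y.1, y.2.1, (y.2.2.2.1, y.2.2.2.2)), y.2.2.1),
        fun _ => rfl, fun _ => rfl⟩)
      (fun p : (Letter × Letter) × (Letter × Letter) × (Letter × Letter) =>
        ins1 backward p.1 * forwardWord p.2.1 * backwardWord p.2.2)
      fun y : (Letter × Letter) × (Letter × Letter) × (Letter × Letter × Letter) =>
          B y.1 y.2.1 y.2.2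
    have a1 := sum_insert
      (⟨fun p => (p.1.1, p.1.2.1, (p.1.2.2.1, p.2, p.1.2.2.2)),
        fun y => ((y.1, y.2.1, (y.2.2.1, y.2.2.2.2)), y.2.2.2.1),
        fun _ => rfl, fun _ => rfl⟩)
      (fun p : (Letter × Letter) × (Letter × Letter) × (Letter × Letter) =>
        ins1 backward p.1 * forwardWord p.2.1 * backwardWord p.2.2)
      fun y : (Letter × Letter) × (Letter × Letter) × (Letter × Letter × Letter) =>
          B y.1 y.2.1 y.2.2
    have a2 := sum_insert
      (⟨fun p => (p.1.1, p.1.2.1, (p.1.2.2.1, p.1.2.2.2, p.2)),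
        fun y => ((y.1, y.2.1, (y.2.2.1, y.2.2.2.1)), y.2.2.2.2),
        fun _ => rfl, fun _ => rfl⟩)
      (fun p : (Letter × Letter) × (Letter × Letter) × (Letter × Letter) =>
        ins1 backward p.1 * forwardWord p.2.1 * backwardWord p.2.2)
      fun y : (Letter × Letter) × (Letter × Letter) × (Letter × Letter × Letter) =>
          B y.1 y.2.1 y.2.2
    simp only [Equiv.coe_fn_mk, Equiv.coe_fn_symm_mk] at a0 a1 a2
    simp only [smul_add, smul_sub, smul_neg, Finset.sum_add_distrib, Finset.sum_sub_distrib,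
      Finset.sum_neg_distrib, a0, a1, a2]
    simp only [← Finset.sum_neg_distrib, ← Finset.sum_add_distrib, ← Finset.sum_sub_distrib,
      ← neg_smul, ← add_smul, ← sub_smul]
    refine Finset.sum_congr rfl fun y _ => congrArg (· • _) ?_
    simp only [show ∀ u : Letter × Letter × Letter, ins2 backwardWord u =
      -(u.1.sign * backwardWord (u.2.1, u.2.2)) + u.2.1.sign * backwardWord (u.1, u.2.2) -
        u.2.2.sign * backwardWord (u.1, u.2.1) from fun _ => rfl]
    ring
  have h : comb222 T = 0 - -comb223 B + comb223 B := by
    rw [← h2, ← h3, ← h1, ← Finset.sum_sub_distrib, ← Finset.sum_add_distrib, comb222]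
    refine Finset.sum_congr rfl fun p _ => ?_
    rw [hT, smul_add, smul_sub]
  rw [h, two_smul, zero_sub, neg_neg]

end Combination

end BiGC

end

noncomputable section

namespace BiGC

open MvPolynomial

variable {K : Type*} [Field K]

/-! ### Relabelling graphs -/

theorem mem_arrows_mapV {V W : Type} (f : V → W) (c : Letter → Bool) {L : List (V × V × Letter)}
    {u v : V} (h : (u, v) ∈ arrows c L) : (f u, f v) ∈ arrows c (mapV f L) := by
  obtain ⟨e, he, h⟩ := List.mem_map.1 h
  refine List.mem_map.2 ⟨(f e.1, f e.2.1, e.2.2), List.mem_map.2 ⟨e, he, rfl⟩, ?_⟩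
  split_ifs at h ⊢ <;> simp_all

theorem hasBlackCycle_mapV {V W : Type} (f : V → W) {L : List (V × V × Letter)}
    (h : (graph L).HasBlackCycle) : (graph (mapV f L)).HasBlackCycle := by
  obtain ⟨v, h⟩ := h
  refine ⟨f v, Relation.TransGen.lift f (fun a b hab => ?_) _ _ h⟩
  exact (black_graph _ _ _).2 (mem_arrows_mapV f _ ((black_graph _ _ _).1 hab))

theorem hasRedCycle_mapV {V W : Type} (f : V → W) {L : List (V × V × Letter)}
    (h : (graph L).HasRedCycle) : (graph (mapV f L)).HasRedCycle := by
  obtain ⟨v, h⟩ := h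
  refine ⟨f v, Relation.TransGen.lift f (fun a b hab => ?_) _ _ h⟩
  exact (red_graph _ _ _).2 (mem_arrows_mapV f _ ((red_graph _ _ _).1 hab))

theorem mapV_symm_mapV {V W : Type} (τ : V ≃ W) (L : List (V × V × Letter)) :
    mapV τ.symm (mapV τ L) = L := by
  rw [mapV, mapV, List.map_map]
  exact List.map_id'' (fun e => by simp) L

theorem connected_mapV {V W : Type} (τ : V ≃ W) {L : List (V × V × Letter)}
    (h : (graph L).Connected) : (graph (mapV τ L)).Connected := by
  have hb : ∀ a b, (graph (mapV τ L)).Black (τ a) (τ b) ↔ (graph L).Black a b := by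
    intro a b
    rw [black_graph, black_graph]
    refine ⟨fun h => ?_, mem_arrows_mapV τ _⟩
    simpa [mapV_symm_mapV] using mem_arrows_mapV τ.symm Prod.fst h
  refine (SimpleGraph.Iso.connected_iff ⟨τ, fun {a b} => ?_⟩).1 h
  simp only [SimpleGraph.fromRel_adj, hb, ne_eq, EmbeddingLike.apply_eq_iff_eq]

theorem hasShape_mapV {n : ℕ} {V : Type} {S : Multiset (Sym2 (Fin n))} (ρ : Fin n ≃ V)
    (τ : V ≃ V) {L : List (V × V × Letter)}
    (hS : S.map (Sym2.map ρ) = ↑(L.map fun e => s(e.1, e.2.1))) :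
    (graph (mapV τ L)).HasShape S := by
  refine ⟨ρ.trans τ, ?_⟩
  rw [shape_graph, mapV, List.map_map, Equiv.coe_trans, Sym2.map_comp, ← Multiset.map_map, hS,
    Multiset.map_coe, List.map_map]
  rfl

/-- The combinations of the graphs with a given property. -/
def combinations (K : Type*) [Field K] {p : ℕ} (Q : BiGraph (Fin (p + 1)) → Prop) :
    Submodule K (Gra K p) :=
  restrictSupport K {G | Q G}

theorem mem_combinations {p : ℕ} {Q : BiGraph (Fin (p + 1)) → Prop} {f : Gra K p} :
    f ∈ combinations K Q ↔ ∀ G ∈ f.support, Q G := .rfl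

theorem alt_prodE_mem {p : ℕ} {Q : BiGraph (Fin (p + 1)) → Prop}
    {L : List (Fin (p + 1) × Fin (p + 1) × Letter)}
    (h : ∀ τ : Equiv.Perm (Fin (p + 1)), Q (graph (mapV τ L))) :
    alt (prodE K L) ∈ combinations K Q := by
  rw [alt_apply]
  refine Submodule.sum_mem _ fun τ _ => zsmul_mem ?_ _
  rw [Gra.perm, rename_prodE, prodE_eq_monomial]
  intro G hG
  have := support_monomial_subset hG
  rw [Finset.mem_singleton.1 this]
  exact h τ

/-! ### The graphs of the cocycle -/

theorem backward_ne_zero : ∀ x, backward x ≠ 0 → x.2 = false := by decide +kernel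

theorem forwardWord_ne_zero : ∀ w, forwardWord w ≠ 0 →
    w.1.2 = true ∧ w.2.2 = true ∧ w.1.1 ≠ w.2.1 := by decide +kernel

theorem backwardWord_ne_zero : ∀ w, backwardWord w ≠ 0 →
    w.1.2 = false ∧ w.2.2 = false ∧ w.1.1 ≠ w.2.1 := by decide +kernel

/-- Both black directions occur already in β. Words with all red arrows forward arise only by
inserting pp or mp into β, and these insertions cancel. This excludes cycles in Θ. -/
theorem ins2_forwardWord_ne_zero : ∀ w, ins2 forwardWord w ≠ 0 →
    ¬ (w.1.1 = w.2.1.1 ∧ w.2.1.1 = w.2.2.1) ∧ ¬ (w.1.2 = w.2.1.2 ∧ w.2.1.2 = w.2.2.2) := by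
  decide +kernel

theorem ins2_backwardWord_ne_zero : ∀ w, ins2 backwardWord w ≠ 0 →
    ¬ (w.1.1 = w.2.1.1 ∧ w.2.1.1 = w.2.2.1) ∧ ¬ (w.1.2 = w.2.1.2 ∧ w.2.1.2 = w.2.2.2) := by
  decide +kernel

theorem acyclic_theta133 : ∀ x w1 w2 w3 z1 z2 z3 : Bool,
    ¬ (w1 = w2 ∧ w2 = w3) → ¬ (z1 = z2 ∧ z2 = z3) → acyclic 6 (arrows Prod.snd (theta133 (x, x)
      (w1, w1) (w2, w2) (w3, w3) (z1, z1) (z2, z2) (z3, z3))) = true := by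
  decide +kernel

theorem cyclicArms_eq_false : (∀ x w1 w2 z1 z2 z3 : Bool, w1 ≠ w2 → ¬ (z1 = z2 ∧ z2 = z3) →
    cyclicArms [x] [w1, w2] [z1, z2, z3] = false) ∧
    ∀ v1 v2 w1 w2 z1 z2 : Bool, w1 ≠ w2 → z1 ≠ z2 →
      cyclicArms [v1, v2] [w1, w2] [z1, z2] = false := by
  decide

theorem adj_graph {V : Type} {L : List (V × V × Letter)} {s t : V}
    (h : ∃ e ∈ L, e.1 = s ∧ e.2.1 = t) (hst : s ≠ t) :
    (SimpleGraph.fromRel (graph L).Black).Adj s t := by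
  obtain ⟨⟨_, _, b, r⟩, he, rfl, rfl⟩ := h
  refine (SimpleGraph.fromRel_adj _ _ _).2 ⟨hst, ?_⟩
  rw [black_graph, black_graph, arrows, List.mem_map, List.mem_map]
  cases b
  · exact .inr ⟨_, he, rfl⟩
  · exact .inl ⟨_, he, rfl⟩

theorem connected_of_parent {n : ℕ} {L : List (Fin (n + 1) × Fin (n + 1) × Letter)}
    (f : Fin (n + 1) → Fin (n + 1)) (hf : ∀ v, v ≠ 0 → f v < v)
    (h : ∀ v, v ≠ 0 → ∃ e ∈ L, e.1 = f v ∧ e.2.1 = v) : (graph L).Connected := by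
  have h0 : ∀ v, (SimpleGraph.fromRel (graph L).Black).Reachable 0 v := by
    intro v
    induction v using WellFoundedLT.induction with
    | ind v ih =>
      by_cases hv : v = 0
      · rw [hv]
      · exact (ih _ (hf v hv)).trans (adj_graph (h v hv) (hf v hv).ne).reachable
  exact ⟨fun u v => (h0 u).symm.trans (h0 v)⟩

theorem connected_theta123 (x w1 w2 z1 z2 z3 : Letter) :
    (graph (theta123 x w1 w2 z1 z2 z3)).Connected :=
  connected_of_parent ![0, 0, 0, 0, 3] (by decide) fun v => by fin_cases v <;> simp [theta123]

theorem connected_theta222 (v1 v2 w1 w2 z1 z2 : Letter) :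
    (graph (theta222 v1 v2 w1 w2 z1 z2)).Connected := by
  -- The far trivalent vertex is not adjacent to 0, so it is renumbered from 1 to 2 to have a parent
  -- with a smaller number.
  rw [← mapV_symm_mapV (Equiv.swap 1 2) (theta222 v1 v2 w1 w2 z1 z2)]
  exact connected_mapV _ <| connected_of_parent ![0, 0, 1, 0, 0] (by decide) fun v => by
    fin_cases v <;> simp [theta222, mapV, Equiv.swap_apply_def]

theorem connected_theta133 (x w1 w2 w3 z1 z2 z3 : Letter) :
    (graph (theta133 x w1 w2 w3 z1 z2 z3)).Connected :=
  connected_of_parent ![0, 0, 0, 2, 0, 4] (by decide) fun v => by fin_cases v <;> simp [theta133]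

theorem hasShape_theta123 (τ : Equiv.Perm (Fin 5)) (x w1 w2 z1 z2 z3 : Letter) :
    (graph (mapV τ (theta123 x w1 w2 z1 z2 z3))).HasShape shapeA := by
  have h : shapeA.map (Sym2.map (permOf ![2, 1, 4, 0, 3] ![3, 1, 0, 4, 2] (by decide))) =
      ↑([s(0, 1), s(0, 2), s(2, 1), s(0, 3), s(3, 4), s(4, 1)] : List (Sym2 (Fin 5))) := by
    decide +kernel
  exact hasShape_mapV _ τ h

theorem hasShape_theta222 (τ : Equiv.Perm (Fin 5)) (v1 v2 w1 w2 z1 z2 : Letter) :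
    (graph (mapV τ (theta222 v1 v2 w1 w2 z1 z2))).HasShape shapeB := by
  have h : shapeB.map (Sym2.map (permOf ![4, 3, 1, 0, 2] ![3, 2, 4, 1, 0] (by decide))) =
      ↑([s(0, 2), s(2, 1), s(0, 3), s(3, 1), s(0, 4), s(4, 1)] : List (Sym2 (Fin 5))) := by
    decide +kernel
  exact hasShape_mapV _ τ h

theorem hasShape_theta133 (τ : Equiv.Perm (Fin 6)) (x w1 w2 w3 z1 z2 z3 : Letter) :
    (graph (mapV τ (theta133 x w1 w2 w3 z1 z2 z3))).HasShape shapeC := by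
  let ρ : Equiv.Perm (Fin 6) := ⟨![2, 4, 1, 0, 5, 3], ![3, 2, 0, 5, 1, 4], by decide, by decide⟩
  have h : shapeC.map (Sym2.map ρ) = ↑([s(0, 1), s(0, 2), s(2, 3), s(3, 1), s(0, 4), s(4, 5),
      s(5, 1)] : List (Sym2 (Fin 6))) := by
    decide +kernel
  exact hasShape_mapV ρ τ h

theorem not_hasBlackCycle_mapV {V : Type} (τ : V ≃ V) {L : List (V × V × Letter)}
    (h : ¬ (graph L).HasBlackCycle) : ¬ (graph (mapV τ L)).HasBlackCycle :=
  fun h' => h (mapV_symm_mapV τ L ▸ hasBlackCycle_mapV τ.symm h')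

theorem not_hasRedCycle_mapV {V : Type} (τ : V ≃ V) {L : List (V × V × Letter)}
    (h : ¬ (graph L).HasRedCycle) : ¬ (graph (mapV τ L)).HasRedCycle :=
  fun h' => h (mapV_symm_mapV τ L ▸ hasRedCycle_mapV τ.symm h')

/-- The graphs of the primitive of the cocycle. -/
def PrimitiveGraph (G : BiGraph (Fin 5)) : Prop :=
  G.Connected ∧ ¬ G.HasBlackCycle ∧ G.HasRedCycle ∧ (G.HasShape shapeA ∨ G.HasShape shapeB)

/-- The graphs of the cocycle. -/
def CocycleGraph (G : BiGraph (Fin 6)) : Prop :=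
  G.Connected ∧ ¬ G.HasBlackCycle ∧ ¬ G.HasRedCycle ∧ G.HasShape shapeC

theorem comb123_mem : comb123 (fun x w z => alt (p := 4)
    (prodE K (theta123 x w.1 w.2 z.1 z.2.1 z.2.2))) ∈ combinations K PrimitiveGraph := by
  refine Submodule.sum_mem _ fun ⟨x, w, z⟩ _ => ?_
  by_cases h : backward x * forwardWord w * ins2 backwardWord z = 0
  · rw [h, zero_smul]
    exact Submodule.zero_mem _
  · simp only [mul_eq_zero, not_or] at h
    obtain ⟨⟨hx, hw⟩, hz⟩ := h
    have hx := backward_ne_zero _ hx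
    obtain ⟨hw1, hw2, hw⟩ := forwardWord_ne_zero _ hw
    have hz := (ins2_backwardWord_ne_zero _ hz).1
    refine zsmul_mem (alt_prodE_mem fun τ => ⟨connected_mapV τ (connected_theta123 ..),
      not_hasBlackCycle_mapV τ (not_hasBlackCycle 5 (acyclic_theta123 _ _ _ _ _ _
        (cyclicArms_eq_false.1 _ _ _ _ _ _ hw hz))),
      hasRedCycle_mapV τ (hasRedCycle_of_reachable (reachable_theta123 _ _ _ _ _ _ ?_)),
      .inl (hasShape_theta123 ..)⟩) _
    simp [cyclicArms, hx, hw1, hw2]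

theorem comb222_mem : comb222 (fun v w z => alt (p := 4)
    (prodE K (theta222 v.1 v.2 w.1 w.2 z.1 z.2))) ∈ combinations K PrimitiveGraph := by
  refine Submodule.sum_mem _ fun ⟨v, w, z⟩ _ => ?_
  by_cases h : ins1 backward v * forwardWord w * backwardWord z = 0
  · rw [h, zero_smul]
    exact Submodule.zero_mem _
  · simp only [mul_eq_zero, not_or] at h
    obtain ⟨⟨-, hw⟩, hz⟩ := h
    obtain ⟨hw1, hw2, hw⟩ := forwardWord_ne_zero _ hw
    obtain ⟨hz1, hz2, hz⟩ := backwardWord_ne_zero _ hz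
    refine zsmul_mem (alt_prodE_mem fun τ => ⟨connected_mapV τ (connected_theta222 ..),
      not_hasBlackCycle_mapV τ (not_hasBlackCycle 5 (acyclic_theta222 _ _ _ _ _ _
        (cyclicArms_eq_false.2 _ _ _ _ _ _ hw hz))),
      hasRedCycle_mapV τ (hasRedCycle_of_reachable (reachable_theta222 _ _ _ _ _ _ ?_)),
      .inr (hasShape_theta222 ..)⟩) _
    simp [cyclicArms, hw1, hw2, hz1, hz2]

/-- The sum of the numberings of a theta graph with arms of lengths 1, 3, 3. -/
def alt133 (K : Type*) [Field K] (x : Letter) (w z : Letter × Letter × Letter) : Gra K 5 :=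
  alt (p := 5) (prodE K (theta133 x w.1 w.2.1 w.2.2 z.1 z.2.1 z.2.2))

theorem comb133_mem : comb133 (alt133 K) ∈ combinations (p := 5) K CocycleGraph := by
  rw [comb133]
  refine sum_mem fun p _ => ?_
  obtain ⟨x, w, z⟩ := p
  by_cases h : backward x * ins2 forwardWord w * ins2 backwardWord z = 0
  · rw [h, zero_smul]
    exact Submodule.zero_mem _
  · simp only [mul_eq_zero, not_or] at h
    obtain ⟨⟨-, hw⟩, hz⟩ := h
    obtain ⟨hw1, hw2⟩ := ins2_forwardWord_ne_zero _ hw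
    obtain ⟨hz1, hz2⟩ := ins2_backwardWord_ne_zero _ hz
    have hL : ∀ τ : Equiv.Perm (Fin 6), CocycleGraph (graph (mapV τ
        (theta133 x w.1 w.2.1 w.2.2 z.1 z.2.1 z.2.2))) := fun τ =>
      ⟨connected_mapV τ (connected_theta133 ..),
        not_hasBlackCycle_mapV τ (not_hasBlackCycle 6 (acyclic_theta133 _ _ _ _ _ _ _ hw1 hz1)),
        not_hasRedCycle_mapV τ (not_hasRedCycle 6 (acyclic_theta133 _ _ _ _ _ _ _ hw2 hz2)),
        hasShape_theta133 ..⟩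
    have hm : alt133 K x w z ∈ combinations (p := 5) K CocycleGraph := alt_prodE_mem (p := 5) hL
    exact zsmul_mem (S := Submodule K (Gra K 5)) hm _

end BiGC

end

/-! ### Existence of the pair -/

noncomputable section

namespace BiGC

open MvPolynomial

variable {K : Type*} [Field K]

/-! ### The differential of the primitive -/

theorem map_comb123 {M N H : Type*} [AddCommGroup M] [AddCommGroup N] [FunLike H M N]
    [AddMonoidHomClass H M N] (F : H)
    (T : Letter → Letter × Letter → Letter × Letter × Letter → M) :
    F (comb123 T) = comb123 fun x w z => F (T x w z) := by
  simp only [comb123, map_sum, map_zsmul]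

theorem map_comb222 {M N H : Type*} [AddCommGroup M] [AddCommGroup N] [FunLike H M N]
    [AddMonoidHomClass H M N] (F : H)
    (T : Letter × Letter → Letter × Letter → Letter × Letter → M) :
    F (comb222 T) = comb222 fun v w z => F (T v w z) := by
  simp only [comb222, map_sum, map_zsmul]

theorem map_comb133 {M N H : Type*} [AddCommGroup M] [AddCommGroup N] [FunLike H M N]
    [AddMonoidHomClass H M N] (F : H)
    (T : Letter → Letter × Letter × Letter → Letter × Letter × Letter → M) :
    F (comb133 T) = comb133 fun x w z => F (T x w z) := by
  simp only [comb133, map_sum, map_zsmul]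

/-- The negative of the differential of combinations of graphs with five vertices. -/
def differential (K : Type*) [Field K] : Gra K 4 →+ Gra K 5 :=
  AddMonoidHom.mk' (fun g => Gra.circ g (mc K) - Gra.circ (mc K) g) fun a b => by
    have h1 : Gra.circ (a + b) (mc K) = Gra.circ a (mc K) + Gra.circ b (mc K) := by
      simp only [Gra.circ, Gra.comp, Gra.perm, map_add, add_mul, smul_add, Finset.sum_add_distrib]
    have h2 : Gra.circ (mc K) (a + b) = Gra.circ (mc K) a + Gra.circ (mc K) b := by
      simp only [Gra.circ, Gra.comp, Gra.perm, map_add, mul_add, map_mul, smul_add,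
        Finset.sum_add_distrib]
    rw [h1, h2]
    exact add_sub_add_comm _ _ _ _

/-- The sum of the numberings of a theta graph with arms of lengths 1, 2, 3. -/
def alt123 (K : Type*) [Field K] (x : Letter) (w : Letter × Letter)
    (z : Letter × Letter × Letter) : Gra K 4 :=
  alt (p := 4) (prodE K (theta123 x w.1 w.2 z.1 z.2.1 z.2.2))

/-- The sum of the numberings of a theta graph with arms of lengths 2, 2, 2. -/
def alt222 (K : Type*) [Field K] (v w z : Letter × Letter) : Gra K 4 :=
  alt (p := 4) (prodE K (theta222 v.1 v.2 w.1 w.2 z.1 z.2))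

/-- The sum of the numberings of a theta graph with arms of lengths 2, 2, 3. -/
def alt223 (K : Type*) [Field K] (v w : Letter × Letter) (z : Letter × Letter × Letter) : Gra K 5 :=
  alt (p := 5) (prodE K (theta223 v.1 v.2 w.1 w.2 z.1 z.2.1 z.2.2))

/-- The sum of the numberings of a theta graph with arms of lengths 1, 2, 4. -/
def alt124 (K : Type*) [Field K] (x : Letter) (w : Letter × Letter)
    (z : Letter × Letter × Letter × Letter) : Gra K 5 :=
  alt (p := 5) (prodE K (theta124 x w.1 w.2 z.1 z.2.1 z.2.2.1 z.2.2.2))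

/-- The renumbering (0 1)(4 5) that turns the theta graph around is even. -/
theorem alt223_rev (v w : Letter × Letter) (z : Letter × Letter × Letter) :
    alt223 K (v.2.rev, v.1.rev) (w.2.rev, w.1.rev) (z.2.2.rev, z.2.1.rev, z.1.rev) =
      alt223 K v w z := by
  let ρ : Equiv.Perm (Fin 6) := ⟨![1, 0, 2, 3, 5, 4], ![1, 0, 2, 3, 5, 4], by decide, by decide⟩
  have hρ : ((Equiv.Perm.sign ρ : ℤˣ) : ℤ) = 1 := by decide +kernel
  have h : prodE K (theta223 v.2.rev v.1.rev w.2.rev w.1.rev z.2.2.rev z.2.1.rev z.1.rev) =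
      prodE K (mapV ρ (theta223 v.1 v.2 w.1 w.2 z.1 z.2.1 z.2.2)) := by
    simp only [prodE, theta223, mapV, List.map_cons, List.map_nil, List.prod_cons, List.prod_nil,
      E_rev]
    change E K 2 0 v.2 * (E K 1 2 v.1 * (E K 3 0 w.2 * (E K 1 3 w.1 * (E K 4 0 z.2.2 *
      (E K 5 4 z.2.1 * (E K 1 5 z.1 * 1)))))) = E K 1 2 v.1 * (E K 2 0 v.2 * (E K 1 3 w.1 *
      (E K 3 0 w.2 * (E K 1 5 z.1 * (E K 5 4 z.2.1 * (E K 4 0 z.2.2 * 1))))))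
    ring
  rw [alt223, alt223, h, alt_prodE, hρ, one_smul]

theorem differential_alt123 (x : Letter) (w : Letter × Letter) (z : Letter × Letter × Letter) :
    differential K (alt123 K x w z) =
      ∑ l : Letter, l.sign • (-alt223 K (l, x) w z + alt223 K (x, l) w z) +
      ∑ l : Letter, l.sign • (-alt133 K x (l, w.1, w.2) z + alt133 K x (w.1, l, w.2) z -
        alt133 K x (w.1, w.2, l) z) +
      ∑ l : Letter, l.sign • (alt124 K x w (l, z.1, z.2.1, z.2.2) -
        alt124 K x w (z.1, l, z.2.1, z.2.2) + alt124 K x w (z.1, z.2.1, l, z.2.2) -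
        alt124 K x w (z.1, z.2.1, z.2.2, l)) := by
  refine (circ_alt_theta123 x w.1 w.2 z.1 z.2.1 z.2.2).trans ?_
  simp only [Letter.sgn_smul]
  rw [← Finset.sum_add_distrib, ← Finset.sum_add_distrib]
  refine Finset.sum_congr rfl fun l _ => ?_
  rw [← smul_add, ← smul_add]
  refine congrArg (l.sign • ·) ?_
  simp only [alt223, alt133, alt124]
  abel

theorem differential_alt222 (v w z : Letter × Letter) : differential K (alt222 K v w z) =
      ∑ l : Letter, l.sign • (-alt223 K w z (l, v.1, v.2) + alt223 K w z (v.1, l, v.2) -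
        alt223 K w z (v.1, v.2, l)) -
      ∑ l : Letter, l.sign • (-alt223 K v z (l, w.1, w.2) + alt223 K v z (w.1, l, w.2) -
        alt223 K v z (w.1, w.2, l)) +
      ∑ l : Letter, l.sign • (-alt223 K v w (l, z.1, z.2) + alt223 K v w (z.1, l, z.2) -
        alt223 K v w (z.1, z.2, l)) := by
  refine (circ_alt_theta222 v.1 v.2 w.1 w.2 z.1 z.2).trans ?_
  simp only [Letter.sgn_smul]
  rw [← Finset.sum_sub_distrib, ← Finset.sum_add_distrib]
  refine Finset.sum_congr rfl fun l _ => ?_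
  rw [← smul_sub, ← smul_add]
  refine congrArg (l.sign • ·) ?_
  simp only [alt223]
  abel

/-- A combination of theta graphs whose alternating sum is the primitive. -/
def seed (K : Type*) [Field K] : Gra K 4 :=
  (2 : ℤ) • comb123 (fun x w z => prodE K (theta123 x w.1 w.2 z.1 z.2.1 z.2.2)) -
    comb222 fun v w z => prodE K (theta222 v.1 v.2 w.1 w.2 z.1 z.2)

theorem alt_seed : alt (p := 4) (seed K) = (2 : ℤ) • comb123 (alt123 K) - comb222 (alt222 K) := by
  rw [seed, map_sub, map_zsmul]
  have h1 : (fun x w z => alt (p := 4) (prodE K (theta123 x w.1 w.2 z.1 z.2.1 z.2.2))) =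
    alt123 K := rfl
  have h2 : (fun v w z => alt (p := 4) (prodE K (theta222 v.1 v.2 w.1 w.2 z.1 z.2))) =
    alt222 K := rfl
  rw [map_comb123, map_comb222, h1, h2]

/-- The combination 2(α|β|dγ) - (dα|β|γ) is chosen such that the graphs with arms 2, 2, 3 cancel. -/
theorem differential_alt_seed :
    differential K (alt (p := 4) (seed K)) = (2 : ℤ) • comb133 (alt133 K) := by
  rw [alt_seed, map_sub, map_zsmul, map_comb123, map_comb222,
    comb123_eq _ _ _ differential_alt123, comb222_eq _ alt223_rev differential_alt222, smul_add,
    add_sub_cancel_left]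

theorem alternating_comb133 : Alternating (p := 5) ((2 : ℤ) • comb133 (alt133 K)) := by
  have h : comb133 (alt133 K) = alt (p := 5) (comb133 fun x w z =>
      prodE K (theta133 x w.1 w.2.1 w.2.2 z.1 z.2.1 z.2.2)) :=
    (map_comb133 (alt (K := K) (p := 5)) _).symm
  rw [h, ← map_zsmul]
  exact alternating_alt (p := 5) _

theorem differential_alt_seed_mem :
    differential K (alt (p := 4) (seed K)) ∈ combinations (p := 5) K CocycleGraph := by
  rw [differential_alt_seed]
  exact zsmul_mem (S := Submodule K (Gra K 5)) comb133_mem _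

theorem alt_seed_mem : alt (p := 4) (seed K) ∈ combinations (p := 4) K PrimitiveGraph := by
  rw [alt_seed]
  exact Submodule.sub_mem _ (zsmul_mem comb123_mem _) comb222_mem

theorem delta_single (g : Gra K 4) :
    delta (DFinsupp.single 4 g) = -DFinsupp.single 5 (differential K g) := by
  classical
  ext1 p
  rw [DFinsupp.neg_apply]
  by_cases hp : p = 5
  · subst hp
    rw [delta_apply_five, DFinsupp.single_eq_same, DFinsupp.single_eq_same]
    exact (neg_sub _ _).symm
  · rw [DFinsupp.single_eq_of_ne hp, neg_zero, delta, bracket, DFinsupp.sum,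
      DFinsupp.finsetSum_apply]
    refine Finset.sum_eq_zero fun i hi => ?_
    rw [DFinsupp.sum, DFinsupp.finsetSum_apply]
    refine Finset.sum_eq_zero fun j hj => ?_
    have hi : i = 1 := Finset.mem_singleton.1 (DFinsupp.support_single_subset hi)
    have hj : j = 4 := Finset.mem_singleton.1 (DFinsupp.support_single_subset hj)
    subst hi hj
    rw [DFinsupp.sub_apply, DFinsupp.smul_apply, DFinsupp.single_eq_of_ne hp,
      DFinsupp.single_eq_of_ne hp, smul_zero, sub_zero]

/-! ### The primitive does not vanish -/

theorem sum_mul_mul {X Y Z : Type*} [Fintype X] [Fintype Y] [Fintype Z] (a : X → ℤ) (b : Y → ℤ)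
    (c : Z → ℤ) : ∑ p : X × Y × Z, a p.1 * b p.2.1 * c p.2.2 =
      (∑ x, a x) * ((∑ y, b y) * ∑ z, c z) := by
  rw [Fintype.sum_prod_type, ← mul_assoc, Finset.sum_mul, Finset.sum_mul]
  refine Finset.sum_congr rfl fun x _ => ?_
  rw [Fintype.sum_prod_type, mul_assoc, Finset.sum_mul_sum, Finset.mul_sum]
  refine Finset.sum_congr rfl fun y _ => ?_
  rw [Finset.mul_sum]
  exact Finset.sum_congr rfl fun z _ => mul_assoc _ _ _

/-- The value of the edge variables at the edges of a theta graph. -/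
def edgeValue (e : BiEdge (Fin 5)) : ℤ :=
  if e ∈ [(0, 1, false), (0, 2, true), (1, 2, false), (0, 3, false), (4, 3, false), (1, 4, true)]
    then 1 else 0

/-- The product of integers, computed such that the second factor is evaluated only if needed. -/
def lazyMul (a b : ℤ) : ℤ := if a = 0 then 0 else a * b

theorem lazyMul_eq (a b : ℤ) : lazyMul a b = a * b := by
  rw [lazyMul]
  split_ifs with h <;> simp [h]

/-- The value of a numbering of the seed. -/
def seedValue (τ : Equiv.Perm (Fin 5)) : ℤ :=
  let q (s t : Fin 5) (l : Letter) : ℤ := edgeValue (edge (τ s) (τ t) l)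
  2 * lazyMul (∑ x, lazyMul (backward x) (q 0 1 x))
    (lazyMul (∑ w, lazyMul (forwardWord w) (lazyMul (q 0 2 w.1) (q 2 1 w.2)))
      (∑ z, lazyMul (ins2 backwardWord z)
        (lazyMul (q 0 3 z.1) (lazyMul (q 3 4 z.2.1) (q 4 1 z.2.2))))) -
  lazyMul (∑ v, lazyMul (ins1 backward v) (lazyMul (q 0 2 v.1) (q 2 1 v.2)))
    (lazyMul (∑ w, lazyMul (forwardWord w) (lazyMul (q 0 3 w.1) (q 3 1 w.2)))
      (∑ z, lazyMul (backwardWord z) (lazyMul (q 0 4 z.1) (q 4 1 z.2))))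

theorem eval_perm_seed (τ : Equiv.Perm (Fin 5)) :
    eval (fun e => (edgeValue e : K)) (Gra.perm (p := 4) τ (seed K)) = (seedValue τ : K) := by
  have hE : ∀ s t l, eval ((fun e => (edgeValue e : K)) ∘ BiEdge.map τ) (E K s t l) =
      (edgeValue (edge (τ s) (τ t) l) : K) := by
    intro s t l
    rw [E, eval_X, Function.comp_apply, map_edge]
  rw [Gra.perm, eval_rename, seed, map_sub, map_zsmul]
  have h1 := map_comb123 (eval ((fun e => (edgeValue e : K)) ∘ BiEdge.map τ))
    fun x w z => prodE K (theta123 x w.1 w.2 z.1 z.2.1 z.2.2)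
  have h2 := map_comb222 (eval ((fun e => (edgeValue e : K)) ∘ BiEdge.map τ))
    fun v w z => prodE K (theta222 v.1 v.2 w.1 w.2 z.1 z.2)
  refine (congrArg₂ (fun a b => (2 : ℤ) • a - b) h1 h2).trans ?_
  simp only [seedValue, lazyMul_eq, ← sum_mul_mul]
  push_cast
  simp only [comb123, comb222, prodE, theta123,
    theta222, List.map_cons, List.map_nil, List.prod_cons, List.prod_nil, map_mul, map_one, hE,
    zsmul_eq_mul]
  push_cast
  congr 1
  · congr 1
    exact Finset.sum_congr rfl fun _ _ => by ring
  · exact Finset.sum_congr rfl fun _ _ => by ring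

/-- The edge variables are set to 1 on the edges of the graph that defines `RedCocycle.scalar` and
to 0 elsewhere; the signed sum over all numberings is then the value of the primitive at this point.
-/
theorem sum_seedValue :
    ∑ τ : Equiv.Perm (Fin 5), ((Equiv.Perm.sign τ : ℤˣ) : ℤ) * seedValue τ ≠ 0 := by
  decide +kernel

theorem alt_seed_ne_zero [CharZero K] : alt (p := 4) (seed K) ≠ 0 := by
  intro h
  have h1 : eval (fun e => (edgeValue e : K)) (alt (p := 4) (seed K)) =
      ((∑ τ : Equiv.Perm (Fin 5), ((Equiv.Perm.sign τ : ℤˣ) : ℤ) * seedValue τ : ℤ) : K) := by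
    rw [alt_apply, map_sum, Int.cast_sum]
    refine Finset.sum_congr rfl fun τ _ => ?_
    rw [map_zsmul, zsmul_eq_mul, Int.cast_mul]
    exact congrArg _ (eval_perm_seed τ)
  rw [h, map_zero] at h1
  exact sum_seedValue (Int.cast_eq_zero.1 h1.symm)

/-! ### The pair -/

theorem single_mem_fGC {p : ℕ} {a : Gra K p} (h : Alternating a) :
    (DFinsupp.single p a : Cochain K) ∈ fGC K := by
  intro q σ
  by_cases hq : q = p
  · subst hq
    rw [DFinsupp.single_eq_same]
    exact h σ
  · rw [DFinsupp.single_eq_of_ne hq, smul_zero, Gra.perm, map_zero]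

theorem eachGraph_single {P : ∀ p : ℕ, BiGraph (Fin (p + 1)) → Prop} {p : ℕ} {a : Gra K p}
    (h : ∀ G ∈ a.support, P p G) : EachGraph P (DFinsupp.single p a : Cochain K) := by
  intro q G hG
  by_cases hq : q = p
  · subst hq
    rw [DFinsupp.single_eq_same] at hG
    exact h G hG
  · rw [DFinsupp.single_eq_of_ne hq] at hG
    simp at hG

variable (K) in
theorem exists_isPair [CharZero K] : ∃ Θ ∈ fcGCBi K, ∃ ϑ ∈ fcGCBlack K,
    IsPair Θ ϑ ∧ OfShapeAB ϑ ∧ RedCocycle.scalar (ϑ 4) ≠ 0 := by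
  set g : Gra K 4 := alt (p := 4) (seed K) with hg
  have hϑ : ∀ G ∈ g.support, PrimitiveGraph G := mem_combinations.1 alt_seed_mem
  have hΘ : ∀ G ∈ (differential K g).support, CocycleGraph G :=
    (mem_combinations (p := 5)).1 differential_alt_seed_mem
  have haΘ : Alternating (p := 5) (differential K g) := by
    rw [differential_alt_seed]
    exact alternating_comb133
  have hmΘ : (DFinsupp.single 5 (differential K g) : Cochain K) ∈ fcGCBi K :=
    ⟨⟨⟨single_mem_fGC haΘ, eachGraph_single fun G hG => (hΘ G hG).1⟩,
      eachGraph_single fun G hG => (hΘ G hG).2.1⟩, eachGraph_single fun G hG => (hΘ G hG).2.2.1⟩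
  have hmϑ : (DFinsupp.single 4 g : Cochain K) ∈ fcGCBlack K :=
    ⟨⟨single_mem_fGC (alternating_alt _), eachGraph_single fun G hG => (hϑ G hG).1⟩,
      eachGraph_single fun G hG => (hϑ G hG).2.1⟩
  have hp : IsPair (DFinsupp.single 5 (differential K g) : Cochain K) (DFinsupp.single 4 g) :=
    ⟨by rw [delta_single, neg_neg], eachGraph_single fun G hG => (hΘ G hG).2.2.2,
      eachGraph_single fun G hG => (hϑ G hG).2.2.1⟩
  refine ⟨_, hmΘ, _, hmϑ, hp, eachGraph_single fun G hG => (hϑ G hG).2.2.2, fun h0 => ?_⟩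
  have hr := hp.redCocycle hmΘ hmϑ
  rw [DFinsupp.single_eq_same] at h0 hr
  -- Were the scalar zero, the uniqueness analysis would make all coefficients at shapes A and B
  -- vanish, and with them the primitive.
  exact alt_seed_ne_zero (eq_zero_of_shape_AB hr.alt (fun G hG => (hϑ G hG).2.2.2)
    (hr.theta123 h0) (hr.theta222 h0))

end BiGC

end

theorem propositionB1 (K : Type*) [Field K] [CharZero K] :
    ∃ Θ ∈ BiGC.fcGCBi K, ∃ ϑ ∈ BiGC.fcGCBlack K,
      BiGC.IsPair Θ ϑ ∧ BiGC.OfShapeAB ϑ ∧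
      (¬ ∃ κ ∈ BiGC.fcGCBi K, Θ = -BiGC.delta κ) ∧
      ∀ Θ' ∈ BiGC.fcGCBi K, ∀ ϑ' ∈ BiGC.fcGCBlack K, BiGC.IsPair Θ' ϑ' →
        (∃ c : K, Θ' = c • Θ) ∧
        (BiGC.OfShapeAB ϑ' → ∃ c : K, Θ' = c • Θ ∧ ϑ' = c • ϑ) := by
  obtain ⟨Θ, hΘ, ϑ, hϑ, hp, hAB, hs⟩ := BiGC.exists_isPair K
  refine ⟨Θ, hΘ, ϑ, hϑ, hp, hAB, hp.not_exact hΘ hϑ hs, fun Θ' hΘ' ϑ' hϑ' hp' => ?_⟩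
  obtain ⟨c, h1, h2⟩ := hp.unique hΘ hϑ hAB hs hp' hΘ' hϑ'
  exact ⟨⟨c, h1⟩, fun h => ⟨c, h1, h2 h⟩⟩
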